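/- All graphs are finite, undirected and simple. The square $H^2$ of a graph $H$ is the graph on the same vertex set in which two distinct vertices are adjacent if and only if their distance in $H$ is at most $2$; $H$ is a square root of $G$ if $H^2=G$. Running times are measured on a random access machine with uniform cost (arithmetic: addition, cut-off subtraction, halving), a graph being given by its adjacency matrix. The problem Tree + $k$ Edges Square Root asks, for a connected graph $G$ with $n$ vertices and $m$ edges and an integer $k\ge 0$, whether $G$ has a square root with at most $n-1+k$ edges. (1) Tree + $k$ Edges Square Root can be solved in time $2^{O(k^4)}+O(n^4m)$. Precisely, there are one algorithm and one constant $C$ such that it takes at most $2^{C(k^4+1)}+C\,n^4m$ steps on every instance. (2) The problem has a generalized kernel of quadratic size: there is an algorithm that, given $(G,k)$, computes within $C(n^4m+1)$ steps, for some constant $C$, a connected graph $\hat G$ with at most $(15k-14)(15k-12)$ vertices and two disjoint sets $\hat R,\hat B$ of edges of $\hat G$ (required and blocked edges), such that $G$ has a square root with at most $n-1+k$ edges if and only if $\hat G$ has a square root with at most $|V_{\hat G}|-1+k$ edges that contains every edge of $\hat R$ and no edge of $\hat B$. (3) For every fixed $k\ge 0$ there is an algorithm that decides in polynomial time, for an arbitrary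 graph $G$, whether $G=F^2$ for some graph $F$ that can be obtained from a tree by adding at most $k$ edges. -/

import Mathlib

namespace TreePlusK

/-! ## Squares, square roots, and the two decision problems -/

/-- The square of a graph: distinct vertices are adjacent iff their distance is at most two.
(`edist` is `⊤` for vertices in different components.) -/
def square {V : Type*} (H : SimpleGraph V) : SimpleGraph V where
  Adj u v := u ≠ v ∧ H.edist u v ≤ 2
  symm := ⟨fun u v h => ⟨h.1.symm, by rw [SimpleGraph.edist_comm]; exact h.2⟩⟩
  loopless := ⟨fun _ h => h.1 rfl⟩

/-- `H` is a square root of `G`. -/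
def IsSquareRoot {V : Type*} (H G : SimpleGraph V) : Prop :=
  square H = G

/-- `H` is a solution of the instance `(G, k)`: a square root of the `n`-vertex graph `G` with at
most `n - 1 + k` edges. -/
def IsSolution {n : ℕ} (G : SimpleGraph (Fin n)) (k : ℕ) (H : SimpleGraph (Fin n)) : Prop :=
  IsSquareRoot H G ∧ H.edgeSet.ncard + 1 ≤ n + k

/-- Has the `n`-vertex graph `G` a square root with at most `n - 1 + k` edges? -/
def YesInstance {n : ℕ} (G : SimpleGraph (Fin n)) (k : ℕ) : Prop :=
  ∃ H : SimpleGraph (Fin n), IsSolution G k H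

/-- A labelled graph: a connected graph on `Fin n` with two disjoint sets of edges, the required
edges and the blocked edges. -/
structure LabelledGraph (n : ℕ) where
  /-- the graph -/
  G : SimpleGraph (Fin n)
  connected : G.Connected
  /-- the required edges -/
  R : Set (Sym2 (Fin n))
  /-- the blocked edges -/
  B : Set (Sym2 (Fin n))
  required_subset : R ⊆ G.edgeSet
  blocked_subset : B ⊆ G.edgeSet
  disjoint : Disjoint R B

/-- Has the labelled graph a square root with at most `n - 1 + k` edges that contains all required
edges and no blocked edge? -/
def LabelledYesInstance {n : ℕ} (L : LabelledGraph n) (k : ℕ) : Prop :=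
  ∃ H : SimpleGraph (Fin n), IsSolution L.G k H ∧ L.R ⊆ H.edgeSet ∧ Disjoint L.B H.edgeSet

/-- `F` can be obtained from a tree by adding at most `k` edges. -/
def IsTreePlus {V : Type*} (k : ℕ) (F : SimpleGraph V) : Prop :=
  ∃ T : SimpleGraph V, T.IsTree ∧ T ≤ F ∧ (F.edgeSet \ T.edgeSet).Finite ∧
    (F.edgeSet \ T.edgeSet).ncard ≤ k

/-- `G` is the square of a graph that is obtained from a tree by adding at most `k` edges. -/
def IsSquareOfTreePlus {V : Type*} (k : ℕ) (G : SimpleGraph V) : Prop :=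
  ∃ F : SimpleGraph V, IsTreePlus k F ∧ square F = G

/-! ## Random access machines

The uniform-cost random access machine with addition, cut-off subtraction and halving, programmed
by structured control flow. A program mentions finitely many registers; the memory is addressed
indirectly through registers. Every instruction and every evaluation of a test takes one step. -/

/-- A state of the machine: the registers and the memory, all holding natural numbers. -/
structure State where
  /-- contents of the registers -/
  reg : ℕ → ℕ
  /-- contents of the memory cells -/
  mem : ℕ → ℕ

/-- Overwrite a register. -/
def State.setReg (s : State) (x v : ℕ) : State :=
  { s with reg := Function.update s.reg x v }

/-- Overwrite a memory cell. -/
def State.setMem (s : State) (a v : ℕ) : State :=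
  { s with mem := Function.update s.mem a v }

/-- Programs. Here `x`, `y`, `z` are names of registers. -/
inductive Prog where
  /-- `x := c` for a constant `c` -/
  | const (x c : ℕ)
  /-- `x := y` -/
  | move (x y : ℕ)
  /-- `x := y + z` -/
  | add (x y z : ℕ)
  /-- `x := y - z`, cut off at zero -/
  | sub (x y z : ℕ)
  /-- `x := ⌊y / 2⌋` -/
  | half (x y : ℕ)
  /-- `x := mem[y]` -/
  | load (x y : ℕ)
  /-- `mem[x] := y` -/
  | store (x y : ℕ)
  /-- first `p`, then `q` -/
  | seq (p q : Prog)
  /-- if `x > 0` then `p` else `q` -/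
  | ifPos (x : ℕ) (p q : Prog)
  /-- while `x > 0` do `p` -/
  | whilePos (x : ℕ) (p : Prog)

/-- `Exec p s t s'`: the program `p`, started in the state `s`, halts after exactly `t` steps, in
the state `s'`. -/
inductive Exec : Prog → State → ℕ → State → Prop where
  | const (s : State) (x c : ℕ) : Exec (.const x c) s 1 (s.setReg x c)
  | move (s : State) (x y : ℕ) : Exec (.move x y) s 1 (s.setReg x (s.reg y))
  | add (s : State) (x y z : ℕ) : Exec (.add x y z) s 1 (s.setReg x (s.reg y + s.reg z))
  | sub (s : State) (x y z : ℕ) : Exec (.sub x y z) s 1 (s.setReg x (s.reg y - s.reg z))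
  | half (s : State) (x y : ℕ) : Exec (.half x y) s 1 (s.setReg x (s.reg y / 2))
  | load (s : State) (x y : ℕ) : Exec (.load x y) s 1 (s.setReg x (s.mem (s.reg y)))
  | store (s : State) (x y : ℕ) : Exec (.store x y) s 1 (s.setMem (s.reg x) (s.reg y))
  | seq {p q : Prog} {s s' s'' : State} {t t' : ℕ} (hp : Exec p s t s') (hq : Exec q s' t' s'') :
      Exec (.seq p q) s (t + t') s''
  | if_pos {x : ℕ} {p q : Prog} {s s' : State} {t : ℕ} (hx : 0 < s.reg x) (hp : Exec p s t s') :
      Exec (.ifPos x p q) s (t + 1) s'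
  | if_zero {x : ℕ} {p q : Prog} {s s' : State} {t : ℕ} (hx : s.reg x = 0) (hq : Exec q s t s') :
      Exec (.ifPos x p q) s (t + 1) s'
  | while_pos {x : ℕ} {p : Prog} {s s' s'' : State} {t t' : ℕ} (hx : 0 < s.reg x)
      (hp : Exec p s t s') (hw : Exec (.whilePos x p) s' t' s'') :
      Exec (.whilePos x p) s (t + t' + 1) s''
  | while_zero {x : ℕ} {p : Prog} {s : State} (hx : s.reg x = 0) :
      Exec (.whilePos x p) s 1 s

open Classical in
/-- The initial state on input `(G, k)`: all registers are zero, and the memory holds `n`, then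
`k`, then the adjacency matrix of `G` row by row, then zeros. -/
noncomputable def inputState {n : ℕ} (G : SimpleGraph (Fin n)) (k : ℕ) : State where
  reg := fun _ => 0
  mem := fun a =>
    if a = 0 then n
    else if a = 1 then k
    else if ∃ i j : Fin n, a = 2 + i.val * n + j.val ∧ G.Adj i j then 1
    else 0

/-- On input `(G, k)`, the program `p` halts within `T` steps, and answers correctly whether `Q`
holds: register `0` finally holds `1` if so, and `0` if not. -/
def DecidesWithin {n : ℕ} (p : Prog) (G : SimpleGraph (Fin n)) (k T : ℕ) (Q : Prop) : Prop :=
  ∃ (t : ℕ) (s : State), Exec p (inputState G k) t s ∧ t ≤ T ∧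
    (Q → s.reg 0 = 1) ∧ (¬ Q → s.reg 0 = 0)

open Classical in
/-- The memory of the state `s` holds the labelled instance `(L, k)`: it starts with `n`, then `k`,
then a matrix, row by row, whose entries are `0` for a pair of non-adjacent vertices, `2` for a
required edge, `3` for a blocked edge, and `1` for any other edge. -/
def State.Holds {n : ℕ} (s : State) (L : LabelledGraph n) (k : ℕ) : Prop :=
  s.mem 0 = n ∧ s.mem 1 = k ∧
    ∀ i j : Fin n, s.mem (2 + i.val * n + j.val) =
      if s(i, j) ∈ L.R then 2
      else if s(i, j) ∈ L.B then 3
      else if L.G.Adj i j then 1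
      else 0

/-- On input `(G, k)`, the program `p` halts within `T` steps, and its output is the labelled
instance `(L, k)`. -/
def OutputsWithin {n n' : ℕ} (p : Prog) (G : SimpleGraph (Fin n)) (k T : ℕ)
    (L : LabelledGraph n') : Prop :=
  ∃ (t : ℕ) (s : State), Exec p (inputState G k) t s ∧ t ≤ T ∧ s.Holds L k

end TreePlusK

namespace TreePlusK
open scoped Classical

/-! ### Squares, edge counts, and labelled instances as matrices -/

section Basic

variable {V V' : Type*}

/-! A connected graph with at most `n - 1 + k` edges has cycle rank at most `k`, so at most `6 * k`
of its vertices are incident to an edge on a cycle of length at most six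
(`exists_shortVerts_subset`). Away from these vertices a square root is locally a tree, and there it
can be read off from its square.

Twins are vertices with the same closed neighbourhood in `G`. Three twins of which two are no leaves
of the root force a short cycle, so among `6 * k + 3` twins one is a leaf in every root with few
edges. A further twin can then be deleted, or attached as a leaf next to that one (`solvable_kept`).
This bounds all classes of twins by `6 * k + 3`.

A root edge `uv` on no short cycle, with further neighbours at both ends, divides the common
neighbours of `u` and `v` in `G` into two cliques without edges between them
(`split_of_not_isShort`). Conversely, such a division in `G` forces the edge `uv` and, unless `u`
and `v` are twins, all edges at `u` and `v` in every root (`Split.root_left`). Leaves attached to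
such ends are also visible, and a root with the fewest edges joins them to nothing else. Vertices
treated in this way are settled. The unsettled vertices and their settled neighbours form the core.
They lie on short cycles or are leaves attached to vertices on short cycles, and leaves with the
same neighbour are twins, so the core has quadratic size (`card_inCore_le`).

Outside the core only known edges matter. The outside is replaced by a gadget joined to one settled
vertex of every component of the core. The gadget reconnects the components, and its cycle rank `δ`
accounts for the edges lost; required and blocked edges fix everything at settled vertices
(`solvable_kernelLabel_iff`). Counting edges of a smallest root gives `0 ≤ δ ≤ k`
(`IsMinRoot.exists_excess`). If one of the conditions fails in a large graph, the answer is no, and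
a path with three vertices is output.

The recognition of edges is a formula with five nested quantifiers, hence takes time `O(n ^ 5)`,
which is `O(n ^ 4 * m)` up to an additive constant. The kernel has at most `36 * k ^ 2 + 26 * k + 8`
vertices, or at most `k`, and exhaustive search on it costs `2 ^ O(k ^ 4)`. This is below `(15 * k -
14) * (15 * k - 12)` except for `k = 1`, where the kernel is decided outright and replaced by a
fixed instance. For arbitrary graphs connectivity is tested first. The programs are written as
expressions and statements whose compiled machine code is proved correct with exact step counts;
loops cost one factor `n + 1` per level of nesting. -/

/-- `x` and `y` are joined by a walk of length one or two. -/
def WithinTwo (H : SimpleGraph V) (x y : V) : Prop :=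
  H.Adj x y ∨ ∃ c, H.Adj x c ∧ H.Adj c y

theorem WithinTwo.symm {H : SimpleGraph V} {x y : V} (h : WithinTwo H x y) : WithinTwo H y x := by
  rcases h with h | ⟨c, h1, h2⟩
  · exact Or.inl h.symm
  · exact Or.inr ⟨c, h2.symm, h1.symm⟩

/-- Between distinct vertices a walk of length at most two has one or two edges; from here on this
replaces `edist`. -/
theorem square_adj {H : SimpleGraph V} {x y : V} :
    (square H).Adj x y ↔ x ≠ y ∧ WithinTwo H x y := by
  change x ≠ y ∧ H.edist x y ≤ 2 ↔ _
  refine and_congr_right fun hne => ⟨fun h => ?_, fun h => ?_⟩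
  · obtain ⟨w, hw⟩ := SimpleGraph.exists_walk_of_edist_ne_top (ne_top_of_le_ne_top (by simp) h)
    rw [← hw] at h
    have h2 : w.length ≤ 2 := by exact_mod_cast h
    cases w with
    | nil => exact absurd rfl hne
    | cons h1 p =>
      cases p with
      | nil => exact Or.inl h1
      | cons h3 q =>
        cases q with
        | nil => exact Or.inr ⟨_, h1, h3⟩
        | cons h4 r => simp at h2
  · rcases h with h | ⟨c, h1, h2⟩
    · exact (SimpleGraph.edist_le h.toWalk).trans (by simp)
    · exact (SimpleGraph.edist_le (SimpleGraph.Walk.cons h1 (.cons h2 .nil))).trans (by simp)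

theorem le_square (H : SimpleGraph V) : H ≤ square H := fun _ _ h =>
  square_adj.2 ⟨h.ne, Or.inl h⟩

theorem square_connected_iff {H : SimpleGraph V} : (square H).Connected ↔ H.Connected := by
  refine ⟨fun h => ?_, fun h => h.mono (le_square H)⟩
  have : Nonempty V := h.nonempty
  refine SimpleGraph.Connected.mk fun x y => ?_
  obtain ⟨w⟩ := h.preconnected x y
  induction w with
  | nil => exact .refl _
  | cons h1 p ih =>
    refine SimpleGraph.Reachable.trans ?_ ih
    rcases (square_adj.1 h1).2 with h | ⟨c, h2, h3⟩
    · exact h.reachable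
    · exact h2.reachable.trans h3.reachable

theorem mem_of_closed {H : SimpleGraph V} (hH : H.Connected) {D : Set V} {x : V}
    (hx : x ∈ D) (hD : ∀ a ∈ D, ∀ b, H.Adj a b → b ∈ D) (y : V) : y ∈ D := by
  obtain ⟨w⟩ := hH.preconnected x y
  induction w with
  | nil => exact hx
  | cons h p ih => exact ih (hD _ hx _ h)

theorem sum_sum_indicator [Fintype V] (P : V → V → Prop) [∀ x y, Decidable (P x y)] :
    (∑ x, ∑ y, if P x y then 1 else 0) =
      (Finset.univ.filter fun p : V × V => P p.1 p.2).card := by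
  rw [Finset.card_filter, Fintype.sum_prod_type]

/-- The number of ordered pairs of adjacent vertices. -/
noncomputable def adjCount [Fintype V] (H : SimpleGraph V) : ℕ :=
  ∑ x, ∑ y, if H.Adj x y then 1 else 0

/-- Counting ordered pairs turns edge numbers into double sums, which split over parts of the vertex
set and can be evaluated by two nested loops. -/
theorem adjCount_eq [Fintype V] (H : SimpleGraph V) : adjCount H = 2 * H.edgeSet.ncard := by
  have h := H.sum_degrees_eq_twice_card_edges
  rw [← SimpleGraph.coe_edgeFinset, Set.ncard_coe_finset, ← h]
  refine Finset.sum_congr rfl fun x _ => ?_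
  rw [← SimpleGraph.card_neighborFinset_eq_degree, Finset.sum_boole]
  simp only [Nat.cast_id]
  congr 1
  ext y
  simp

theorem two_mul_card_le_of_connected [Fintype V] {H : SimpleGraph V} (hH : H.Connected) :
    2 * Fintype.card V ≤ adjCount H + 2 := by
  have h := hH.card_vert_le_card_edgeSet_add_one
  rw [Nat.card_eq_fintype_card, Nat.card_coe_set_eq] at h
  rw [adjCount_eq]
  omega

/-- The quotient of `H` along `f` is connected, and each of its edges lifts to an edge of `H`
between different fibres. This serves to bound the edges outside the core from below. -/
theorem two_mul_card_le_of_surjective [Fintype V] [Fintype V'] {H : SimpleGraph V}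
    (hH : H.Connected) (f : V → V') (hf : Function.Surjective f) :
    2 * Fintype.card V' ≤ (∑ a, ∑ b, if H.Adj a b ∧ f a ≠ f b then 1 else 0) + 2 := by
  obtain ⟨Q, hQ'⟩ : ∃ Q : SimpleGraph V',
      ∀ p q, Q.Adj p q ↔ p ≠ q ∧ ∃ a b, H.Adj a b ∧ f a = p ∧ f b = q :=
    ⟨{ Adj := fun p q => p ≠ q ∧ ∃ a b, H.Adj a b ∧ f a = p ∧ f b = q
       symm := ⟨fun p q ⟨h, a, b, h1, h2, h3⟩ => ⟨h.symm, b, a, h1.symm, h3, h2⟩⟩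
       loopless := ⟨fun p h => h.1 rfl⟩ }, fun _ _ => Iff.rfl⟩
  have hQ : Q.Connected := by
    have : Nonempty V := hH.nonempty
    have : Nonempty V' := this.map f
    refine SimpleGraph.Connected.mk fun p q => ?_
    obtain ⟨a, rfl⟩ := hf p
    obtain ⟨b, rfl⟩ := hf q
    obtain ⟨w⟩ := hH.preconnected a b
    induction w with
    | nil => exact .refl _
    | @cons u v _ h1 p ih =>
      refine SimpleGraph.Reachable.trans ?_ ih
      by_cases h : f u = f v
      · rw [h]
      · exact SimpleGraph.Adj.reachable ((hQ' _ _).2 ⟨h, _, _, h1, rfl, rfl⟩)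
  refine (two_mul_card_le_of_connected hQ).trans (Nat.add_le_add_right ?_ 2)
  unfold adjCount
  rw [sum_sum_indicator, sum_sum_indicator]
  refine (Finset.card_le_card ?_).trans (Finset.card_image_le (f := Prod.map f f))
  rintro ⟨p, q⟩ h
  obtain ⟨hne, a, b, h1, rfl, rfl⟩ := (hQ' _ _).1 (Finset.mem_filter.1 h).2
  exact Finset.mem_image.2 ⟨(a, b), by simp [h1, hne], rfl⟩

/-- A labelled instance, given by a matrix of labels, has a solution: `0` stands for a non-edge,
`2` for a required edge, `3` for a blocked edge, and any other label for an edge. -/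
def Solvable [Fintype V] (ℓ : V → V → ℕ) (k : ℕ) : Prop :=
  ∃ H : SimpleGraph V, (∀ x y, x ≠ y → (ℓ x y ≠ 0 ↔ WithinTwo H x y)) ∧
    (∀ x y, ℓ x y = 2 → H.Adj x y) ∧ (∀ x y, ℓ x y = 3 → ¬ H.Adj x y) ∧
    adjCount H + 2 ≤ 2 * Fintype.card V + 2 * k

/-- `H` is a square root of `G` with at most `|V| - 1 + k` edges. -/
def IsRoot [Fintype V] (G : SimpleGraph V) (k : ℕ) (H : SimpleGraph V) : Prop :=
  square H = G ∧ adjCount H + 2 ≤ 2 * Fintype.card V + 2 * k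

/-- The matrix of labels of an unlabelled graph. -/
noncomputable def plainLabel (G : SimpleGraph V) (x y : V) : ℕ := if G.Adj x y then 1 else 0

theorem solvable_plainLabel [Fintype V] {G : SimpleGraph V} {k : ℕ} :
    Solvable (plainLabel G) k ↔ ∃ H, IsRoot G k H := by
  refine exists_congr fun H => ⟨fun ⟨h1, _, _, h4⟩ => ⟨?_, h4⟩, fun ⟨h1, h4⟩ => ⟨?_, ?_, ?_, h4⟩⟩
  · ext x y
    rw [square_adj]
    by_cases h : x = y
    · subst h; simp
    · have := h1 x y h
      simp only [plainLabel] at this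
      grind
  · intro x y h
    have : (square H).Adj x y ↔ G.Adj x y := by rw [h1]
    rw [square_adj] at this
    simp only [plainLabel]
    grind
  · intro x y; simp only [plainLabel]; grind
  · intro x y; simp only [plainLabel]; grind

theorem yesInstance_iff {n : ℕ} {G : SimpleGraph (Fin n)} {k : ℕ} :
    YesInstance G k ↔ Solvable (plainLabel G) k := by
  rw [solvable_plainLabel]
  refine exists_congr fun H => ?_
  unfold IsSolution IsRoot IsSquareRoot
  rw [adjCount_eq, Fintype.card_fin]
  refine and_congr_right fun _ => ?_
  omega

theorem withinTwo_comap {e : V ≃ V'} {H : SimpleGraph V'} {x y : V} :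
    WithinTwo (H.comap e) x y ↔ WithinTwo H (e x) (e y) := by
  unfold WithinTwo
  simp only [SimpleGraph.comap_adj]
  rw [e.surjective.exists]

theorem adjCount_comap [Fintype V] [Fintype V'] (e : V ≃ V') (H : SimpleGraph V') :
    adjCount (H.comap e) = adjCount H := by
  unfold adjCount
  simp only [SimpleGraph.comap_adj]
  rw [← e.sum_comp]
  exact Finset.sum_congr rfl fun x _ => e.sum_comp (fun y => if H.Adj (e x) y then 1 else 0)

theorem Solvable.comap [Fintype V] [Fintype V'] (e : V ≃ V') {ℓ : V' → V' → ℕ} {k : ℕ}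
    (h : Solvable ℓ k) : Solvable (fun x y => ℓ (e x) (e y)) k := by
  obtain ⟨H, h1, h2, h3, h4⟩ := h
  refine ⟨H.comap e, fun x y hne => ?_, fun x y h => h2 _ _ h, fun x y h => h3 _ _ h, ?_⟩
  · rw [withinTwo_comap]; exact h1 _ _ (e.injective.ne hne)
  · rw [adjCount_comap, Fintype.card_congr e]; exact h4

theorem solvable_comap_iff [Fintype V] [Fintype V'] (e : V ≃ V') {ℓ : V' → V' → ℕ} {k : ℕ} :
    Solvable (fun x y => ℓ (e x) (e y)) k ↔ Solvable ℓ k :=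
  ⟨fun h => by simpa using h.comap e.symm, fun h => h.comap e⟩

/-- The graph described by a symmetric matrix of labels with zero diagonal. -/
def labelGraph (ℓ : V → V → ℕ) (hs : ∀ x y, ℓ x y = ℓ y x) (h0 : ∀ x, ℓ x x = 0) :
    SimpleGraph V where
  Adj x y := ℓ x y ≠ 0
  symm := ⟨fun x y h => by rwa [hs]⟩
  loopless := ⟨fun x h => h (h0 x)⟩

/-- The set of edges with a given label. -/
def labelSet (ℓ : V → V → ℕ) (c : ℕ) : Set (Sym2 V) := {e | ∃ x y, e = s(x, y) ∧ ℓ x y = c}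

theorem mem_labelSet {ℓ : V → V → ℕ} (hs : ∀ x y, ℓ x y = ℓ y x) {c : ℕ} {x y : V} :
    s(x, y) ∈ labelSet ℓ c ↔ ℓ x y = c := by
  constructor
  · rintro ⟨a, b, h, h1⟩
    rcases Sym2.eq_iff.1 h with ⟨rfl, rfl⟩ | ⟨rfl, rfl⟩
    · exact h1
    · rw [hs]; exact h1
  · exact fun h => ⟨x, y, rfl, h⟩

/-- The labelled graph described by a matrix of labels. -/
def LabelledGraph.ofLabel {n : ℕ} (ℓ : Fin n → Fin n → ℕ) (hs : ∀ x y, ℓ x y = ℓ y x)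
    (h0 : ∀ x, ℓ x x = 0) (hc : (labelGraph ℓ hs h0).Connected) : LabelledGraph n where
  G := labelGraph ℓ hs h0
  connected := hc
  R := labelSet ℓ 2
  B := labelSet ℓ 3
  required_subset := by
    rintro _ ⟨x, y, rfl, h⟩
    exact show ℓ x y ≠ 0 by omega
  blocked_subset := by
    rintro _ ⟨x, y, rfl, h⟩
    exact show ℓ x y ≠ 0 by omega
  disjoint := by
    rw [Set.disjoint_left]
    intro e
    refine Sym2.ind (fun x y => ?_) e
    rw [mem_labelSet hs, mem_labelSet hs]
    omega

theorem labelledYesInstance_ofLabel {n k : ℕ} {ℓ : Fin n → Fin n → ℕ} {hs : ∀ x y, ℓ x y = ℓ y x}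
    {h0 : ∀ x, ℓ x x = 0} {hc : (labelGraph ℓ hs h0).Connected} :
    LabelledYesInstance (LabelledGraph.ofLabel ℓ hs h0 hc) k ↔ Solvable ℓ k := by
  refine exists_congr fun H => ?_
  have e1 : square H = labelGraph ℓ hs h0 ↔ ∀ x y, x ≠ y → (ℓ x y ≠ 0 ↔ WithinTwo H x y) := by
    constructor
    · intro h x y hne
      have : (square H).Adj x y ↔ ℓ x y ≠ 0 := by rw [h]; rfl
      rw [← this, square_adj]
      simp [hne]
    · intro h
      ext x y
      change _ ↔ ℓ x y ≠ 0
      rw [square_adj]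
      by_cases hne : x = y
      · subst hne; simp [h0]
      · rw [h x y hne]; simp [hne]
  have e2 : labelSet ℓ 2 ⊆ H.edgeSet ↔ ∀ x y, ℓ x y = 2 → H.Adj x y := by
    constructor
    · exact fun h x y hxy => h ⟨x, y, rfl, hxy⟩
    · rintro h _ ⟨x, y, rfl, hxy⟩
      exact h x y hxy
  have e3 : Disjoint (labelSet ℓ 3) H.edgeSet ↔ ∀ x y, ℓ x y = 3 → ¬ H.Adj x y := by
    rw [Set.disjoint_left]
    constructor
    · exact fun h x y hxy => h ⟨x, y, rfl, hxy⟩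
    · rintro h _ ⟨x, y, rfl, hxy⟩
      exact h x y hxy
  unfold IsSolution IsSquareRoot
  rw [adjCount_eq, Fintype.card_fin, ← e1, ← e2, ← e3]
  change (_ ∧ _) ∧ _ ∧ _ ↔ _
  constructor
  · rintro ⟨⟨h1, h2⟩, h3, h4⟩
    exact ⟨h1, h3, h4, by omega⟩
  · rintro ⟨h1, h3, h4, h2⟩
    exact ⟨⟨h1, by omega⟩, h3, h4⟩

/-- `Solvable` takes any nonzero label for an edge, whereas the output format prescribes `1` for
ordinary edges; for labels up to `3` the two encodings coincide. -/
theorem holds_ofLabel {n k : ℕ} {ℓ : Fin n → Fin n → ℕ} {hs : ∀ x y, ℓ x y = ℓ y x}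
    {h0 : ∀ x, ℓ x x = 0} {hc : (labelGraph ℓ hs h0).Connected} (hℓ : ∀ x y, ℓ x y ≤ 3)
    {s : State} (hn : s.mem 0 = n) (hk : s.mem 1 = k)
    (hm : ∀ i j : Fin n, s.mem (2 + i.val * n + j.val) = ℓ i j) :
    s.Holds (LabelledGraph.ofLabel ℓ hs h0 hc) k := by
  refine ⟨hn, hk, fun i j => ?_⟩
  rw [hm]
  simp only [LabelledGraph.ofLabel, mem_labelSet hs, labelGraph]
  have := hℓ i j
  have h : ∀ a, a ≤ 3 → a = if a = 2 then 2 else if a = 3 then 3 else if a ≠ 0 then 1 else 0 := by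
    decide
  convert h _ this
  split_ifs with h
  · exact if_pos h
  · exact if_neg h

/-- A spanning tree has `n - 1` edges, so a tree plus at most `k` edges is the same as a connected
graph with at most `n - 1 + k` edges; and a graph is connected if and only if its square is. -/
theorem isSquareOfTreePlus_iff {n k : ℕ} {G : SimpleGraph (Fin n)} :
    IsSquareOfTreePlus k G ↔ G.Connected ∧ YesInstance G k := by
  have key : ∀ T F : SimpleGraph (Fin n), T.IsTree → T ≤ F →
      (F.edgeSet \ T.edgeSet).ncard + n = F.edgeSet.ncard + 1 := by
    intro T F hT hle
    have h1 := (SimpleGraph.isTree_iff_connected_and_card.1 hT).2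
    rw [Nat.card_coe_set_eq, Nat.card_fin] at h1
    have h2 := Set.ncard_sdiff_add_ncard_of_subset (SimpleGraph.edgeSet_mono hle)
    omega
  constructor
  · rintro ⟨F, ⟨T, hT, hle, _, hk⟩, rfl⟩
    refine ⟨square_connected_iff.2 (hT.connected.mono hle), F, rfl, ?_⟩
    have := key T F hT hle
    omega
  · rintro ⟨hc, F, rfl, hk⟩
    obtain ⟨T, hle, hT⟩ := (square_connected_iff.1 hc).exists_isTree_le
    refine ⟨F, ⟨T, hT, hle, Set.toFinite _, ?_⟩, rfl⟩
    have := key T F hT hle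
    omega

end Basic

end TreePlusK

namespace TreePlusK
open scoped Classical

/-! ### Edges on cycles of length at most six -/

section Short

variable {V : Type*}

/-- The edge `uv` lies on a cycle of length at most six. -/
def IsShort (H : SimpleGraph V) (u v : V) : Prop :=
  H.Adj u v ∧ ∃ p : (H.deleteEdges {s(u, v)}).Walk u v, p.length ≤ 5

theorem IsShort.symm {H : SimpleGraph V} {u v : V} (h : IsShort H u v) : IsShort H v u := by
  obtain ⟨h1, p, hp⟩ := h
  refine ⟨h1.symm, ?_⟩
  rw [Sym2.eq_swap]
  exact ⟨p.reverse, by simpa using hp⟩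

theorem deleteEdge_adj {H : SimpleGraph V} {u v x y : V} (h : H.Adj x y)
    (h' : ¬ ((x = u ∧ y = v) ∨ (x = v ∧ y = u))) : (H.deleteEdges {s(u, v)}).Adj x y := by
  rw [SimpleGraph.deleteEdges_adj]
  exact ⟨h, fun he => h' (Sym2.eq_iff.1 he)⟩

theorem IsShort.of_three {H : SimpleGraph V} {u a v : V} (h : H.Adj u v) (h1 : H.Adj u a)
    (h2 : H.Adj a v) : IsShort H u v := by
  have := h1.ne; have := h2.ne; have := h.ne
  exact ⟨h, .cons (deleteEdge_adj h1 (by grind)) (.cons (deleteEdge_adj h2 (by grind)) .nil),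
    by simp⟩

/-- Any walk avoiding the edge `uv` will do, so its inner vertices need not be distinct; the
inequalities keep its steps off `uv`. -/
theorem IsShort.of_four {H : SimpleGraph V} {u a b v : V} (h : H.Adj u v) (h1 : H.Adj u a)
    (h2 : H.Adj a b) (h3 : H.Adj b v) (hav : a ≠ v) (hbu : b ≠ u) : IsShort H u v := by
  have := h1.ne; have := h2.ne; have := h.ne; have := h3.ne
  exact ⟨h, .cons (deleteEdge_adj h1 (by grind)) (.cons (deleteEdge_adj h2 (by grind))
    (.cons (deleteEdge_adj h3 (by grind)) .nil)), by simp⟩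

theorem IsShort.of_five {H : SimpleGraph V} {u a b c v : V} (h : H.Adj u v) (h1 : H.Adj u a)
    (h2 : H.Adj a b) (h3 : H.Adj b c) (h4 : H.Adj c v) (hav : a ≠ v) (hbv : b ≠ v)
    (hcu : c ≠ u) : IsShort H u v := by
  have := h1.ne; have := h2.ne; have := h.ne; have := h3.ne; have := h4.ne
  exact ⟨h, .cons (deleteEdge_adj h1 (by grind)) (.cons (deleteEdge_adj h2 (by grind))
    (.cons (deleteEdge_adj h3 (by grind)) (.cons (deleteEdge_adj h4 (by grind)) .nil))), by simp⟩

theorem IsShort.of_six {H : SimpleGraph V} {u a b c d v : V} (h : H.Adj u v) (h1 : H.Adj u a)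
    (h2 : H.Adj a b) (h3 : H.Adj b c) (h4 : H.Adj c d) (h5 : H.Adj d v) (hav : a ≠ v)
    (hbv : b ≠ v) (hcv : c ≠ v) (hdu : d ≠ u) : IsShort H u v := by
  have := h1.ne; have := h2.ne; have := h.ne; have := h3.ne; have := h4.ne; have := h5.ne
  exact ⟨h, .cons (deleteEdge_adj h1 (by grind)) (.cons (deleteEdge_adj h2 (by grind))
    (.cons (deleteEdge_adj h3 (by grind)) (.cons (deleteEdge_adj h4 (by grind))
    (.cons (deleteEdge_adj h5 (by grind)) .nil)))), by simp⟩

/-- The vertices incident to an edge on a cycle of length at most six. -/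
def shortVerts (H : SimpleGraph V) : Set V := {u | ∃ v, IsShort H u v}

/-- The edges `F` can be removed from any connected subgraph containing `H[D]` without
disconnecting it. -/
structure Removable (H : SimpleGraph V) (D : Finset V) (F : Finset (Sym2 V)) (r : ℕ) : Prop where
  card_le : D.card ≤ 6 * r
  card_eq : F.card = r
  subset : ∀ e ∈ F, ∀ x ∈ e, x ∈ D
  edges : ∀ e ∈ F, e ∈ H.edgeSet
  connected : ∀ H' ≤ H, H'.Connected → (∀ a ∈ D, ∀ b ∈ D, H.Adj a b → H'.Adj a b) →
    (H'.deleteEdges F).Connected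

/-- The cycle through `w` is added to `D`, and its edge at `w` to `F`. That edge is no bridge, and
since `w` is outside the old `D`, deleting it leaves `H[D]` intact, so that the old edges can still
be removed afterwards. -/
theorem Removable.step {H : SimpleGraph V} {D : Finset V} {F : Finset (Sym2 V)} {r : ℕ}
    (h : Removable H D F r) {w : V} (hw : w ∈ shortVerts H) (hD : w ∉ D) :
    ∃ D' F', Removable H D' F' (r + 1) := by
  obtain ⟨w', hadj, p, hp⟩ := hw
  refine ⟨D ∪ p.support.toFinset, insert s(w, w') F, ?_, ?_, ?_, ?_, ?_⟩
  · have h1 := Finset.card_union_le D p.support.toFinset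
    have h2 := p.support.toFinset_card_le
    have h3 := p.length_support
    have := h.card_le
    omega
  -- The new edge is not in `F`, because its end `w` is outside `D`.
  · rw [Finset.card_insert_of_notMem fun hF => hD (h.subset _ hF _ (by simp)), h.card_eq]
  · intro e he x hx
    rcases Finset.mem_insert.1 he with rfl | he
    · rcases Sym2.mem_iff.1 hx with rfl | rfl <;> simp
    · exact Finset.mem_union_left _ (h.subset _ he _ hx)
  · intro e he
    rcases Finset.mem_insert.1 he with rfl | he
    · exact hadj
    · exact h.edges _ he
  · intro H' hle hc hsub
    -- The rest of the short cycle lies within the new set of vertices, so `H'` contains it.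
    have hq : ∀ e ∈ p.edges, e ∈ (H'.deleteEdges {s(w, w')}).edgeSet := by
      intro e
      refine Sym2.ind (fun a b he => ?_) e
      have h1 := p.adj_of_mem_edges he
      rw [SimpleGraph.deleteEdges_adj] at h1
      rw [SimpleGraph.mem_edgeSet, SimpleGraph.deleteEdges_adj]
      exact ⟨hsub a (by simp [p.fst_mem_support_of_mem_edges he]) b
        (by simp [p.snd_mem_support_of_mem_edges he]) h1.1, h1.2⟩
    have hbr : ¬ H'.IsBridge s(w, w') := by
      rw [SimpleGraph.isBridge_iff]
      exact fun hn => hn ⟨p.transfer _ hq⟩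
    have h2 := h.connected (H'.deleteEdges {s(w, w')}) ((SimpleGraph.deleteEdges_le _).trans hle)
      (hc.connected_delete_edge_of_not_isBridge hbr) (fun a ha b hb hab => by
        rw [SimpleGraph.deleteEdges_adj]
        refine ⟨hsub a (by simp [ha]) b (by simp [hb]) hab, fun he => ?_⟩
        rcases Sym2.eq_iff.1 (Set.mem_singleton_iff.1 he) with ⟨rfl, _⟩ | ⟨_, rfl⟩
        · exact hD ha
        · exact hD hb)
    rw [SimpleGraph.deleteEdges_deleteEdges] at h2
    rwa [Finset.coe_insert, Set.insert_eq]

/-- Greedy choice: as long as some vertex of `shortVerts H` is uncovered, a further edge can be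
removed without disconnecting `H`. Since a connected graph has at least `|V| - 1` edges, this
happens at most `k` times, each time at the expense of at most six vertices. -/
theorem exists_shortVerts_subset [Fintype V] {H : SimpleGraph V} {k : ℕ} (hH : H.Connected)
    (hk : adjCount H + 2 ≤ 2 * Fintype.card V + 2 * k) :
    ∃ D : Finset V, shortVerts H ⊆ D ∧ D.card ≤ 6 * k := by
  have bound : ∀ {D F r}, Removable H D F r → r ≤ k := by
    intro D F r h
    have h1 := two_mul_card_le_of_connected (h.connected H le_rfl hH fun _ _ _ _ h => h)
    rw [adjCount_eq, SimpleGraph.edgeSet_deleteEdges] at h1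
    rw [adjCount_eq] at hk
    have h2 := Set.ncard_sdiff_add_ncard_of_subset (s := (F : Set (Sym2 V))) (t := H.edgeSet)
      (fun e he => h.edges e he)
    rw [Set.ncard_coe_finset, h.card_eq] at h2
    omega
  have key : ∀ r, (∃ D : Finset V, shortVerts H ⊆ D ∧ D.card ≤ 6 * k) ∨
      ∃ D F, Removable H D F r := by
    intro r
    induction r with
    | zero =>
      exact Or.inr ⟨∅, ∅, by simp, by simp, by simp, by simp, fun H' _ h _ => by simpa using h⟩
    | succ r ih =>
      rcases ih with h | ⟨D, F, h⟩
      · exact Or.inl h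
      · by_cases hs : shortVerts H ⊆ D
        · exact Or.inl ⟨D, hs, h.card_le.trans (Nat.mul_le_mul_left 6 (bound h))⟩
        · obtain ⟨w, hw, hD⟩ := Set.not_subset.1 hs
          exact Or.inr (h.step hw hD)
  rcases key (k + 1) with h | ⟨D, F, h⟩
  · exact h
  · have := bound h
    omega

end Short

end TreePlusK

namespace TreePlusK
open scoped Classical

/-! ### Twins and leaves -/

section Twins

variable {V : Type*}

theorem square_eq_iff {H G : SimpleGraph V} :
    square H = G ↔ ∀ x y, x ≠ y → (G.Adj x y ↔ WithinTwo H x y) := by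
  constructor
  · rintro rfl x y h
    rw [square_adj]
    simp [h]
  · intro h
    ext x y
    rw [square_adj]
    by_cases hxy : x = y
    · subst hxy; simp
    · simp [hxy, h x y hxy]

/-- `x` and `y` have the same closed neighbourhood. -/
def Twin (G : SimpleGraph V) (x y : V) : Prop := ∀ z, (G.Adj x z ∨ z = x) ↔ (G.Adj y z ∨ z = y)

theorem Twin.symm {G : SimpleGraph V} {x y : V} (h : Twin G x y) : Twin G y x :=
  fun z => (h z).symm

theorem Twin.trans {G : SimpleGraph V} {x y z : V} (h : Twin G x y) (h' : Twin G y z) :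
    Twin G x z :=
  fun w => (h w).trans (h' w)

theorem Twin.adj {G : SimpleGraph V} {x y : V} (h : Twin G x y) (hne : x ≠ y) : G.Adj x y :=
  (((h y).2 (Or.inr rfl)).resolve_right hne.symm)

/-- `x` has exactly one neighbour. -/
def IsLeaf (H : SimpleGraph V) (x : V) : Prop := ∃ p, ∀ z, H.Adj x z ↔ z = p

theorem exists_adj_ne_of_not_isLeaf {H : SimpleGraph V} {x c : V} (h : ¬ IsLeaf H x)
    (hc : H.Adj x c) : ∃ a, a ≠ c ∧ H.Adj x a := by
  by_contra hcon
  push Not at hcon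
  exact h ⟨c, fun z => ⟨fun hz => by_contra fun hne => hcon z hne hz, fun hz => hz ▸ hc⟩⟩

/-- A second neighbour `a` of `x` is within distance two of the twin `y`. Together with the path `x
c y` this closes a cycle of length at most five through `xc`. -/
theorem isShort_of_twin {G H : SimpleGraph V} (hG : square H = G) {x y c : V} (ht : Twin G x y)
    (hne : x ≠ y) (hna : ¬ H.Adj x y) (hx : ¬ IsLeaf H x) (h1 : H.Adj x c) (h2 : H.Adj c y) :
    IsShort H x c := by
  obtain ⟨a, hac, ha⟩ := exists_adj_ne_of_not_isLeaf hx h1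
  have hay : a ≠ y := fun h => hna (h ▸ ha)
  have h3 : G.Adj y a :=
    ((ht a).1 (Or.inl (hG ▸ le_square H ha))).resolve_right hay
  rcases ((square_eq_iff.1 hG) y a hay.symm).1 h3 with h | ⟨z, h4, h5⟩
  · exact IsShort.of_four h1 ha h.symm h2.symm hac hne.symm
  · by_cases hz : z = c
    · subst hz
      exact IsShort.of_three h1 ha h5.symm
    · exact IsShort.of_five h1 ha h5.symm h4.symm h2.symm hac hz hne.symm

/-- If `x` is not `H`-adjacent to one of the others, `isShort_of_twin` applies to `x`. Otherwise `x
y z` is a triangle, or `y` and `z` are twins joined through `x` and the lemma applies to `y`. Hence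
`z` may be a leaf. -/
theorem mem_shortVerts_of_twins {G H : SimpleGraph V} (hG : square H = G) {x y z : V}
    (hxy : Twin G x y) (hxz : Twin G x z) (hx : ¬ IsLeaf H x) (hy : ¬ IsLeaf H y) (h1 : x ≠ y)
    (h2 : x ≠ z) (h3 : y ≠ z) : x ∈ shortVerts H := by
  have key : ∀ y, Twin G x y → x ≠ y → ¬ H.Adj x y → x ∈ shortVerts H := by
    intro y ht hne hna
    rcases ((square_eq_iff.1 hG) x y hne).1 (ht.adj hne) with h | ⟨c, h1, h2⟩
    · exact absurd h hna
    · exact ⟨c, isShort_of_twin hG ht hne hna hx h1 h2⟩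
  by_cases hy1 : H.Adj x y
  · by_cases hz1 : H.Adj x z
    · by_cases hyz : H.Adj y z
      · exact ⟨y, IsShort.of_three hy1 hz1 hyz.symm⟩
      · exact ⟨y, (isShort_of_twin hG (hxy.symm.trans hxz) h3 hyz hy hy1.symm hz1).symm⟩
    · exact key z hxz h2 hz1
  · exact key y hxy h1 hy1

/-- A set `T` without leaves would consist of vertices on short cycles, of which there are at most
`6 * k`. The excess of three provides two further twins for every member even when `k = 0`. -/
theorem exists_isLeaf_of_twins [Fintype V] {G H : SimpleGraph V} {k : ℕ} (hG : G.Connected)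
    (hH : IsRoot G k H) {T : Finset V} (hT : ∀ x ∈ T, ∀ y ∈ T, Twin G x y)
    (hc : 6 * k + 3 ≤ T.card) : ∃ x ∈ T, IsLeaf H x := by
  by_contra hcon
  push Not at hcon
  have hconn : H.Connected := square_connected_iff.1 (hH.1.symm ▸ hG)
  obtain ⟨D, hD, hcard⟩ := exists_shortVerts_subset hconn hH.2
  have : T ⊆ D := by
    intro x hx
    have h1 : 1 < (T.erase x).card := by
      rw [Finset.card_erase_of_mem hx]; omega
    obtain ⟨y, hy, z, hz, hyz⟩ := Finset.one_lt_card.1 h1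
    rw [Finset.mem_erase] at hy hz
    exact hD (mem_shortVerts_of_twins hH.1 (hT x hx y hy.2) (hT x hx z hz.2) (hcon x hx)
      (hcon y hy.2) hy.1.symm hz.1.symm hyz)
  have := Finset.card_le_card this
  omega

theorem adjCount_option [Fintype V] (H : SimpleGraph (Option V)) (p : V)
    (hp : ∀ z, H.Adj none (some z) ↔ z = p) :
    adjCount H = adjCount (H.comap some) + 2 := by
  unfold adjCount
  have h2 : ∀ z, H.Adj (some z) none ↔ z = p := fun z => by rw [H.adj_comm, hp]
  simp only [Fintype.sum_option, hp, h2, Finset.sum_add_distrib, SimpleGraph.comap_adj]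
  simp
  omega

/-- A leaf is not the middle of a path with two edges, so its deletion only affects pairs containing
it; it lowers the numbers of vertices and of edges by one each. -/
theorem IsRoot.of_leaf [Fintype V] {G H : SimpleGraph (Option V)} {k : ℕ} (hH : IsRoot G k H)
    (hl : IsLeaf H none) : IsRoot (G.comap some) k (H.comap some) := by
  obtain ⟨p, hp⟩ := hl
  cases p with
  | none => exact absurd ((hp none).2 rfl) (H.irrefl)
  | some p =>
    refine ⟨?_, ?_⟩
    · rw [square_eq_iff]
      intro x y hne
      have := (square_eq_iff.1 hH.1) (some x) (some y) (by simpa using hne)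
      rw [SimpleGraph.comap_adj, this]
      unfold WithinTwo
      simp only [SimpleGraph.comap_adj]
      refine or_congr_right ⟨?_, fun ⟨c, h⟩ => ⟨some c, h⟩⟩
      rintro ⟨c, h1, h2⟩
      cases c with
      | none =>
        have e1 := (hp _).1 h1.symm
        have e2 := (hp _).1 h2
        exact absurd (Option.some_injective _ (e1.trans e2.symm)) hne
      | some c => exact ⟨c, h1, h2⟩
    · have h1 := hH.2
      rw [adjCount_option H p (fun z => by rw [hp]; simp), Fintype.card_option] at h1
      omega

/-- Interchanging two twins is an automorphism of `G`. -/
theorem isRoot_comap_swap [Fintype V] [DecidableEq V] {G H : SimpleGraph V} {k : ℕ} (hH : IsRoot G k H) {x y : V}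
    (ht : Twin G x y) : IsRoot G k (H.comap (Equiv.swap x y)) := by
  refine ⟨?_, by rw [adjCount_comap]; exact hH.2⟩
  rw [square_eq_iff]
  intro a b hne
  rw [withinTwo_comap, ← square_eq_iff.1 hH.1 _ _ ((Equiv.swap x y).injective.ne hne)]
  have h1 := ht a
  have h2 := ht b
  have h3 := G.adj_comm a x
  have h4 := G.adj_comm a y
  have h5 := G.adj_comm x y
  simp only [Equiv.swap_apply_def]
  grind

/-- The graph obtained from `H` by attaching a leaf to `p`. -/
def addLeaf (H : SimpleGraph V) (p : V) : SimpleGraph (Option V) where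
  Adj
    | some a, some b => H.Adj a b
    | none, some b => b = p
    | some a, none => a = p
    | none, none => False
  symm := ⟨by
    rintro (_ | a) (_ | b) h
    · exact h
    · exact h
    · exact h
    · exact SimpleGraph.Adj.symm (G := H) h⟩
  loopless := ⟨by
    rintro (_ | a) h
    · exact h
    · exact H.irrefl h⟩

/-- In the square, a leaf at `p` sees exactly the closed `H`-neighbourhood of `p`. The leaf `y`
shows that this is what its twin `none` has to see. -/
theorem isRoot_addLeaf [Fintype V] {G : SimpleGraph (Option V)} {H : SimpleGraph V} {k : ℕ}
    (hH : IsRoot (G.comap some) k H) {y p : V} (hp : ∀ z, H.Adj y z ↔ z = p)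
    (ht : Twin G none (some y)) : IsRoot G k (addLeaf H p) := by
  have hsq := square_eq_iff.1 hH.1
  simp only [SimpleGraph.comap_adj] at hsq
  have hyp : H.Adj y p := (hp p).2 rfl
  have hnone : ∀ b, G.Adj none (some b) ↔ WithinTwo (addLeaf H p) none (some b) := by
    intro b
    have e1 : WithinTwo (addLeaf H p) none (some b) ↔ b = p ∨ H.Adj p b := by
      refine or_congr Iff.rfl ⟨?_, fun h => ⟨some p, rfl, h⟩⟩
      rintro ⟨_ | c, h1, h2⟩
      · exact h1.elim
      · cases (show c = p from h1)
        exact h2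
    have e2 := ht (some b)
    simp only [reduceCtorEq, or_false, Option.some.injEq] at e2
    rw [e1, e2]
    by_cases hb : b = y
    · subst hb
      simp [hyp.symm]
    · rw [hsq y b (Ne.symm hb)]
      unfold WithinTwo
      simp [hp, hb]
  refine ⟨?_, ?_⟩
  · rw [square_eq_iff]
    rintro (_ | a) (_ | b) hne
    · exact absurd rfl hne
    · exact hnone b
    · rw [G.adj_comm, hnone a]
      exact ⟨WithinTwo.symm, WithinTwo.symm⟩
    · have hab : a ≠ b := fun h => hne (h ▸ rfl)
      rw [hsq a b hab]
      refine or_congr Iff.rfl ⟨fun ⟨c, h⟩ => ⟨some c, h⟩, ?_⟩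
      rintro ⟨_ | c, h1, h2⟩
      · exact absurd ((show a = p from h1).trans (show b = p from h2).symm) hab
      · exact ⟨c, h1, h2⟩
  · have h1 := hH.2
    have h2 : (addLeaf H p).comap some = H := rfl
    rw [adjCount_option _ p (fun z => Iff.rfl), Fintype.card_option, h2]
    omega

theorem twin_comap {V' : Type*} {f : V' → V} (hf : Function.Injective f) {G : SimpleGraph V}
    {x y : V'} (h : Twin G (f x) (f y)) : Twin (G.comap f) x y := fun z => by
  have := h (f z)
  rwa [hf.eq_iff, hf.eq_iff] at this

/-- Walks can be rerouted through the twin `y` instead of `none`. -/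
theorem connected_comap_some {G : SimpleGraph (Option V)} (hG : G.Connected) {y : V}
    (ht : Twin G none (some y)) : (G.comap some).Connected := by
  have : Nonempty V := ⟨y⟩
  have key : ∀ u v, G.Adj u v → (G.comap some).Reachable (u.getD y) (v.getD y) := by
    have h0 : ∀ b, G.Adj none (some b) → (G.comap some).Reachable y b := by
      intro b hb
      rcases (ht (some b)).1 (Or.inl hb) with h | h
      · exact SimpleGraph.Adj.reachable h
      · cases h; exact .refl _
    rintro (_ | u) (_ | v) h
    · exact .refl _
    · exact h0 v h
    · exact (h0 u h.symm).symm
    · exact SimpleGraph.Adj.reachable h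
  refine SimpleGraph.Connected.mk fun a b => ?_
  suffices ∀ u v : Option V, (G.comap some).Reachable (u.getD y) (v.getD y) from this (some a) (some b)
  intro u v
  obtain ⟨w⟩ := hG.preconnected u v
  induction w with
  | nil => exact .refl _
  | cons h p ih => exact (key _ _ h).trans ih

/-- In a root of `G`, some twin is a leaf and can be moved to `none` and deleted. In a root of the
smaller graph, the remaining `6 * k + 3` twins still contain a leaf, and `none` is attached beside
it. -/
theorem solvable_comap_some [Fintype V] {G : SimpleGraph (Option V)} {k : ℕ} (hG : G.Connected)
    {T : Finset V} (hT : ∀ y ∈ T, Twin G none (some y)) (hc : 6 * k + 3 ≤ T.card) :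
    Solvable (plainLabel (G.comap some)) k ↔ Solvable (plainLabel G) k := by
  obtain ⟨y0, hy0⟩ : T.Nonempty := Finset.card_pos.1 (by omega)
  rw [solvable_plainLabel, solvable_plainLabel]
  constructor
  · rintro ⟨H, hH⟩
    obtain ⟨y, hy, p, hp⟩ := exists_isLeaf_of_twins (connected_comap_some hG (hT y0 hy0)) hH
      (T := T) (fun a ha b hb => twin_comap (Option.some_injective _)
        ((hT a ha).symm.trans (hT b hb))) hc
    exact ⟨_, isRoot_addLeaf hH hp (hT y hy)⟩
  · rintro ⟨H, hH⟩
    obtain ⟨y, hy, p, hp⟩ := exists_isLeaf_of_twins hG hH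
      (T := T.map Function.Embedding.some) (by
        intro a ha b hb
        rw [Finset.mem_map] at ha hb
        obtain ⟨a, ha, rfl⟩ := ha
        obtain ⟨b, hb, rfl⟩ := hb
        exact (hT a ha).symm.trans (hT b hb)) (by simpa using hc)
    rw [Finset.mem_map] at hy
    obtain ⟨y, hy, rfl⟩ := hy
    -- After the swap with the leaf `y`, the vertex `none` itself is the leaf.
    refine ⟨_, IsRoot.of_leaf (isRoot_comap_swap hH (hT y hy)) ⟨Equiv.swap none (some y) p, ?_⟩⟩
    intro z
    rw [SimpleGraph.comap_adj, Equiv.swap_apply_left]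
    refine (hp _).trans ⟨fun h => ?_, fun h => ?_⟩
    · simp [← h]
    · simp [h]

end Twins

/-! ### Shrinking the classes of twins -/

section Reduction

variable {V : Type*} [Fintype V] [LinearOrder V]

/-- The first `t` vertices of every class of twins. -/
noncomputable def kept (G : SimpleGraph V) (t : ℕ) : Finset V :=
  Finset.univ.filter fun i => (Finset.univ.filter fun j => j < i ∧ Twin G i j).card < t

/-- The least twin of `x` that is not kept has at least `t` smaller twins, and these are all kept.
-/
theorem le_card_twins_kept {G : SimpleGraph V} {t : ℕ} {x : V} (hx : x ∉ kept G t) :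
    t ≤ ((kept G t).filter fun j => Twin G x j).card := by
  by_contra hcon
  push Not at hcon
  obtain ⟨m, hm, hmin⟩ := Finset.exists_min_image
    (Finset.univ.filter fun j => Twin G x j ∧ j ∉ kept G t) id
    ⟨x, Finset.mem_filter.2 ⟨Finset.mem_univ _, fun _ => Iff.rfl, hx⟩⟩
  rw [Finset.mem_filter] at hm
  refine hm.2.2 ?_
  rw [kept, Finset.mem_filter]
  refine ⟨Finset.mem_univ _, lt_of_le_of_lt (Finset.card_le_card ?_) hcon⟩
  intro j hj
  rw [Finset.mem_filter] at hj ⊢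
  have ht := hm.2.1.trans hj.2.2
  refine ⟨by_contra fun hjk => ?_, ht⟩
  exact absurd (hmin j (by simp [ht, hjk])) (not_le.2 hj.2.1)

/-- Induction on the number of deleted vertices. They are deleted one at a time, and each still has
`6 * k + 3` kept twins when its turn comes. -/
theorem kept_aux {G : SimpleGraph V} (hG : G.Connected) {k : ℕ} (d : ℕ) :
    ∀ S : Finset V, kept G (6 * k + 3) ⊆ S → Sᶜ.card = d →
    (G.comap (Subtype.val : S → V)).Connected ∧
    (Solvable (plainLabel (G.comap (Subtype.val : S → V))) k ↔ Solvable (plainLabel G) k) := by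
  induction d with
  | zero =>
    intro S _ hd
    have hS : S = Finset.univ := by simpa using hd
    subst hS
    let e : {x // x ∈ (Finset.univ : Finset V)} ≃ V := Equiv.subtypeUnivEquiv (by simp)
    refine ⟨?_, solvable_comap_iff e (ℓ := plainLabel G)⟩
    exact (SimpleGraph.Iso.connected_iff (SimpleGraph.Iso.comap e G)).2 hG
  | succ d ih =>
    intro S hS hd
    obtain ⟨x, hx⟩ : Sᶜ.Nonempty := Finset.card_pos.1 (by omega)
    rw [Finset.mem_compl] at hx
    obtain ⟨h1, h2⟩ := ih (insert x S) (hS.trans (Finset.subset_insert _ _)) (by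
      rw [Finset.compl_insert, Finset.card_erase_of_mem (by simpa using hx), hd]; rfl)
    let e : Option S ≃ {y // y ∈ insert x S} :=
      { toFun := fun o => o.elim ⟨x, by simp⟩ fun y => ⟨y.1, Finset.mem_insert_of_mem y.2⟩
        invFun := fun y => if h : y.1 ∈ S then some ⟨y.1, h⟩ else none
        left_inv := by rintro (_ | y) <;> simp [hx]
        right_inv := by
          rintro ⟨y, hy⟩
          by_cases h : y ∈ S
          · simp [h]
          · have : y = x := by simpa [h] using hy
            simp [this, hx] }
    let G' : SimpleGraph (Option S) := (G.comap (Subtype.val : {y // y ∈ insert x S} → V)).comap e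
    have hG' : G'.Connected :=
      (SimpleGraph.Iso.connected_iff (SimpleGraph.Iso.comap e _)).2 h1
    have e1 : G'.comap some = G.comap (Subtype.val : S → V) := rfl
    have hxk : x ∉ kept G (6 * k + 3) := fun h => hx (hS h)
    have hcard := le_card_twins_kept hxk
    let T : Finset S := Finset.univ.filter fun y => y.1 ∈ kept G (6 * k + 3) ∧ Twin G x y.1
    have hT : ∀ y ∈ T, Twin G' none (some y) := by
      intro y hy
      refine twin_comap e.injective (twin_comap Subtype.val_injective ?_)
      exact (Finset.mem_filter.1 hy).2.2
    have hTc : 6 * k + 3 ≤ T.card := by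
      refine hcard.trans ?_
      rw [← Finset.card_map (Function.Embedding.subtype fun y => y ∈ S)]
      refine Finset.card_le_card fun y hy => ?_
      rw [Finset.mem_filter] at hy
      exact Finset.mem_map.2 ⟨⟨y, hS hy.1⟩, by simp [T, hy.1, hy.2], rfl⟩
    obtain ⟨y, hy⟩ : T.Nonempty := Finset.card_pos.1 (by omega)
    refine ⟨e1 ▸ connected_comap_some hG' (hT y hy), ?_⟩
    rw [← e1, solvable_comap_some hG' hT hTc, ← h2]
    exact solvable_comap_iff e (ℓ := plainLabel (G.comap (Subtype.val : {y // y ∈ insert x S} → V)))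

theorem connected_kept {G : SimpleGraph V} (hG : G.Connected) (k : ℕ) :
    (G.comap (Subtype.val : kept G (6 * k + 3) → V)).Connected :=
  (kept_aux hG _ _ le_rfl rfl).1

theorem solvable_kept {G : SimpleGraph V} (hG : G.Connected) (k : ℕ) :
    Solvable (plainLabel (G.comap (Subtype.val : kept G (6 * k + 3) → V))) k ↔
      Solvable (plainLabel G) k :=
  (kept_aux hG _ _ le_rfl rfl).2

/-- A deleted neighbour `z` of `a` has three kept twins, hence a kept twin `w` different from `a`
and `b`. Adjacency passes from `z` to `w`, from `a` to `b` in the small graph, and back to `z`. So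
the reduction creates no new twins. -/
theorem twin_of_twin_kept {G : SimpleGraph V} {t : ℕ} (ht : 3 ≤ t) {a b : kept G t}
    (h : Twin (G.comap (Subtype.val : kept G t → V)) a b) : Twin G a.1 b.1 := by
  have key : ∀ a b : kept G t, Twin (G.comap (Subtype.val : kept G t → V)) a b →
      ∀ z, G.Adj a.1 z ∨ z = a.1 → G.Adj b.1 z ∨ z = b.1 := by
    intro a b h z hz
    by_cases hzk : z ∈ kept G t
    · have := (h ⟨z, hzk⟩).1 (by simpa [Subtype.ext_iff] using hz)
      simpa [Subtype.ext_iff] using this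
    · have h1 := le_card_twins_kept hzk
      obtain ⟨w, hw, hwa⟩ := Finset.exists_mem_notMem_of_card_lt_card
        (s := {a.1, b.1}) (t := (kept G t).filter fun j => Twin G z j)
        (lt_of_le_of_lt Finset.card_le_two (by omega))
      rw [Finset.mem_filter] at hw
      simp only [Finset.mem_insert, Finset.mem_singleton, not_or] at hwa
      have hza : z ≠ a.1 := fun e => hzk (e ▸ a.2)
      have h2 : G.Adj w a.1 :=
        ((hw.2 a.1).1 (Or.inl (hz.resolve_right hza).symm)).resolve_right (Ne.symm hwa.1)
      have h3 := (h ⟨w, hw.1⟩).1 (Or.inl h2.symm)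
      have h4 : G.Adj b.1 w := h3.resolve_right fun e => hwa.2 (congrArg Subtype.val e)
      have h5 := (hw.2 b.1).2 (Or.inl h4.symm)
      rcases h5 with h5 | h5
      · exact Or.inl h5.symm
      · exact Or.inr h5.symm
  exact fun z => ⟨key a b h z, key b a h.symm z⟩

/-- The largest member of `T` has all the others as smaller twins in `G`, and being kept it has
fewer than `t` of these. -/
theorem card_le_of_twins_kept {G : SimpleGraph V} {t : ℕ} (ht : 3 ≤ t) {T : Finset (kept G t)}
    (hT : ∀ x ∈ T, ∀ y ∈ T, Twin (G.comap (Subtype.val : kept G t → V)) x y) : T.card ≤ t := by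
  rcases T.eq_empty_or_nonempty with rfl | hne
  · simp
  obtain ⟨m, hm, hmax⟩ := Finset.exists_max_image T Subtype.val hne
  have h1 := (Finset.mem_filter.1 m.2).2
  have h2 : (T.erase m).card ≤ (Finset.univ.filter fun j => j < m.1 ∧ Twin G m.1 j).card := by
    rw [← Finset.card_map (Function.Embedding.subtype fun y => y ∈ kept G t)]
    refine Finset.card_le_card fun y hy => ?_
    obtain ⟨z, hz, rfl⟩ := Finset.mem_map.1 hy
    rw [Finset.mem_erase] at hz
    refine Finset.mem_filter.2 ⟨Finset.mem_univ _, lt_of_le_of_ne (hmax z hz.2) ?_,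
      twin_of_twin_kept ht (hT m hm z hz.2)⟩
    exact fun e => hz.1 (Subtype.ext e)
  rw [Finset.card_erase_of_mem hm] at h2
  omega

end Reduction

end TreePlusK

namespace TreePlusK
open scoped Classical

/-! ### Root edges that can be recognized in the square -/

section Recognition

variable {V : Type*}

/-- The common neighbours of the adjacent vertices `u` and `v` are divided into two cliques `X` and
`Y` in the way in which a square root `H` with an edge `uv` on no short cycle divides them into
the neighbours of `u` and the neighbours of `v`. -/
structure Split (G : SimpleGraph V) (u v : V) (X Y : V → Prop) : Prop where
  adj : G.Adj u v
  mem : ∀ z, (G.Adj u z ∧ G.Adj v z) ↔ X z ∨ Y z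
  left_nonempty : ∃ x, X x
  right_nonempty : ∃ y, Y y
  left_clique : ∀ a b, X a → X b → a ≠ b → G.Adj a b
  right_clique : ∀ a b, Y a → Y b → a ≠ b → G.Adj a b
  disjoint : ∀ a, X a → ¬ Y a
  cross : ∀ a b, X a → Y b → ¬ G.Adj a b
  left_out : ∀ w b, G.Adj u w → w ≠ v → ¬ G.Adj v w → Y b → ¬ G.Adj w b
  right_out : ∀ w a, G.Adj v w → w ≠ u → ¬ G.Adj u w → X a → ¬ G.Adj w a

theorem Split.symm {G : SimpleGraph V} {u v : V} {X Y : V → Prop} (h : Split G u v X Y) :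
    Split G v u Y X where
  adj := h.adj.symm
  mem z := by rw [and_comm, h.mem, or_comm]
  left_nonempty := h.right_nonempty
  right_nonempty := h.left_nonempty
  left_clique := h.right_clique
  right_clique := h.left_clique
  disjoint a h1 h2 := h.disjoint a h2 h1
  cross a b h1 h2 h3 := h.cross b a h2 h1 h3.symm
  left_out := h.right_out
  right_out := h.left_out

/-- This excludes `z` as the middle of a path from `u` to `v`. A short path from `u` to some `y` in
`Y` has a middle vertex `p` that is `G`-adjacent to both `y` and `z`. If `p` is a common neighbour,
this violates `cross`; otherwise it violates `left_out`. -/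
theorem Split.false_of_common {G H : SimpleGraph V} {u v : V} {X Y : V → Prop}
    (h : Split G u v X Y) (hG : square H = G) (hn : ¬ H.Adj u v) {z : V} (hz : X z)
    (h1 : H.Adj u z) : False := by
  have E := square_eq_iff.1 hG
  obtain ⟨y, hy⟩ := h.right_nonempty
  obtain ⟨hy1, hy2⟩ := (h.mem y).2 (Or.inr hy)
  have hzy : ¬ G.Adj z y := h.cross z y hz hy
  have hne : z ≠ y := fun e => h.disjoint z hz (e ▸ hy)
  rcases (E u y hy1.ne).1 hy1 with h3 | ⟨p, h3, h4⟩
  · exact hzy ((E z y hne).2 (Or.inr ⟨u, h1.symm, h3⟩))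
  · have hpz : p ≠ z := fun e => hzy ((E z y hne).2 (Or.inl (e ▸ h4)))
    have hpv : p ≠ v := fun e => hn (e ▸ h3)
    have h5 : G.Adj p z := (E p z hpz).2 (Or.inr ⟨u, h3.symm, h1⟩)
    have h6 : G.Adj u p := (E u p h3.ne).2 (Or.inl h3)
    have h7 : G.Adj p y := (E p y h4.ne).2 (Or.inl h4)
    by_cases hvp : G.Adj v p
    · rcases (h.mem p).1 ⟨h6, hvp⟩ with hp | hp
      · exact h.cross p y hp hy h7
      · exact h.cross z p hz hp h5.symm
    · exact h.left_out p y h6 hpv hvp hy h7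

theorem Split.root_adj {G H : SimpleGraph V} {u v : V} {X Y : V → Prop}
    (h : Split G u v X Y) (hG : square H = G) : H.Adj u v := by
  by_contra hn
  rcases ((square_eq_iff.1 hG) u v h.adj.ne).1 h.adj with h1 | ⟨z, h1, h2⟩
  · exact hn h1
  · rcases (h.mem z).1 ⟨hG ▸ le_square H h1, hG ▸ le_square H h2.symm⟩ with hz | hz
    · exact h.false_of_common hG hn hz h1
    · exact h.symm.false_of_common hG (fun e => hn e.symm) hz h2.symm

theorem Split.root_nbr {G H : SimpleGraph V} {u v : V} {X Y : V → Prop}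
    (h : Split G u v X Y) (hG : square H = G) {z : V} (hz : H.Adj u z) (hne : z ≠ v) :
    X z ∨ Y z := by
  have E := square_eq_iff.1 hG
  have h1 := h.root_adj hG
  exact (h.mem z).1 ⟨hG ▸ le_square H hz, (E v z hne.symm).2 (Or.inr ⟨u, h1.symm, hz⟩)⟩

/-- If all neighbours of `u` are in `X`, then all those of `v` are in `Y`. -/
theorem Split.root_of_left {G H : SimpleGraph V} {u v : V} {X Y : V → Prop}
    (h : Split G u v X Y) (hG : square H = G) (hu : ∀ z, H.Adj u z → z = v ∨ X z) :
    ∀ z, H.Adj v z ↔ z = u ∨ Y z := by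
  have E := square_eq_iff.1 hG
  have huv := h.root_adj hG
  -- A short path from `u` to `y` has to pass through `v`, since by `cross` no step leads from `X`
  -- to `Y`.
  have hX : ∀ y, Y y → H.Adj v y := by
    intro y hy
    obtain ⟨h1, h2⟩ := (h.mem y).2 (Or.inr hy)
    rcases (E u y h1.ne).1 h1 with h3 | ⟨p, h3, h4⟩
    · rcases hu y h3 with e | e
      · exact absurd e h2.ne'
      · exact absurd hy (h.disjoint y e)
    · rcases hu p h3 with e | e
      · exact e ▸ h4
      · exact absurd ((E p y h4.ne).2 (Or.inl h4)) (h.cross p y e hy)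
  intro z
  refine ⟨fun hz => ?_, ?_⟩
  · by_cases hzu : z = u
    · exact Or.inl hzu
    · rcases h.symm.root_nbr hG hz hzu with e | e
      · exact Or.inr e
      · obtain ⟨y, hy⟩ := h.right_nonempty
        have h1 := hX y hy
        have hne : z ≠ y := fun e' => h.disjoint z e (e' ▸ hy)
        exact absurd ((E z y hne).2 (Or.inr ⟨v, hz.symm, h1⟩)) (h.cross z y e hy)
  · rintro (rfl | hz)
    · exact huv.symm
    · exact hX z hz

/-- By `cross`, the `H`-neighbours of `u` other than `v` lie all in `X` or all in `Y`. In the second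
case the two sides are exchanged, and `left_out` and `right_out` then leave no vertex adjacent to
only one of `u` and `v`, which makes them twins. -/
theorem Split.root_left {G H : SimpleGraph V} {u v : V} {X Y : V → Prop}
    (h : Split G u v X Y) (hG : square H = G) (hne : ¬ Twin G u v) :
    ∀ z, H.Adj u z ↔ z = v ∨ X z := by
  have E := square_eq_iff.1 hG
  have huv := h.root_adj hG
  by_cases hu : ∀ z, H.Adj u z → z = v ∨ X z
  -- `root_of_left` determines the neighbours of `v`, and these in turn determine those of `u`.
  · exact h.symm.root_of_left hG (fun z hz => (h.root_of_left hG hu z).1 hz)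
  exfalso
  push Not at hu
  obtain ⟨a, ha, hav, haX⟩ := hu
  have haY : Y a := (h.root_nbr hG ha hav).resolve_left haX
  have huY : ∀ z, H.Adj u z → z = v ∨ Y z := by
    intro z hz
    by_cases hzv : z = v
    · exact Or.inl hzv
    · refine Or.inr ((h.root_nbr hG hz hzv).resolve_left fun hzX => ?_)
      have : z ≠ a := fun e => haX (e ▸ hzX)
      exact h.cross z a hzX haY ((E z a this).2 (Or.inr ⟨u, hz.symm, ha⟩))
  -- If `v` had a neighbour in `Y`, no path of length at most two could lead from `u` to a vertex of
  -- `X`.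
  have hvX : ∀ z, H.Adj v z → z = u ∨ X z := by
    intro z hz
    by_cases hzv : z = u
    · exact Or.inl hzv
    · refine Or.inr ((h.symm.root_nbr hG hz hzv).resolve_left fun hzY => ?_)
      obtain ⟨x, hx⟩ := h.left_nonempty
      obtain ⟨h1, h2⟩ := (h.mem x).2 (Or.inl hx)
      rcases (E u x h1.ne).1 h1 with h3 | ⟨p, h3, h4⟩
      · rcases huY x h3 with e | e
        · exact h2.ne' e
        · exact h.disjoint x hx e
      · rcases huY p h3 with e | e
        · subst e
          have hne' : x ≠ z := fun e => h.disjoint x hx (e ▸ hzY)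
          exact h.cross x z hx hzY ((E x z hne').2 (Or.inr ⟨_, h4.symm, hz⟩))
        · exact h.cross x p hx e ((E p x h4.ne).2 (Or.inl h4)).symm
  refine hne fun z => ?_
  by_cases h1 : z = u
  · subst h1; simp [h.adj.symm]
  by_cases h2 : z = v
  · subst h2; simp [h.adj]
  simp only [h1, h2, or_false]
  constructor
  · intro h3
    by_contra h4
    rcases (E u z h3.ne).1 h3 with h5 | ⟨p, h5, h6⟩
    · exact h4 ((E v z (Ne.symm h2)).2 (Or.inr ⟨u, huv.symm, h5⟩))
    · rcases huY p h5 with e | e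
      · exact h4 ((E v z (Ne.symm h2)).2 (Or.inl (e ▸ h6)))
      · exact h.left_out z p h3 h2 h4 e ((E p z h6.ne).2 (Or.inl h6)).symm
  · intro h3
    by_contra h4
    rcases (E v z h3.ne).1 h3 with h5 | ⟨p, h5, h6⟩
    · exact h4 ((E u z (Ne.symm h1)).2 (Or.inr ⟨v, huv, h5⟩))
    · rcases hvX p h5 with e | e
      · exact h4 ((E u z (Ne.symm h1)).2 (Or.inl (e ▸ h6)))
      · exact h.right_out z p h3 h1 h4 e ((E p z h6.ne).2 (Or.inl h6)).symm

/-- An edge of a square root that is on no short cycle divides the common neighbours of its ends. -/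
theorem split_of_not_isShort {G H : SimpleGraph V} (hG : square H = G) {u v x y : V}
    (huv : H.Adj u v) (hs : ¬ IsShort H u v) (hx : H.Adj u x) (hxv : x ≠ v) (hy : H.Adj v y)
    (hyu : y ≠ u) : Split G u v (fun z => H.Adj u z ∧ z ≠ v) (fun z => H.Adj v z ∧ z ≠ u) := by
  have E := square_eq_iff.1 hG
  -- This is where the length six comes from: `left_out` and `right_out` need `c6`, while `mem` and
  -- `cross` get by with cycles of length at most five.
  have c3 : ∀ a, H.Adj u a → H.Adj a v → False := fun a h1 h2 => hs (.of_three huv h1 h2)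
  have c4 : ∀ a b, H.Adj u a → H.Adj a b → H.Adj b v → a ≠ v → b ≠ u → False :=
    fun a b h1 h2 h3 h4 h5 => hs (.of_four huv h1 h2 h3 h4 h5)
  have c5 : ∀ a b c, H.Adj u a → H.Adj a b → H.Adj b c → H.Adj c v → a ≠ v → c ≠ u →
      b ≠ v → False := fun a b c h1 h2 h3 h4 h5 h6 h7 => hs (.of_five huv h1 h2 h3 h4 h5 h7 h6)
  have c6 : ∀ a b c d, H.Adj u a → H.Adj a b → H.Adj b c → H.Adj c d → H.Adj d v → a ≠ v → d ≠ u →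
      b ≠ v → c ≠ v → False :=
    fun a b c d h1 h2 h3 h4 h5 h6 h7 h8 h9 => hs (.of_six huv h1 h2 h3 h4 h5 h6 h8 h9 h7)
  have nu : ∀ z, z ≠ u → z ≠ v → (G.Adj u z ↔ H.Adj u z ∨ H.Adj v z ∨
      ∃ c, H.Adj u c ∧ c ≠ v ∧ H.Adj c z) := by
    intro z h1 h2
    rw [E u z h1.symm]
    unfold WithinTwo
    grind
  have nv : ∀ z, z ≠ u → z ≠ v → (G.Adj v z ↔ H.Adj v z ∨ H.Adj u z ∨
      ∃ c, H.Adj v c ∧ c ≠ u ∧ H.Adj c z) := by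
    intro z h1 h2
    rw [E v z h2.symm]
    unfold WithinTwo
    grind [SimpleGraph.adj_comm]
  have hXY : ∀ a b, H.Adj u a → a ≠ v → H.Adj v b → b ≠ u → ¬ G.Adj a b := by
    intro a b h1 h2 h3 h4 h5
    rcases (E a b h5.ne).1 h5 with h6 | ⟨c, h6, h7⟩
    · exact c4 a b h1 h6 h3.symm h2 h4
    · by_cases hcv : c = v
      · subst hcv; exact c3 a h1 h6
      · exact c5 a c b h1 h6 h7 h3.symm h2 h4 hcv
  refine ⟨hG ▸ le_square H huv, fun z => ?_, ⟨x, hx, hxv⟩, ⟨y, hy, hyu⟩, ?_, ?_, ?_, ?_, ?_, ?_⟩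
  · by_cases h1 : z = u
    · subst h1; simp
    by_cases h2 : z = v
    · subst h2; simp
    rw [nu z h1 h2, nv z h1 h2]
    constructor
    · rintro ⟨h3, h4⟩
      rcases h3 with h3 | h3 | ⟨c, h3, h5, h6⟩
      · exact Or.inl ⟨h3, h2⟩
      · exact Or.inr ⟨h3, h1⟩
      · rcases h4 with h4 | h4 | ⟨d, h4, h7, h8⟩
        · exact Or.inr ⟨h4, h1⟩
        · exact Or.inl ⟨h4, h2⟩
        · exact (c5 c z d h3 h6 h8.symm h4.symm h5 h7 h2).elim
    · rintro (⟨h3, _⟩ | ⟨h3, _⟩)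
      · exact ⟨Or.inl h3, Or.inr (Or.inl h3)⟩
      · exact ⟨Or.inr (Or.inl h3), Or.inl h3⟩
  · exact fun a b ⟨h1, _⟩ ⟨h2, _⟩ h3 => (E a b h3).2 (Or.inr ⟨u, h1.symm, h2⟩)
  · exact fun a b ⟨h1, _⟩ ⟨h2, _⟩ h3 => (E a b h3).2 (Or.inr ⟨v, h1.symm, h2⟩)
  · exact fun a ⟨h1, _⟩ ⟨h2, _⟩ => c3 a h1 h2.symm
  · exact fun a b ⟨h1, h2⟩ ⟨h3, h4⟩ => hXY a b h1 h2 h3 h4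
  · rintro w b h1 h2 h3 ⟨h4, h5⟩ h6
    rw [nu w h1.ne' h2] at h1
    rw [nv w (by rintro rfl; exact h3 (hG ▸ le_square H huv.symm)) h2] at h3
    push Not at h3
    rcases h1 with h1 | h1 | ⟨c, h1, h7, h8⟩
    · exact h3.2.1 h1
    · exact h3.1 h1
    · rcases (E w b h6.ne).1 h6 with h9 | ⟨d, h9, h10⟩
      · exact h3.2.2 b h4 h5 h9.symm
      · by_cases hd : d = v
        · exact h3.1 (hd ▸ h9.symm)
        · exact c6 c w d b h1 h8 h9 h10 h4.symm h7 h5 h2 hd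
  · rintro w b h1 h2 h3 ⟨h4, h5⟩ h6
    have hwv := h1.ne'
    rw [nv w h2 h1.ne'] at h1
    rw [nu w h2 (by rintro rfl; exact h3 (hG ▸ le_square H huv))] at h3
    push Not at h3
    rcases h1 with h1 | h1 | ⟨c, h1, h7, h8⟩
    · exact h3.2.1 h1
    · exact h3.1 h1
    · rcases (E w b h6.ne).1 h6 with h9 | ⟨d, h9, h10⟩
      · exact h3.2.2 b h4 h5 h9.symm
      · by_cases hd : d = v
        · exact (c3 b h4 (hd ▸ h10.symm))
        · exact c6 b d w c h4 h10.symm h9.symm h8.symm h1.symm h5 h7 hd hwv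

/-- The common neighbours of `u` and `v` on the side of `x`. -/
def Side (G : SimpleGraph V) (u v x z : V) : Prop := G.Adj u z ∧ G.Adj v z ∧ (z = x ∨ G.Adj z x)

/-- The common neighbours of `u` and `v` that are not on the side of `x`. -/
def OtherSide (G : SimpleGraph V) (u v x z : V) : Prop :=
  G.Adj u z ∧ G.Adj v z ∧ z ≠ x ∧ ¬ G.Adj z x

/-- `uv` is a recognizable edge with `x` on the side of `u`. -/
def Recog (G : SimpleGraph V) (u v x : V) : Prop :=
  G.Adj u v ∧ G.Adj u x ∧ G.Adj v x ∧ (∃ y, OtherSide G u v x y) ∧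
    (∀ a b, a ≠ b → (Side G u v x a ∧ Side G u v x b ∨
      OtherSide G u v x a ∧ OtherSide G u v x b) → G.Adj a b) ∧
    (∀ a b, Side G u v x a → OtherSide G u v x b → ¬ G.Adj a b) ∧
    (∀ w b, G.Adj u w → w ≠ v → ¬ G.Adj v w → OtherSide G u v x b → ¬ G.Adj w b) ∧
    (∀ w a, G.Adj v w → w ≠ u → ¬ G.Adj u w → Side G u v x a → ¬ G.Adj w a) ∧
    ∃ w, w ≠ u ∧ w ≠ v ∧ ¬ (G.Adj u w ↔ G.Adj v w)

theorem Recog.split {G : SimpleGraph V} {u v x : V} (h : Recog G u v x) :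
    Split G u v (Side G u v x) (OtherSide G u v x) := by
  obtain ⟨h1, h2, h3, h4, h5, h6, h7, h8, -⟩ := h
  refine ⟨h1, fun z => ?_, ⟨x, h2, h3, Or.inl rfl⟩, h4, ?_, ?_, ?_, h6, h7, h8⟩
  · unfold Side OtherSide; tauto
  · exact fun a b ha hb hab => h5 a b hab (Or.inl ⟨ha, hb⟩)
  · exact fun a b ha hb hab => h5 a b hab (Or.inr ⟨ha, hb⟩)
  · unfold Side OtherSide; tauto

theorem Recog.not_twin {G : SimpleGraph V} {u v x : V} (h : Recog G u v x) : ¬ Twin G u v := by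
  obtain ⟨-, -, -, -, -, -, -, -, w, h1, h2, h3⟩ := h
  intro ht
  have := ht w
  tauto

/-- By `left_clique` and `cross`, any `x` in `X` determines `X` as its closed neighbourhood among
the common neighbours. So the division is definable in `G` from three vertices. -/
theorem Split.recog {G : SimpleGraph V} {u v x : V} {X Y : V → Prop} (h : Split G u v X Y)
    (hx : X x) (ht : ¬ Twin G u v) : Recog G u v x := by
  have eX : ∀ z, Side G u v x z ↔ X z := by
    intro z
    unfold Side
    rw [← and_assoc, h.mem]
    constructor
    · rintro ⟨h1 | h1, h2⟩
      · exact h1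
      · rcases h2 with rfl | h2
        · exact hx
        · exact absurd h2.symm (h.cross x z hx h1)
    · intro h1
      refine ⟨Or.inl h1, ?_⟩
      by_cases hz : z = x
      · exact Or.inl hz
      · exact Or.inr (h.left_clique z x h1 hx hz)
  have eY : ∀ z, OtherSide G u v x z ↔ Y z := by
    intro z
    have h1 := eX z
    have h2 := h.mem z
    have h3 := h.disjoint z
    unfold OtherSide
    unfold Side at h1
    tauto
  obtain ⟨h1, h2⟩ := (h.mem x).2 (Or.inl hx)
  unfold Recog
  simp only [eX, eY]
  refine ⟨h.adj, h1, h2, h.right_nonempty, ?_, h.cross, h.left_out, h.right_out, ?_⟩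
  · rintro a b hab (⟨ha, hb⟩ | ⟨ha, hb⟩)
    · exact h.left_clique a b ha hb hab
    · exact h.right_clique a b ha hb hab
  · by_contra hcon
    push Not at hcon
    refine ht fun z => ?_
    by_cases h3 : z = u
    · subst h3; simp [h.adj.symm]
    by_cases h4 : z = v
    · subst h4; simp [h.adj]
    simp [h3, h4, hcon z h3 h4]

/-- `uz` is seen to be an edge of every square root, because `u` is an end of a recognizable
edge. -/
def NearRecog (G : SimpleGraph V) (u z : V) : Prop := ∃ v, Recog G u v z ∨ Recog G u z v

/-- A recognizable edge `uv` fixes the neighbours of `u` in every root. Conversely all of them are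
seen: `v` as the other end, and the others because each may serve as the vertex `x` that marks the
side of `u`. -/
theorem nearRecog_iff {G H : SimpleGraph V} (hG : square H = G) {u : V}
    (hu : ∃ z, NearRecog G u z) (z : V) : NearRecog G u z ↔ H.Adj u z := by
  have key : ∀ {v x}, Recog G u v x → ∀ z, H.Adj u z ↔ z = v ∨ Side G u v x z :=
    fun h => h.split.root_left hG h.not_twin
  constructor
  · rintro ⟨v, h | h⟩
    · exact (key h z).2 (Or.inr ⟨h.2.1, h.2.2.1, Or.inl rfl⟩)
    · exact (key h z).2 (Or.inl rfl)
  · intro hz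
    obtain ⟨v, x, h⟩ : ∃ v x, Recog G u v x := by
      obtain ⟨z, v, h | h⟩ := hu
      · exact ⟨_, _, h⟩
      · exact ⟨_, _, h⟩
    rcases (key h z).1 hz with rfl | h1
    · exact ⟨x, Or.inr h⟩
    · exact ⟨v, Or.inl (h.split.recog h1 h.not_twin)⟩

/-- `xz` is seen to be an edge of every smallest square root, and all edges at `x` are seen:
`x` is an end of a recognizable edge, or a leaf attached to such an end. -/
def Known (G : SimpleGraph V) (x z : V) : Prop :=
  NearRecog G x z ∨ ((∀ w, ¬ NearRecog G x w) ∧ (∃ w, NearRecog G z w) ∧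
    ∀ w, (G.Adj x w ∨ w = x) ↔ (w = z ∨ NearRecog G z w))

/-- All edges at `x` are known. -/
def Settled (G : SimpleGraph V) (x : V) : Prop := ∃ z, Known G x z

/-- Everything within distance two of `x` lies in the closed neighbourhood of `v`. So a pair joined
by a short path through the edge `xz` is also joined within the star of `v`, which does not contain
that edge. -/
theorem square_deleteEdges {H : SimpleGraph V} {v x z : V} (h1 : H.Adj v x) (hzv : z ≠ v)
    (h2 : H.Adj x z) (hw : ∀ w, w ≠ x → WithinTwo H x w → w = v ∨ H.Adj v w) :
    square (H.deleteEdges {s(x, z)}) = square H := by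
  rw [square_eq_iff]
  intro a b hab
  rw [square_adj]
  simp only [ne_eq, hab, not_false_eq_true, true_and]
  constructor
  · have hv : ∀ w, H.Adj v w → (H.deleteEdges {s(x, z)}).Adj v w := by
      intro w hvw
      refine deleteEdge_adj hvw ?_
      have := h1.ne
      rintro (⟨e, _⟩ | ⟨e, _⟩)
      · exact this e
      · exact hzv e.symm
    have hN : ∀ a b, a ≠ b → (a = v ∨ H.Adj v a) → (b = v ∨ H.Adj v b) →
        WithinTwo (H.deleteEdges {s(x, z)}) a b := by
      rintro a b hab (rfl | ha) (rfl | hb)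
      · exact absurd rfl hab
      · exact Or.inl (hv b hb)
      · exact Or.inl (hv a ha).symm
      · exact Or.inr ⟨v, (hv a ha).symm, hv b hb⟩
    have hxN : x = v ∨ H.Adj v x := Or.inr h1
    have hz : z = v ∨ H.Adj v z := hw z h2.ne' (Or.inl h2)
    have hb' : ∀ b, H.Adj z b → b = v ∨ H.Adj v b := by
      intro b hb
      by_cases hbx : b = x
      · exact hbx ▸ hxN
      · exact hw b hbx (Or.inr ⟨z, h2, hb⟩)
    have hb'' : ∀ b, H.Adj x b → b = v ∨ H.Adj v b := fun b hb => hw b hb.ne' (Or.inl hb)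
    rintro (h | ⟨c, h3, h4⟩)
    · by_cases he : (a = x ∧ b = z) ∨ (a = z ∧ b = x)
      · rcases he with ⟨rfl, rfl⟩ | ⟨rfl, rfl⟩
        · exact hN _ _ hab hxN hz
        · exact hN _ _ hab hz hxN
      · exact Or.inl (deleteEdge_adj h he)
    · by_cases he : (a = x ∧ c = z) ∨ (a = z ∧ c = x)
      · rcases he with ⟨rfl, rfl⟩ | ⟨rfl, rfl⟩
        · exact hN _ _ hab hxN (hb' _ h4)
        · exact hN _ _ hab hz (hb'' _ h4)
      · by_cases he' : (c = x ∧ b = z) ∨ (c = z ∧ b = x)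
        · rcases he' with ⟨rfl, rfl⟩ | ⟨rfl, rfl⟩
          · exact hN _ _ hab (hb'' _ h3.symm) hz
          · exact hN _ _ hab (hb' _ h3.symm) hxN
        · exact Or.inr ⟨c, deleteEdge_adj h3 he, deleteEdge_adj h4 he'⟩
  · have hle := SimpleGraph.deleteEdges_le (G := H) {s(x, z)}
    rintro (h | ⟨c, h3, h4⟩)
    · exact Or.inl (hle h)
    · exact Or.inr ⟨c, hle h3, hle h4⟩

/-- `H` is a square root of `G` with the smallest number of edges, which is at most
`|V| - 1 + k`. -/
def IsMinRoot [Fintype V] (G : SimpleGraph V) (k : ℕ) (H : SimpleGraph V) : Prop :=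
  IsRoot G k H ∧ ∀ H', square H' = G → adjCount H ≤ adjCount H'

theorem exists_isMinRoot [Fintype V] {G H : SimpleGraph V} {k : ℕ} (h : IsRoot G k H) :
    ∃ H, IsMinRoot G k H := by
  obtain ⟨H', h1, h2⟩ := Set.exists_min_image {H | square H = G} adjCount (Set.toFinite _) ⟨H, h.1⟩
  exact ⟨H', ⟨h1, by have := h2 H h.1; have := h.2; omega⟩, h2⟩

/-- If `x` sees in `G` nothing but the closed `H`-neighbourhood of `v`, an edge from `x` to another
vertex is superfluous. -/
theorem IsMinRoot.eq_of_adj [Fintype V] {G H : SimpleGraph V} {k : ℕ} (hH : IsMinRoot G k H)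
    {v x z : V} (h1 : H.Adj v x) (hw : ∀ w, (G.Adj x w ∨ w = x) ↔ (w = v ∨ H.Adj v w))
    (hz : H.Adj x z) : z = v := by
  by_contra hzv
  have h2 := hH.2 _ ((square_deleteEdges h1 hzv hz fun w hwx hw2 => (hw w).1
    (Or.inl (((square_eq_iff.1 hH.1.1) x w (Ne.symm hwx)).2 hw2))).trans hH.1.1)
  rw [adjCount_eq, adjCount_eq, SimpleGraph.edgeSet_deleteEdges] at h2
  have h3 := Set.ncard_sdiff_singleton_lt_of_mem (s := H.edgeSet) (a := s(x, z)) hz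
  omega

/-- Ends of recognizable edges have the same neighbours in every root. Minimality is needed only for
the second alternative of `Known`, the leaves, through `eq_of_adj`. -/
theorem IsMinRoot.known_iff [Fintype V] {G H : SimpleGraph V} {k : ℕ} (hH : IsMinRoot G k H)
    {x : V} (hx : Settled G x) (z : V) : Known G x z ↔ H.Adj x z := by
  by_cases hE : ∃ w, NearRecog G x w
  · rw [← nearRecog_iff hH.1.1 hE]
    refine ⟨fun h => h.resolve_right fun h' => ?_, Or.inl⟩
    exact hE.elim h'.1
  · have key : ∀ z, Known G x z → H.Adj x z ∧ ∀ z', H.Adj x z' → z' = z := by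
      intro z hz
      obtain ⟨h1, h2, h3⟩ := hz.resolve_left fun h => hE ⟨z, h⟩
      simp only [nearRecog_iff hH.1.1 h2] at h3
      have hne : x ≠ z := fun e => hE (e ▸ h2)
      have h4 : H.Adj z x := ((h3 x).1 (Or.inr rfl)).resolve_left hne
      exact ⟨h4.symm, fun z' => hH.eq_of_adj h4 h3⟩
    refine ⟨fun h => (key z h).1, fun h => ?_⟩
    obtain ⟨v, hv⟩ := hx
    exact (key v hv).2 z h ▸ hv

/-- A settled vertex with an unsettled neighbour. -/
def IsGate (G : SimpleGraph V) (a : V) : Prop := Settled G a ∧ ∃ u, ¬ Settled G u ∧ Known G a u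

/-- The vertices that are unsettled, or settled with an unsettled neighbour. -/
def InCore (G : SimpleGraph V) (x : V) : Prop := ¬ Settled G x ∨ IsGate G x

/-- In the square a leaf sees exactly the closed neighbourhood of the vertex it is attached to; this
is the condition in the second alternative of `Known`. -/
theorem known_of_leaf {G H : SimpleGraph V} (hG2 : square H = G) {u v : V} (hu : ∀ z, H.Adj u z ↔ z = v)
    (hnu : ∀ w, ¬ NearRecog G u w) (hv : ∃ w, NearRecog G v w) : Known G u v := by
  refine Or.inr ⟨hnu, hv, fun w => ?_⟩
  rw [nearRecog_iff hG2 hv]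
  have huv : H.Adj u v := (hu v).2 rfl
  by_cases hw : w = u
  · subst hw; simp [huv.symm]
  · rw [(square_eq_iff.1 hG2) u w (Ne.symm hw)]
    unfold WithinTwo
    simp [hu, hw]

theorem not_nearRecog_of_not_settled {G : SimpleGraph V} {u : V} (h : ¬ Settled G u) : ∀ w, ¬ NearRecog G u w :=
  fun w hw => h ⟨w, Or.inl hw⟩

/-! ### The size of the core -/

section Size

variable [Fintype V] {G H : SimpleGraph V} {k t : ℕ}

/-- Such a root is a star, so its square is complete and all vertices are twins. -/
theorem false_of_star (hG : G.Connected) (hG2 : square H = G)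
    (hT : ∀ T : Finset V, (∀ x ∈ T, ∀ y ∈ T, Twin G x y) → T.card ≤ t) (hn : t < Fintype.card V)
    {v : V} (hv : ∀ w, H.Adj v w → ∀ c, H.Adj w c → c = v) : False := by
  have hconn : H.Connected := square_connected_iff.1 (hG2.symm ▸ hG)
  have hall : ∀ y, y ∈ {y | y = v ∨ H.Adj v y} := mem_of_closed hconn (x := v) (Or.inl rfl) (by
    rintro a (rfl | ha) b hab
    · exact Or.inr hab
    · exact Or.inl (hv a ha b hab))
  have hadj : ∀ x y, x ≠ y → G.Adj x y := by
    intro x y hne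
    refine ((square_eq_iff.1 hG2) x y hne).2 ?_
    rcases hall x with rfl | h1 <;> rcases hall y with rfl | h2
    · exact absurd rfl hne
    · exact Or.inl h2
    · exact Or.inl h1.symm
    · exact Or.inr ⟨v, h1.symm, h2⟩
  have h3 := hT Finset.univ (fun x _ y _ z => by
    by_cases h1 : z = x <;> by_cases h2 : z = y
    · exact iff_of_true (Or.inr h1) (Or.inr h2)
    · simp [h1, hadj y x (by rintro rfl; exact h2 h1)]
    · simp [h2, hadj x y (by rintro rfl; exact h1 h2)]
    · simp [hadj x z (Ne.symm h1), hadj y z (Ne.symm h2)])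
  rw [Finset.card_univ] at h3
  omega

/-- If `u` and `v` were twins, nothing would lie beyond their `H`-neighbours, and each of the two
sides would consist of twins. This leaves at most `2 * t + 2` vertices. -/
theorem not_twin_of_not_isShort (hG : G.Connected) (hG2 : square H = G)
    (hT : ∀ T : Finset V, (∀ x ∈ T, ∀ y ∈ T, Twin G x y) → T.card ≤ t)
    (hn : 2 * t + 2 < Fintype.card V) {u v x y : V}
    (huv : H.Adj u v) (hs : ¬ IsShort H u v) (hx : H.Adj u x) (hxv : x ≠ v) (hy : H.Adj v y)
    (hyu : y ≠ u) : ¬ Twin G u v := by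
  intro ht
  have hconn : H.Connected := square_connected_iff.1 (hG2.symm ▸ hG)
  have hsp := split_of_not_isShort hG2 huv hs hx hxv hy hyu
  have E := square_eq_iff.1 hG2
  have hall : ∀ z, z ∈ {z | z = u ∨ z = v ∨ H.Adj u z ∨ H.Adj v z} := by
    have hin : ∀ z, G.Adj u z → z = u ∨ z = v ∨ H.Adj u z ∨ H.Adj v z := by
      intro z hz
      rcases (ht z).1 (Or.inl hz) with h | h
      · rcases (hsp.mem z).1 ⟨hz, h⟩ with h | h
        · exact Or.inr (Or.inr (Or.inl h.1))
        · exact Or.inr (Or.inr (Or.inr h.1))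
      · exact Or.inr (Or.inl h)
    refine mem_of_closed hconn (x := u) (Or.inl rfl) ?_
    rintro a (rfl | rfl | ha | ha) b hab
    · exact Or.inr (Or.inr (Or.inl hab))
    · exact Or.inr (Or.inr (Or.inr hab))
    · by_cases hub : u = b
      · exact Or.inl hub.symm
      · exact hin b ((E u b hub).2 (Or.inr ⟨a, ha, hab⟩))
    · by_cases hvb : v = b
      · exact Or.inr (Or.inl hvb.symm)
      · rcases (ht b).2 (Or.inl ((E v b hvb).2 (Or.inr ⟨a, ha, hab⟩))) with h | h
        · exact hin b h
        · exact Or.inl h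
  -- A member of `X` sees `u`, `v`, the rest of `X`, and nothing of `Y`, so `X` consists of twins.
  have side : ∀ {u v : V} {X Y : V → Prop} [DecidablePred X], Split G u v X Y →
      (∀ z, z = u ∨ z = v ∨ X z ∨ Y z) → (Finset.univ.filter X).card ≤ t := by
    intro u v X Y _ hsp hall
    refine hT _ fun a ha b hb z => ?_
    have ha' := (Finset.mem_filter.1 ha).2
    have hb' := (Finset.mem_filter.1 hb).2
    obtain ⟨a1, a2⟩ := (hsp.mem a).2 (Or.inl ha')
    obtain ⟨b1, b2⟩ := (hsp.mem b).2 (Or.inl hb')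
    rcases hall z with rfl | rfl | hz | hz
    · simp [a1.symm, b1.symm]
    · simp [a2.symm, b2.symm]
    · by_cases h1 : a = z <;> by_cases h2 : b = z
      · simp [h1, h2]
      · simp [h1, hsp.left_clique b z hb' hz h2]
      · simp [h2, hsp.left_clique a z ha' hz h1]
      · simp [hsp.left_clique a z ha' hz h1, hsp.left_clique b z hb' hz h2]
    · have h1 : z ≠ a := fun e => hsp.disjoint a ha' (e ▸ hz)
      have h2 : z ≠ b := fun e => hsp.disjoint b hb' (e ▸ hz)
      simp [hsp.cross a z ha' hz, hsp.cross b z hb' hz, h1, h2]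
  have h1 := side hsp fun z => by
    have := hall z; simp only [Set.mem_ofPred_eq] at this; tauto
  have h2 := side hsp.symm fun z => by
    have := hall z; simp only [Set.mem_ofPred_eq] at this; tauto
  have h3 : (Finset.univ : Finset V) ⊆ {u, v} ∪
      (Finset.univ.filter (fun z => H.Adj u z ∧ z ≠ v) ∪
        Finset.univ.filter (fun z => H.Adj v z ∧ z ≠ u)) := by
    intro z _
    have := hall z
    simp only [Set.mem_ofPred_eq] at this
    simp only [Finset.mem_union, Finset.mem_insert, Finset.mem_singleton, Finset.mem_filter,
      Finset.mem_univ, true_and]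
    tauto
  have h4 := Finset.card_le_card h3
  have h5 := Finset.card_union_le {u, v} (Finset.univ.filter (fun z => H.Adj u z ∧ z ≠ v) ∪
        Finset.univ.filter (fun z => H.Adj v z ∧ z ≠ u))
  have h6 := Finset.card_union_le (Finset.univ.filter (fun z => H.Adj u z ∧ z ≠ v))
    (Finset.univ.filter (fun z => H.Adj v z ∧ z ≠ u))
  have h7 : ({u, v} : Finset V).card ≤ 2 := Finset.card_le_two
  rw [Finset.card_univ] at h4
  omega

theorem nearRecog_of_not_isShort (hG : G.Connected) (hG2 : square H = G)
    (hT : ∀ T : Finset V, (∀ x ∈ T, ∀ y ∈ T, Twin G x y) → T.card ≤ t)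
    (hn : 2 * t + 2 < Fintype.card V) {u v x y : V}
    (huv : H.Adj u v) (hs : ¬ IsShort H u v) (hx : H.Adj u x) (hxv : x ≠ v) (hy : H.Adj v y)
    (hyu : y ≠ u) : NearRecog G u x :=
  ⟨v, Or.inl ((split_of_not_isShort hG2 huv hs hx hxv hy hyu).recog ⟨hx, hxv⟩
    (not_twin_of_not_isShort hG hG2 hT hn huv hs hx hxv hy hyu))⟩

/-- Suppose that no edge at `v` is short. If a neighbour `w` of `v` had a neighbour other than `v`,
then `vw` would be recognizable, because `v` has a neighbour besides `w`. So the root is a star. -/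
theorem mem_shortVerts_of_two (hG : G.Connected) (hG2 : square H = G)
    (hT : ∀ T : Finset V, (∀ x ∈ T, ∀ y ∈ T, Twin G x y) → T.card ≤ t)
    (hn : 2 * t + 2 < Fintype.card V) {v a b : V} (hv : ∀ w, ¬ NearRecog G v w) (ha : H.Adj v a)
    (hb : H.Adj v b) (hab : a ≠ b) : v ∈ shortVerts H := by
  by_contra hs
  refine false_of_star hG hG2 hT (by omega) (v := v) fun w hw c hc => ?_
  by_contra hcv
  have hsw : ¬ IsShort H v w := fun h => hs ⟨w, h⟩
  by_cases haw : a = w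
  · exact hv _ (nearRecog_of_not_isShort hG hG2 hT hn hw hsw hb (fun e => hab (haw.trans e.symm))
      hc hcv)
  · exact hv _ (nearRecog_of_not_isShort hG hG2 hT hn hw hsw ha haw hc hcv)

/-- The neighbour of an unsettled leaf is no end of a recognizable edge, since otherwise the leaf
would be settled. So `mem_shortVerts_of_two` applies to this neighbour or, if `u` is no leaf, to `u`
itself. -/
theorem mem_shortVerts_or_leaf (hG : G.Connected) (hH : square H = G)
    (hT : ∀ T : Finset V, (∀ x ∈ T, ∀ y ∈ T, Twin G x y) → T.card ≤ t)
    (hn : 2 * t + 2 < Fintype.card V) {u : V} (hu : ¬ Settled G u) :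
    u ∈ shortVerts H ∨ ∃ v ∈ shortVerts H, ∀ z, H.Adj u z ↔ z = v := by
  have hconn : H.Connected := square_connected_iff.1 (hH.symm ▸ hG)
  have hnu := not_nearRecog_of_not_settled hu
  obtain ⟨v, hv⟩ : ∃ v, H.Adj u v := by
    by_contra hcon
    push Not at hcon
    have hall := mem_of_closed hconn (D := {u}) (x := u) rfl (by
      rintro a rfl b hab; exact absurd hab (hcon b))
    have : Fintype.card V ≤ 1 := Fintype.card_le_one_iff.2 fun a b => (hall a).trans (hall b).symm
    omega
  by_cases hl : IsLeaf H u
  · obtain ⟨p, hp⟩ := hl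
    obtain rfl := (hp v).1 hv
    refine Or.inr ⟨v, ?_, hp⟩
    obtain ⟨c, hcu, hc⟩ : ∃ c, c ≠ u ∧ H.Adj v c := by
      by_contra hcon
      push Not at hcon
      have hall := mem_of_closed hconn (D := {u, v}) (x := u) (by simp) (by
        rintro a (rfl | rfl) b hab
        · exact Or.inr ((hp b).1 hab)
        · exact Or.inl (by_contra fun h => hcon b h hab))
      have h1 : (Finset.univ : Finset V) ⊆ {u, v} := fun z _ => by simpa using hall z
      have h2 := Finset.card_le_card h1
      have h3 : ({u, v} : Finset V).card ≤ 2 := Finset.card_le_two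
      rw [Finset.card_univ] at h2
      omega
    refine mem_shortVerts_of_two hG hH hT hn (fun w hw => hu ⟨v, ?_⟩) hc hv.symm hcu
    exact known_of_leaf hH hp hnu ⟨w, hw⟩
  · obtain ⟨a, hav, ha⟩ := exists_adj_ne_of_not_isLeaf hl hv
    exact Or.inl (mem_shortVerts_of_two hG hH hT hn hnu ha hv hav)

/-- Suppose that the edge from `a` to its unsettled neighbour `u` is not short. If `u` is a leaf, it
is visible as a leaf attached to `a`; otherwise the edge is recognizable. Either way `u` would be
settled. -/
theorem IsGate.mem_shortVerts (hG : G.Connected) (hH : IsMinRoot G k H)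
    (hT : ∀ T : Finset V, (∀ x ∈ T, ∀ y ∈ T, Twin G x y) → T.card ≤ t)
    (hn : 2 * t + 2 < Fintype.card V) {a : V} (ha : IsGate G a) : a ∈ shortVerts H := by
  obtain ⟨ha, u, hu, hau⟩ := ha
  have hnu := not_nearRecog_of_not_settled hu
  have hadj := (hH.known_iff ha u).1 hau
  by_contra hs
  have hs' : ¬ IsShort H u a := fun h => hs ⟨u, h.symm⟩
  have hE : ∃ w, NearRecog G a w := by
    rcases hau with h | ⟨_, ⟨w, hw⟩, _⟩
    · exact ⟨u, h⟩
    · exact absurd hw (hnu w)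
  obtain ⟨c, hcu, hc⟩ : ∃ c, c ≠ u ∧ H.Adj a c := by
    obtain ⟨v, x, h⟩ : ∃ v x, Recog G a v x := by
      obtain ⟨z, v, h | h⟩ := hE
      · exact ⟨_, _, h⟩
      · exact ⟨_, _, h⟩
    have h1 := (nearRecog_iff hH.1.1 hE v).1 ⟨x, Or.inr h⟩
    have h2 := (nearRecog_iff hH.1.1 hE x).1 ⟨v, Or.inl h⟩
    by_cases hvu : v = u
    · exact ⟨x, fun e => h.2.2.1.ne (hvu.trans e.symm), h2⟩
    · exact ⟨v, hvu, h1⟩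
  by_cases hl : IsLeaf H u
  · obtain ⟨p, hp⟩ := hl
    obtain rfl := (hp a).1 hadj.symm
    exact hu ⟨_, known_of_leaf hH.1.1 hp hnu hE⟩
  · obtain ⟨b, hba, hb⟩ := exists_adj_ne_of_not_isLeaf hl hadj.symm
    exact hnu b (nearRecog_of_not_isShort hG hH.1.1 hT hn hadj.symm hs' hb hba hc hcu)

/-- Core vertices lie in the cover `D` of the short cycles or are leaves of `H` attached to `D`.
Leaves with a common neighbour are twins, so there are at most `t` of them at each vertex of `D`. -/
theorem card_inCore_le (hG : G.Connected) (hH : IsMinRoot G k H)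
    (hT : ∀ T : Finset V, (∀ x ∈ T, ∀ y ∈ T, Twin G x y) → T.card ≤ t)
    (hn : 2 * t + 2 < Fintype.card V) :
    (Finset.univ.filter (InCore G)).card ≤ 6 * k + 6 * k * t := by
  have hconn : H.Connected := square_connected_iff.1 (hH.1.1.symm ▸ hG)
  obtain ⟨D, hD, hcard⟩ := exists_shortVerts_subset hconn hH.1.2
  have hsub : Finset.univ.filter (InCore G) ⊆
      D ∪ D.biUnion fun v => Finset.univ.filter fun u => ∀ z, H.Adj u z ↔ z = v := by
    intro x hx
    rw [Finset.mem_union, Finset.mem_biUnion]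
    rcases (Finset.mem_filter.1 hx).2 with h | h
    · rcases mem_shortVerts_or_leaf hG hH.1.1 hT hn h with h | ⟨v, h1, h2⟩
      · exact Or.inl (hD h)
      · exact Or.inr ⟨v, hD h1, by simpa using h2⟩
    · exact Or.inl (hD (h.mem_shortVerts hG hH hT hn))
  have hleaf : ∀ v ∈ D, (Finset.univ.filter fun u => ∀ z, H.Adj u z ↔ z = v).card ≤ t := by
    intro v _
    refine hT _ fun a ha b hb z => ?_
    have key : ∀ a, (∀ z, H.Adj a z ↔ z = v) → ((G.Adj a z ∨ z = a) ↔ (z = v ∨ H.Adj v z)) := by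
      intro a ha
      have hav : H.Adj a v := (ha v).2 rfl
      by_cases hz : z = a
      · subst hz; simp [hav.symm]
      · rw [(square_eq_iff.1 hH.1.1) a z (Ne.symm hz)]
        unfold WithinTwo
        simp [ha, hz]
    rw [key a (Finset.mem_filter.1 ha).2, key b (Finset.mem_filter.1 hb).2]
  have h1 := Finset.card_le_card hsub
  have h2 := Finset.card_union_le D
    (D.biUnion fun v => Finset.univ.filter fun u => ∀ z, H.Adj u z ↔ z = v)
  have h3 := Finset.card_biUnion_le_card_mul D
    (fun v => Finset.univ.filter fun u => ∀ z, H.Adj u z ↔ z = v) t hleaf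
  have h4 : D.card * t ≤ 6 * k * t := Nat.mul_le_mul_right t hcard
  omega

end Size

end Recognition

end TreePlusK

namespace TreePlusK
open scoped Classical

/-! ### The gadget -/

section Joined

variable {S : Type*}

/-- The graph obtained from `F` by joining all vertices satisfying `P` to the first vertex of a
connected gadget with `δ + 2` vertices and `2 * δ + 1` edges. -/
def joined (F : SimpleGraph S) (P : S → Prop) (δ : ℕ) : SimpleGraph (S ⊕ Fin (δ + 2)) where
  Adj
    | .inl a, .inl b => F.Adj a b
    | .inl a, .inr g => P a ∧ g.val = 0
    | .inr g, .inl a => P a ∧ g.val = 0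
    | .inr g, .inr h => g ≠ h ∧ (g.val ≤ 1 ∨ h.val ≤ 1)
  symm := ⟨by
    rintro (a | g) (b | h) h'
    · exact SimpleGraph.Adj.symm (G := F) h'
    · exact h'
    · exact h'
    · exact ⟨h'.1.symm, h'.2.symm⟩⟩
  loopless := ⟨by
    rintro (a | g) h'
    · exact F.irrefl h'
    · exact h'.1 rfl⟩

theorem withinTwo_joined_inl_inl {F : SimpleGraph S} {P : S → Prop} {δ : ℕ} {a b : S} :
    WithinTwo (joined F P δ) (.inl a) (.inl b) ↔ WithinTwo F a b ∨ (P a ∧ P b) := by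
  constructor
  · rintro (h | ⟨c | g, h1, h2⟩)
    · exact Or.inl (Or.inl h)
    · exact Or.inl (Or.inr ⟨c, h1, h2⟩)
    · exact Or.inr ⟨h1.1, h2.1⟩
  · rintro ((h | ⟨c, h1, h2⟩) | ⟨h1, h2⟩)
    · exact Or.inl h
    · exact Or.inr ⟨.inl c, h1, h2⟩
    · exact Or.inr ⟨.inr 0, ⟨h1, rfl⟩, ⟨h2, rfl⟩⟩

theorem withinTwo_joined_inl_inr {F : SimpleGraph S} {P : S → Prop} {δ : ℕ} {a : S}
    {g : Fin (δ + 2)} : WithinTwo (joined F P δ) (.inl a) (.inr g) ↔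
      P a ∨ (g.val = 0 ∧ ∃ r, P r ∧ F.Adj a r) := by
  constructor
  · rintro (h | ⟨c | g, h1, h2⟩)
    · exact Or.inl h.1
    · exact Or.inr ⟨h2.2, c, h2.1, h1⟩
    · exact Or.inl h1.1
  · rintro (h | ⟨h0, r, h1, h2⟩)
    · by_cases hg : g.val = 0
      · exact Or.inl ⟨h, hg⟩
      · refine Or.inr ⟨.inr 0, ⟨h, rfl⟩, ?_, Or.inl (Nat.zero_le _)⟩
        rintro rfl
        exact hg rfl
    · exact Or.inr ⟨.inl r, h2, h1, h0⟩

theorem withinTwo_joined_inr_inr {F : SimpleGraph S} {P : S → Prop} {δ : ℕ}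
    {g h : Fin (δ + 2)} (hne : g ≠ h) : WithinTwo (joined F P δ) (.inr g) (.inr h) := by
  by_cases hg : g = 0
  · exact Or.inl ⟨hne, Or.inl (by simp [hg])⟩
  by_cases hh : h = 0
  · exact Or.inl ⟨hne, Or.inr (by simp [hh])⟩
  · exact Or.inr ⟨.inr 0, ⟨hg, Or.inr (by simp)⟩, ⟨Ne.symm hh, Or.inl (by simp)⟩⟩

theorem sum_gadget_row (δ : ℕ) (g : Fin (δ + 2)) : (∑ h : Fin (δ + 2),
    if g ≠ h ∧ (g.val ≤ 1 ∨ h.val ≤ 1) then 1 else 0) = if g.val ≤ 1 then δ + 1 else 2 := by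
  by_cases hg : g.val ≤ 1
  · simp only [hg, true_or, and_true, if_true]
    rw [← Finset.card_filter, Finset.filter_ne, Finset.card_erase_of_mem (Finset.mem_univ _),
      Finset.card_univ, Fintype.card_fin]
    rfl
  · have h0 : g ≠ 0 := by rintro rfl; exact hg (by simp)
    have h1 : g ≠ Fin.succ 0 := by rintro rfl; exact hg (by simp)
    rw [Fin.sum_univ_succ, Fin.sum_univ_succ]
    have h1' : g ≠ 1 := h1
    simp [hg, h0, h1']

/-- The edges are those at the vertices `0` and `1`, so the gadget has cycle rank `δ`; its square is
complete because of the vertex `0`. -/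
theorem sum_gadget (δ : ℕ) : (∑ g : Fin (δ + 2), ∑ h : Fin (δ + 2),
    if g ≠ h ∧ (g.val ≤ 1 ∨ h.val ≤ 1) then 1 else 0) = 4 * δ + 2 := by
  rw [Finset.sum_congr rfl fun g _ => sum_gadget_row δ g, Fin.sum_univ_succ, Fin.sum_univ_succ]
  simp
  omega

theorem adjCount_joined [Fintype S] (F : SimpleGraph S) (P : S → Prop) (δ : ℕ) :
    adjCount (joined F P δ) = adjCount F + 2 * (Finset.univ.filter P).card + (4 * δ + 2) := by
  have a1 : ∀ (a : S) (g : Fin (δ + 2)), (joined F P δ).Adj (.inl a) (.inr g) ↔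
    P a ∧ g = 0 := fun a g => and_congr_right fun _ => Fin.val_eq_zero_iff
  have a2 : ∀ (a : S) (g : Fin (δ + 2)), (joined F P δ).Adj (.inr g) (.inl a) ↔
    P a ∧ g = 0 := fun a g => and_congr_right fun _ => Fin.val_eq_zero_iff
  have a3 : ∀ (a b : S), (joined F P δ).Adj (.inl a) (.inl b) ↔ F.Adj a b := fun _ _ => Iff.rfl
  have h1 : ∀ a : S, (∑ g : Fin (δ + 2), if (joined F P δ).Adj (.inl a) (.inr g) then 1 else 0) =
      if P a then 1 else 0 := by
    intro a
    by_cases h : P a <;> simp [h, a1]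
  have h2 : (∑ g : Fin (δ + 2), ∑ a : S, if (joined F P δ).Adj (.inr g) (.inl a) then 1 else 0) =
      ∑ a : S, if P a then 1 else 0 := by
    rw [Finset.sum_comm]
    refine Finset.sum_congr rfl fun a _ => ?_
    by_cases h : P a <;> simp [h, a2]
  have h3 : (∑ g : Fin (δ + 2), ∑ h : Fin (δ + 2),
      if (joined F P δ).Adj (.inr g) (.inr h) then 1 else 0) = 4 * δ + 2 := by
    rw [← sum_gadget δ]
    refine Finset.sum_congr rfl fun g _ => Finset.sum_congr rfl fun h _ => ?_
    by_cases hgh : g ≠ h ∧ (g.val ≤ 1 ∨ h.val ≤ 1)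
    · rw [if_pos hgh]; exact if_pos hgh
    · rw [if_neg hgh]; exact if_neg hgh
  unfold adjCount
  rw [Fintype.sum_sum_type]
  simp only [Fintype.sum_sum_type, Finset.sum_add_distrib]
  rw [h2, h3, Finset.sum_congr rfl fun a _ => h1 a, Finset.card_filter]
  simp only [a3]
  ring

end Joined

/-! ### The kernel and its equivalence with the original instance -/

section Kernel

variable {V : Type*}

theorem Known.adj {G : SimpleGraph V} {x z : V} (h : Known G x z) : G.Adj x z := by
  rcases h with ⟨v, h | h⟩ | ⟨h1, h2, h3⟩
  · exact h.2.1
  · exact h.1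
  · refine ((h3 z).2 (Or.inl rfl)).resolve_right ?_
    rintro rfl
    obtain ⟨w, hw⟩ := h2
    exact h1 w hw

/-- One of the ends of the edge `xy` sees it to be an edge of every smallest square root. -/
def KnownEdge (G : SimpleGraph V) (x y : V) : Prop := Known G x y ∨ Known G y x

theorem KnownEdge.symm {G : SimpleGraph V} {x y : V} (h : KnownEdge G x y) : KnownEdge G y x :=
  Or.symm h

theorem KnownEdge.adj {G : SimpleGraph V} {x y : V} (h : KnownEdge G x y) : G.Adj x y :=
  h.elim Known.adj fun h => h.adj.symm

/-- The graph on the core with the same components as the core of a smallest square root. -/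
def coreGraph (G : SimpleGraph V) : SimpleGraph V where
  Adj x y := InCore G x ∧ InCore G y ∧
    ((¬ (Settled G x ∧ Settled G y) ∧ G.Adj x y) ∨ (Settled G x ∧ Settled G y ∧ KnownEdge G x y))
  symm := ⟨fun _ _ ⟨h1, h2, h3⟩ => ⟨h2, h1, h3.imp (fun h => ⟨fun h' => h.1 h'.symm, h.2.symm⟩)
    fun h => ⟨h.2.1, h.1, h.2.2.symm⟩⟩⟩
  loopless := ⟨fun _ ⟨_, _, h⟩ => h.elim (fun h => G.irrefl h.2) fun h => G.irrefl h.2.2.adj⟩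

/-- `H` has the known edges at all settled vertices. -/
def Agrees (G H : SimpleGraph V) : Prop := ∀ x, Settled G x → ∀ y, H.Adj x y ↔ KnownEdge G x y

theorem KnownEdge.settled {G : SimpleGraph V} {x y : V} (h : KnownEdge G x y) :
    Settled G x ∨ Settled G y :=
  h.imp (fun h => ⟨_, h⟩) fun h => ⟨_, h⟩

theorem IsMinRoot.agrees [Fintype V] {G H : SimpleGraph V} {k : ℕ} (hH : IsMinRoot G k H) :
    Agrees G H := by
  intro x hx y
  constructor
  · exact fun h => Or.inl ((hH.known_iff hx y).2 h)
  · rintro (h | h)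
    · exact (hH.known_iff hx y).1 h
    · exact ((hH.known_iff ⟨x, h⟩ x).1 h).symm

theorem KnownEdge.isGate {G : SimpleGraph V} {x y : V} (h : KnownEdge G x y)
    (hy : ¬ Settled G y) : IsGate G x := by
  have h1 : Known G x y := h.resolve_right fun h' => hy ⟨x, h'⟩
  exact ⟨⟨y, h1⟩, y, hy, h1⟩

theorem InCore.isGate {G : SimpleGraph V} {x : V} (h : InCore G x) (hx : Settled G x) :
    IsGate G x :=
  h.resolve_left fun h' => h' hx

theorem Agrees.inCore_of_adj {G H : SimpleGraph V} (hA : Agrees G H) {x y : V}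
    (hx : ¬ Settled G x) (h : H.Adj x y) : InCore G y := by
  by_cases hy : Settled G y
  · exact Or.inr (((hA y hy x).1 h.symm).isGate hx)
  · exact Or.inl hy

/-- A vertex outside the core is settled and all its neighbours are settled, as otherwise it would
be a gate. So paths of length at most two from it consist of known edges. Between two settled
vertices they do so anyway. -/
theorem Agrees.withinTwo_iff {G H : SimpleGraph V} (hA : Agrees G H) {a b : V}
    (h : ¬ (InCore G a ∧ InCore G b ∧ ¬ (Settled G a ∧ Settled G b))) :
    WithinTwo H a b ↔ KnownEdge G a b ∨ ∃ c, KnownEdge G a c ∧ KnownEdge G c b := by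
  have hout : ∀ {a}, ¬ InCore G a → Settled G a := fun {a} h => by
    by_contra h'; exact h (Or.inl h')
  have key : ∀ a b c, ¬ InCore G a → H.Adj a c → H.Adj c b →
      KnownEdge G a c ∧ KnownEdge G c b := by
    intro a b c ha h1 h2
    have h3 := (hA a (hout ha) c).1 h1
    refine ⟨h3, (hA c ?_ b).1 h2⟩
    by_contra hc
    exact ha (Or.inr (h3.isGate hc))
  constructor
  · rintro (h1 | ⟨c, h1, h2⟩)
    · left
      by_cases ha : Settled G a
      · exact (hA a ha b).1 h1
      · by_cases hb : Settled G b
        · exact ((hA b hb a).1 h1.symm).symm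
        · exact absurd ⟨Or.inl ha, Or.inl hb, fun h => ha h.1⟩ h
    · right
      by_cases ha : InCore G a
      · by_cases hb : InCore G b
        · have hs : Settled G a ∧ Settled G b := by
            by_contra h'; exact h ⟨ha, hb, h'⟩
          exact ⟨c, (hA a hs.1 c).1 h1, ((hA b hs.2 c).1 h2.symm).symm⟩
        · have := key b a c hb h2.symm h1.symm
          exact ⟨c, this.2.symm, this.1.symm⟩
      · exact ⟨c, key a b c ha h1 h2⟩
  · have hof : ∀ {x y}, KnownEdge G x y → H.Adj x y := by
      intro x y h
      rcases h.settled with hx | hy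
      · exact (hA x hx y).2 h
      · exact ((hA y hy x).2 h.symm).symm
    rintro (h1 | ⟨c, h1, h2⟩)
    · exact Or.inl (hof h1)
    · exact Or.inr ⟨c, hof h1, hof h2⟩

/-- The part of `H` on the core. -/
def coreOf (G H : SimpleGraph V) : SimpleGraph {x // InCore G x} := H.comap Subtype.val

/-- The middle vertex of a path is adjacent to an unsettled vertex, hence lies in the core. -/
theorem Agrees.withinTwo_coreOf {G H : SimpleGraph V} (hA : Agrees G H) {a b : {x // InCore G x}}
    (h : ¬ (Settled G a ∧ Settled G b)) :
    WithinTwo (coreOf G H) a b ↔ WithinTwo H a.1 b.1 := by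
  refine or_congr Iff.rfl ⟨fun ⟨c, h1, h2⟩ => ⟨c.1, h1, h2⟩, fun ⟨c, h1, h2⟩ => ?_⟩
  refine ⟨⟨c, ?_⟩, h1, h2⟩
  by_cases ha : Settled G a.1
  · exact hA.inCore_of_adj (fun hb => h ⟨ha, hb⟩) h2.symm
  · exact hA.inCore_of_adj ha h1

/-- The number of ordered pairs of ends of known edges that do not lie in the core. -/
noncomputable def outCount [Fintype V] (G : SimpleGraph V) : ℕ :=
  ∑ a, ∑ b, if KnownEdge G a b ∧ ¬ (InCore G a ∧ InCore G b) then 1 else 0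

theorem sum_subtype_indicator [Fintype V] (p : V → Prop) (f : V → ℕ) :
    (∑ x : {x // p x}, f x) = ∑ x, if p x then f x else 0 := by
  rw [← Finset.sum_filter]
  exact (Finset.sum_subtype _ (by simp) f).symm

/-- An edge with an end outside the core is known, because that end is settled. Hence the number of
these edges depends on `G` alone. -/
theorem Agrees.adjCount_eq [Fintype V] {G H : SimpleGraph V} (hA : Agrees G H) :
    adjCount H = adjCount (coreOf G H) + outCount G := by
  have h1 : adjCount (coreOf G H) =
      ∑ a, ∑ b, if InCore G a ∧ InCore G b ∧ H.Adj a b then 1 else 0 := by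
    unfold adjCount
    simp only [coreOf, SimpleGraph.comap_adj]
    rw [sum_subtype_indicator (InCore G) fun a => ∑ b : {x // InCore G x}, if H.Adj a b then 1 else 0]
    refine Finset.sum_congr rfl fun a _ => ?_
    rw [sum_subtype_indicator (InCore G) fun b => if H.Adj a b then 1 else 0]
    by_cases ha : InCore G a
    · simp only [ha, if_true, true_and]
      exact Finset.sum_congr rfl fun b _ => by by_cases hb : InCore G b <;> simp [hb]
    · simp [ha]
  rw [h1, outCount, adjCount, ← Finset.sum_add_distrib]
  refine Finset.sum_congr rfl fun a _ => ?_
  rw [← Finset.sum_add_distrib]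
  refine Finset.sum_congr rfl fun b _ => ?_
  by_cases hc : InCore G a ∧ InCore G b
  · by_cases hab : H.Adj a b <;> simp [hc, hab]
  · have hk : H.Adj a b ↔ KnownEdge G a b := by
      by_cases ha : InCore G a
      · have hb : Settled G b := by
          by_contra h; exact hc ⟨ha, Or.inl h⟩
        rw [H.adj_comm, hA b hb a]
        exact ⟨KnownEdge.symm, KnownEdge.symm⟩
      · exact hA a (by by_contra h; exact ha (Or.inl h)) b
    by_cases hab : KnownEdge G a b
    · have : ¬ (InCore G a ∧ InCore G b ∧ True) := fun h => hc ⟨h.1, h.2.1⟩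
      simp [hk, hab, hc]
    · simp [hk, hab]

variable [LinearOrder V]

/-- The first gate of a component of the core. -/
def IsRep (G : SimpleGraph V) (r : V) : Prop :=
  IsGate G r ∧ ∀ r', IsGate G r' → (coreGraph G).Reachable r r' → r ≤ r'

theorem IsRep.eq {G : SimpleGraph V} {r r' : V} (h : IsRep G r) (h' : IsRep G r')
    (hr : (coreGraph G).Reachable r r') : r = r' :=
  le_antisymm (h.2 r' h'.1 hr) (h'.2 r h.1 hr.symm)

/-- Two core vertices are to be adjacent in the kernel. -/
def KernelAdj (G : SimpleGraph V) (a b : V) : Prop :=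
  (¬ (Settled G a ∧ Settled G b) ∧ G.Adj a b) ∨ (Settled G a ∧ Settled G b ∧ a ≠ b ∧
    (KnownEdge G a b ∨ (∃ c, InCore G c ∧ KnownEdge G a c ∧ KnownEdge G c b) ∨
      (IsRep G a ∧ IsRep G b)))

/-- The labels of the kernel between two core vertices. -/
noncomputable def coreLabel (G : SimpleGraph V) (a b : V) : ℕ :=
  if KnownEdge G a b then 2 else if KernelAdj G a b then
    (if Settled G a ∨ Settled G b then 3 else 1) else 0

/-- The labels of the kernel between a core vertex and a gadget vertex. -/
noncomputable def gadgetLabel (G : SimpleGraph V) (a : V) (g : ℕ) : ℕ :=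
  if IsRep G a then (if g = 0 then 2 else 3)
  else if g = 0 ∧ ∃ r, IsRep G r ∧ KnownEdge G a r then 3 else 0

/-- The labels of the kernel. -/
noncomputable def kernelLabel (G : SimpleGraph V) (δ : ℕ) :
    {x // InCore G x} ⊕ Fin (δ + 2) → {x // InCore G x} ⊕ Fin (δ + 2) → ℕ
  | .inl a, .inl b => coreLabel G a b
  | .inl a, .inr g => gadgetLabel G a g
  | .inr g, .inl a => gadgetLabel G a g
  | .inr g, .inr h => if g.val = h.val then 0 else if g.val ≤ 1 ∨ h.val ≤ 1 then 2 else 3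

theorem KernelAdj.symm {G : SimpleGraph V} {a b : V} (h : KernelAdj G a b) : KernelAdj G b a := by
  rcases h with ⟨h1, h2⟩ | ⟨h1, h2, h3, h4⟩
  · exact Or.inl ⟨fun h => h1 h.symm, h2.symm⟩
  · refine Or.inr ⟨h2, h1, h3.symm, ?_⟩
    rcases h4 with h | ⟨c, h5, h6, h7⟩ | h
    · exact Or.inl h.symm
    · exact Or.inr (Or.inl ⟨c, h5, h7.symm, h6.symm⟩)
    · exact Or.inr (Or.inr h.symm)

theorem coreLabel_symm (G : SimpleGraph V) (a b : V) : coreLabel G a b = coreLabel G b a := by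
  unfold coreLabel
  have h1 : KnownEdge G a b ↔ KnownEdge G b a := ⟨KnownEdge.symm, KnownEdge.symm⟩
  have h2 : KernelAdj G a b ↔ KernelAdj G b a := ⟨KernelAdj.symm, KernelAdj.symm⟩
  split_ifs <;> first | rfl | (exfalso; tauto)

theorem coreLabel_eq_two {G : SimpleGraph V} {a b : V} : coreLabel G a b = 2 ↔ KnownEdge G a b := by
  unfold coreLabel
  split_ifs <;> simp_all

theorem coreLabel_eq_three {G : SimpleGraph V} {a b : V} (h : coreLabel G a b = 3) :
    ¬ KnownEdge G a b ∧ (Settled G a ∨ Settled G b) := by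
  unfold coreLabel at h
  split_ifs at h <;> simp_all

theorem coreLabel_ne_zero {G : SimpleGraph V} {a b : V} :
    coreLabel G a b ≠ 0 ↔ KnownEdge G a b ∨ KernelAdj G a b := by
  unfold coreLabel
  split_ifs <;> simp_all

theorem gadgetLabel_eq_two {G : SimpleGraph V} {a : V} {g : ℕ} :
    gadgetLabel G a g = 2 ↔ IsRep G a ∧ g = 0 := by
  unfold gadgetLabel
  split_ifs <;> simp_all

theorem gadgetLabel_ne_zero {G : SimpleGraph V} {a : V} {g : ℕ} :
    gadgetLabel G a g ≠ 0 ↔ IsRep G a ∨ (g = 0 ∧ ∃ r, IsRep G r ∧ KnownEdge G a r) := by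
  unfold gadgetLabel
  split_ifs <;> simp_all

theorem kernelLabel_symm (G : SimpleGraph V) (δ : ℕ) (x y) :
    kernelLabel G δ x y = kernelLabel G δ y x := by
  rcases x with a | g <;> rcases y with b | h
  · exact coreLabel_symm G a b
  · rfl
  · rfl
  · simp only [kernelLabel]
    split_ifs <;> first | rfl | omega

theorem kernelLabel_self (G : SimpleGraph V) (δ : ℕ) (x) : kernelLabel G δ x x = 0 := by
  rcases x with a | g
  · have h1 : ¬ KnownEdge G a.1 a.1 := fun h => G.irrefl h.adj
    have h2 : ¬ KernelAdj G a.1 a.1 := by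
      rintro (h | h)
      · exact G.irrefl h.2
      · exact h.2.2.1 rfl
    simp [kernelLabel, coreLabel, h1, h2]
  · simp [kernelLabel]

theorem kernelLabel_le (G : SimpleGraph V) (δ : ℕ) (x y) : kernelLabel G δ x y ≤ 3 := by
  rcases x with a | g <;> rcases y with b | h <;> simp only [kernelLabel, coreLabel, gadgetLabel] <;>
    split_ifs <;> omega

/-- The known edges are consistent with `G`, and every component of the core has a gate. -/
structure Consistent (G : SimpleGraph V) : Prop where
  square : ∀ a b, a ≠ b → ¬ (InCore G a ∧ InCore G b ∧ ¬ (Settled G a ∧ Settled G b)) →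
    (G.Adj a b ↔ KnownEdge G a b ∨ ∃ c, KnownEdge G a c ∧ KnownEdge G c b)
  reach : ∀ s, InCore G s → ∃ r, IsRep G r ∧ (coreGraph G).Reachable s r

/-- Every core vertex reaches the first gate of its component, and all first gates are adjacent to
the gadget vertex `0`. -/
theorem Consistent.connected {G : SimpleGraph V} (h : Consistent G) (δ : ℕ) :
    (labelGraph (kernelLabel G δ) (kernelLabel_symm G δ) (kernelLabel_self G δ)).Connected := by
  set L := labelGraph (kernelLabel G δ) (kernelLabel_symm G δ) (kernelLabel_self G δ) with hL
  have hadj : ∀ x y, kernelLabel G δ x y ≠ 0 → L.Reachable x y :=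
    fun x y h => SimpleGraph.Adj.reachable h
  have hcore : ∀ (s r : V) (hs : InCore G s) (hr : InCore G r), (coreGraph G).Reachable s r →
      L.Reachable (.inl ⟨s, hs⟩) (.inl ⟨r, hr⟩) := by
    rintro s r hs hr ⟨w⟩
    induction w with
    | nil => exact .refl _
    | @cons u v _ h1 p ih =>
      have hv : InCore G v := h1.2.1
      refine (hadj (.inl ⟨u, hs⟩) (.inl ⟨v, hv⟩) ?_).trans (ih hv hr)
      have hk : KnownEdge G u v ∨ KernelAdj G u v := by
        rcases h1.2.2 with h2 | h2
        · exact Or.inr (Or.inl h2)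
        · exact Or.inl h2.2.2
      simp only [kernelLabel, coreLabel]
      split_ifs <;> simp_all
  have hg : ∀ g : Fin (δ + 2), L.Reachable (.inr g) (.inr 0) := by
    intro g
    by_cases hg : g = 0
    · rw [hg]
    · refine hadj _ _ ?_
      have : g.val ≠ 0 := fun h => hg (Fin.ext h)
      simp [kernelLabel, this]
  have hall : ∀ x, L.Reachable x (.inr 0) := by
    rintro (⟨s, hs⟩ | g)
    · obtain ⟨r, hr, hsr⟩ := h.reach s hs
      refine (hcore s r hs (Or.inr hr.1) hsr).trans (hadj _ _ ?_)
      simp [kernelLabel, gadgetLabel, hr]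
    · exact hg g
  have : Nonempty ({x // InCore G x} ⊕ Fin (δ + 2)) := ⟨.inr 0⟩
  exact SimpleGraph.Connected.mk fun x y => (hall x).trans (hall y).symm

/-- The labels are defined without a root; this ties their nonzero entries to the core of any
agreeing root. Pairs of settled vertices are governed by the known edges, other pairs by
`withinTwo_coreOf`. -/
theorem Agrees.label_iff {G H : SimpleGraph V} (hA : Agrees G H) (hG : square H = G) {δ : ℕ}
    (x y) (hne : x ≠ y) : kernelLabel G δ x y ≠ 0 ↔
      WithinTwo (joined (coreOf G H) (fun a => IsRep G a) δ) x y := by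
  have E := square_eq_iff.1 hG
  have hgad : ∀ a : {x // InCore G x}, ∀ g : Fin (δ + 2), gadgetLabel G a g ≠ 0 ↔
      WithinTwo (joined (coreOf G H) (fun a => IsRep G a) δ) (.inl a) (.inr g) := by
    intro a g
    rw [withinTwo_joined_inl_inr]
    have h1 : (∃ r, IsRep G r ∧ KnownEdge G a r) ↔
        ∃ r : {x // InCore G x}, IsRep G r ∧ (coreOf G H).Adj a r := by
      constructor
      · rintro ⟨r, h1, h2⟩
        exact ⟨⟨r, Or.inr h1.1⟩, h1, ((hA r h1.1.1 a).2 h2.symm).symm⟩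
      · rintro ⟨r, h1, h2⟩
        exact ⟨r, h1, ((hA r h1.1.1 a).1 h2.symm).symm⟩
    rw [← h1, gadgetLabel_ne_zero]
  rcases x with a | g <;> rcases y with b | h
  · rw [withinTwo_joined_inl_inl]
    have hab : a.1 ≠ b.1 := fun e => hne (congrArg _ (Subtype.ext e))
    rw [show kernelLabel G δ (.inl a) (.inl b) = coreLabel G a b from rfl, coreLabel_ne_zero]
    by_cases hs : Settled G a ∧ Settled G b
    · have e2 : WithinTwo (coreOf G H) a b ↔
          KnownEdge G a b ∨ ∃ c, InCore G c ∧ KnownEdge G a c ∧ KnownEdge G c b := by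
        refine or_congr (hA a hs.1 b) ⟨?_, ?_⟩
        · rintro ⟨c, h1, h2⟩
          exact ⟨c, c.2, (hA a hs.1 c).1 h1, ((hA b hs.2 c).1 h2.symm).symm⟩
        · rintro ⟨c, hc, h1, h2⟩
          exact ⟨⟨c, hc⟩, (hA a hs.1 c).2 h1, ((hA b hs.2 c).2 h2.symm).symm⟩
      have hs1 := hs.1
      have hs2 := hs.2
      rw [e2]
      simp only [KernelAdj, hs1, hs2, hab, ne_eq, not_false_eq_true, true_and, and_self,
        not_true_eq_false, false_and, false_or, ← or_assoc, or_self]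
    · have hr : ¬ (IsRep G a ∧ IsRep G b) := fun h => hs ⟨h.1.1.1, h.2.1.1⟩
      rw [hA.withinTwo_coreOf hs, ← E a b hab]
      unfold KernelAdj
      have := KnownEdge.adj (G := G) (x := a) (y := b)
      tauto
  · exact hgad a h
  · rw [show kernelLabel G δ (.inr g) (.inl b) = gadgetLabel G b g from rfl, hgad b g]
    exact ⟨WithinTwo.symm, WithinTwo.symm⟩
  · have hgh : g ≠ h := fun e => hne (congrArg _ e)
    have : g.val ≠ h.val := fun e => hgh (Fin.ext e)
    simp only [withinTwo_joined_inr_inr hgh, iff_true, kernelLabel, this, if_false]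
    split_ifs <;> simp

variable [Fintype V]

/-- The number of gates that are first in their components. -/
noncomputable def repCount (G : SimpleGraph V) : ℕ := (Finset.univ.filter (IsRep G)).card

theorem card_filter_subtype {V : Type*} [Fintype V] (p q : V → Prop) (h : ∀ x, q x → p x) :
    (Finset.univ.filter fun a : {x // p x} => q a).card = (Finset.univ.filter q).card := by
  rw [← Finset.card_map (Function.Embedding.subtype p)]
  congr 1
  ext x
  simp only [Finset.mem_map, Finset.mem_filter, Finset.mem_univ, true_and,
    Function.Embedding.subtype_apply, Subtype.exists, exists_and_left, exists_prop]
  constructor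
  · rintro ⟨y, h1, h2, rfl⟩; exact h1
  · exact fun hx => ⟨x, hx, h x hx, rfl⟩

theorem adjCount_joined_core {G : SimpleGraph V} (F : SimpleGraph {x // InCore G x}) (δ : ℕ) :
    adjCount (joined F (fun a => IsRep G a) δ) = adjCount F + 2 * repCount G + (4 * δ + 2) := by
  rw [adjCount_joined, repCount]
  congr 3
  exact card_filter_subtype _ _ fun x hx => Or.inr hx.1

/-- The equation `hδ` makes the two edge budgets equal. The labels force a solution of the kernel to
consist of the gadget and a graph `F` with the known edges at settled vertices; `F` with all known
edges is a root of `G`, where `Consistent` takes care of the pairs that `F` does not decide.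
Conversely, the core of a smallest root is joined to the gadget. -/
theorem solvable_kernelLabel_iff {G : SimpleGraph V} (hC : Consistent G) {k δ : ℕ}
    (hδ : 2 * δ + 2 * Fintype.card V + 2 * repCount G =
      outCount G + 2 + 2 * Fintype.card {x // InCore G x}) :
    Solvable (kernelLabel G δ) k ↔ Solvable (plainLabel G) k := by
  rw [solvable_plainLabel]
  constructor
  · rintro ⟨J, h1, h2, h3, h4⟩
    have hJ0 : ∀ x y, kernelLabel G δ x y = 0 → ¬ J.Adj x y := by
      intro x y h hJ
      exact ((h1 x y hJ.ne).2 (Or.inl hJ)) h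
    let F : SimpleGraph {x // InCore G x} := J.comap Sum.inl
    have hF : ∀ a b : {x // InCore G x}, F.Adj a b ↔ J.Adj (.inl a) (.inl b) := fun a b => Iff.rfl
    -- The label `1` does not occur at settled vertices, so `F` has no choice there.
    have hFk : ∀ a b : {x // InCore G x}, Settled G a ∨ Settled G b →
        (F.Adj a b ↔ KnownEdge G a b) := by
      intro a b hs
      refine ⟨fun h => ?_, fun h => h2 (.inl a) (.inl b) (coreLabel_eq_two.2 h)⟩
      by_contra hk
      have q0 : coreLabel G a b ≠ 0 := fun e => hJ0 (.inl a) (.inl b) e h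
      have q3 : coreLabel G a b ≠ 3 := fun e => h3 (.inl a) (.inl b) e h
      unfold coreLabel at q0 q3
      rw [if_neg hk, if_pos hs] at q0 q3
      split_ifs at q0 q3 <;> omega
    -- Labels involving gadget vertices are `0`, `2` or `3`, which determines `J` outside the core.
    have hJ : J = joined F (fun a => IsRep G a) δ := by
      have hgad : ∀ (a : {x // InCore G x}) (g : Fin (δ + 2)),
          J.Adj (.inl a) (.inr g) ↔ IsRep G a ∧ g.val = 0 := by
        intro a g
        refine ⟨fun h => ?_, fun h => h2 (.inl a) (.inr g) (gadgetLabel_eq_two.2 h)⟩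
        by_contra hk
        have q0 : gadgetLabel G a g ≠ 0 := fun e => hJ0 (.inl a) (.inr g) e h
        have q3 : gadgetLabel G a g ≠ 3 := fun e => h3 (.inl a) (.inr g) e h
        unfold gadgetLabel at q0 q3
        split_ifs at q0 q3 <;> simp_all
      ext x y
      rcases x with a | g <;> rcases y with b | h
      · exact Iff.rfl
      · exact hgad a h
      · rw [J.adj_comm]; exact hgad b g
      · have e : kernelLabel G δ (.inr g) (.inr h) =
          if g.val = h.val then 0 else if g.val ≤ 1 ∨ h.val ≤ 1 then 2 else 3 := rfl
        have q2 := h2 (.inr g) (.inr h)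
        have q3 := h3 (.inr g) (.inr h)
        change _ ↔ g ≠ h ∧ (g.val ≤ 1 ∨ h.val ≤ 1)
        by_cases hgh : g = h
        · subst hgh; simp
        · have hv : g.val ≠ h.val := fun e => hgh (Fin.ext e)
          by_cases hle : g.val ≤ 1 ∨ h.val ≤ 1
          · simp only [e, hv, hle, if_true, if_false] at q2
            simp [hgh, hle, q2]
          · simp only [e, hv, hle, if_false] at q3
            simp [hle, q3]
    let H : SimpleGraph V :=
      { Adj := fun x y => KnownEdge G x y ∨ ∃ (hx : InCore G x) (hy : InCore G y), F.Adj ⟨x, hx⟩ ⟨y, hy⟩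
        symm := ⟨fun x y h => h.imp KnownEdge.symm fun ⟨hx, hy, h⟩ => ⟨hy, hx, h.symm⟩⟩
        loopless := ⟨fun x h => h.elim (fun h => G.irrefl h.adj) fun ⟨_, _, h⟩ => F.irrefl h⟩ }
    have hHF : coreOf G H = F := by
      ext a b
      constructor
      · rintro (h | ⟨_, _, h⟩)
        · exact (hFk a b h.settled).2 h
        · exact h
      · exact fun h => Or.inr ⟨a.2, b.2, h⟩
    have hA : Agrees G H := by
      intro x hx y
      refine ⟨?_, Or.inl⟩
      rintro (h | ⟨hx', hy', h⟩)
      · exact h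
      · exact (hFk _ _ (Or.inl hx)).1 h
    refine ⟨H, ?_, ?_⟩
    · rw [square_eq_iff]
      intro a b hab
      by_cases hcase : InCore G a ∧ InCore G b ∧ ¬ (Settled G a ∧ Settled G b)
      · obtain ⟨ha, hb, hs⟩ := hcase
        have q := h1 (.inl ⟨a, ha⟩) (.inl ⟨b, hb⟩) (by simpa using hab)
        rw [hJ, withinTwo_joined_inl_inl, ← hHF, hA.withinTwo_coreOf hs] at q
        have hr : ¬ (IsRep G a ∧ IsRep G b) := fun h => hs ⟨h.1.1.1, h.2.1.1⟩
        simp only [hr, or_false] at q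
        rw [← q]
        rw [show kernelLabel G δ (.inl ⟨a, ha⟩) (.inl ⟨b, hb⟩) = coreLabel G a b from rfl,
          coreLabel_ne_zero]
        have := KnownEdge.adj (G := G) (x := a) (y := b)
        unfold KernelAdj
        tauto
      · rw [hA.withinTwo_iff hcase]
        exact hC.square a b hab hcase
    · rw [hA.adjCount_eq, hHF]
      rw [hJ, adjCount_joined_core, Fintype.card_sum, Fintype.card_fin] at h4
      omega
  · rintro ⟨H, hH⟩
    obtain ⟨H, hH⟩ := exists_isMinRoot hH
    have hA := hH.agrees
    refine ⟨joined (coreOf G H) (fun a => IsRep G a) δ,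
      fun x y hne => hA.label_iff hH.1.1 x y hne, ?_, ?_, ?_⟩
    · rintro (a | g) (b | h) hl
      · have hk := coreLabel_eq_two.1 (show coreLabel G a b = 2 from hl)
        rcases hk.settled with hs | hs
        · exact (hA a hs b).2 hk
        · exact ((hA b hs a).2 hk.symm).symm
      · exact gadgetLabel_eq_two.1 (show gadgetLabel G a h = 2 from hl)
      · exact gadgetLabel_eq_two.1 (show gadgetLabel G b g = 2 from hl)
      · simp only [kernelLabel] at hl
        split_ifs at hl with q1 q2
        · exact ⟨fun e => q1 (congrArg _ e), q2⟩
        · omega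
    · rintro (a | g) (b | h) hl hadj
      · obtain ⟨q1, q3⟩ := coreLabel_eq_three (show coreLabel G a b = 3 from hl)
        have hadj' : H.Adj a b := hadj
        rcases q3 with q3 | q3
        · exact q1 ((hA a q3 b).1 hadj')
        · exact q1 ((hA b q3 a).1 hadj'.symm).symm
      · have h1 := gadgetLabel_eq_two.2 (show IsRep G a ∧ h.val = 0 from hadj)
        have h2 : gadgetLabel G a h = 3 := hl
        omega
      · have h1 := gadgetLabel_eq_two.2 (show IsRep G b ∧ g.val = 0 from hadj)
        have h2 : gadgetLabel G b g = 3 := hl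
        omega
      · simp only [kernelLabel] at hl
        split_ifs at hl with q1 q2
        · omega
        · exact q2 hadj.2
    · have h1 := hA.adjCount_eq
      have h2 := hH.1.2
      rw [adjCount_joined_core, Fintype.card_sum, Fintype.card_fin]
      omega

/-- On a walk in `H` from a core vertex to a settled vertex, the first settled vertex is a gate, and
up to there the walk stays in the core. -/
theorem IsMinRoot.consistent {G H : SimpleGraph V} {k : ℕ} (hG : G.Connected)
    (hH : IsMinRoot G k H) (hs : ∃ x, Settled G x) : Consistent G := by
  have hconn : H.Connected := square_connected_iff.1 (hH.1.1.symm ▸ hG)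
  have hA := hH.agrees
  refine ⟨fun a b hab hcase => ?_, fun s hs' => ?_⟩
  · rw [← hA.withinTwo_iff hcase]
    exact (square_eq_iff.1 hH.1.1) a b hab
  · obtain ⟨y, hy⟩ := hs
    obtain ⟨w⟩ := hconn.preconnected s y
    have key : ∃ g, IsGate G g ∧ (coreGraph G).Reachable s g := by
      induction w with
      | nil => exact ⟨_, hs'.isGate hy, .refl _⟩
      | @cons u v _ h p ih =>
        by_cases hu : Settled G u
        · exact ⟨u, hs'.isGate hu, .refl _⟩
        · have hv := hA.inCore_of_adj hu h
          obtain ⟨g, h1, h2⟩ := ih hv hy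
          refine ⟨g, h1, SimpleGraph.Reachable.trans (SimpleGraph.Adj.reachable ?_) h2⟩
          exact ⟨hs', hv, Or.inl ⟨fun h => hu h.1, hH.1.1 ▸ le_square H h⟩⟩
    obtain ⟨g, hg, hsg⟩ := key
    obtain ⟨r, hr, hmin⟩ := Finset.exists_min_image
      (Finset.univ.filter fun r => IsGate G r ∧ (coreGraph G).Reachable s r) id
      ⟨g, by simp [hg, hsg]⟩
    rw [Finset.mem_filter] at hr
    refine ⟨r, ⟨hr.2.1, fun r' h1 h2 => hmin r' ?_⟩, hr.2.2⟩
    simp [h1, hr.2.2.trans h2]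

/-- For `δ ≤ k`: joining the core to a gadget of rank `0` gives a connected graph, so the core has
many edges and few are left outside. For `0 ≤ δ`: contracting the components of the core gives a
connected graph, so enough edges lie outside. -/
theorem IsMinRoot.exists_excess {G H : SimpleGraph V} {k : ℕ} (hG : G.Connected)
    (hH : IsMinRoot G k H) (hC : Consistent G) : ∃ δ ≤ k,
      2 * δ + 2 * Fintype.card V + 2 * repCount G =
        outCount G + 2 + 2 * Fintype.card {x // InCore G x} := by
  have hconn : H.Connected := square_connected_iff.1 (hH.1.1.symm ▸ hG)
  have hA := hH.agrees
  have h1 := hA.adjCount_eq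
  have h2 := hH.1.2
  have h3 : 2 * Fintype.card {x // InCore G x} ≤ adjCount (coreOf G H) + 2 * repCount G := by
    have hsq : square (joined (coreOf G H) (fun a => IsRep G a) 0) =
        labelGraph (kernelLabel G 0) (kernelLabel_symm G 0) (kernelLabel_self G 0) :=
      square_eq_iff.2 fun x y hne => hA.label_iff hH.1.1 x y hne
    have h4 := two_mul_card_le_of_connected (square_connected_iff.1 (hsq ▸ hC.connected 0))
    rw [adjCount_joined_core, Fintype.card_sum, Fintype.card_fin] at h4
    omega
  have h4 : 2 * (Fintype.card V - Fintype.card {x // InCore G x} + repCount G) ≤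
      outCount G + 2 := by
    choose! rep hrep using hC.reach
    -- Contract every component of the core to its first gate; the edges that survive are known and
    -- lie outside the core.
    let f : V → {x // ¬ InCore G x} ⊕ {r // IsRep G r} := fun x =>
      if h : InCore G x then .inr ⟨rep x, (hrep x h).1⟩ else .inl ⟨x, h⟩
    have hf : Function.Surjective f := by
      rintro (⟨x, hx⟩ | ⟨r, hr⟩)
      · exact ⟨x, by simp [f, hx]⟩
      · have hc : InCore G r := Or.inr hr.1
        refine ⟨r, ?_⟩
        simp only [f, hc, dif_pos]
        exact congrArg _ (Subtype.ext (hr.eq (hrep r hc).1 (hrep r hc).2).symm)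
    have h5 := two_mul_card_le_of_surjective hconn f hf
    rw [Fintype.card_sum, Fintype.card_subtype_compl,
      show Fintype.card {r // IsRep G r} = repCount G from Fintype.card_subtype _] at h5
    refine h5.trans (Nat.add_le_add_right (Finset.sum_le_sum fun a _ =>
      Finset.sum_le_sum fun b _ => ?_) 2)
    by_cases hab : H.Adj a b ∧ f a ≠ f b
    · have hnc : ¬ (InCore G a ∧ InCore G b) := by
        rintro ⟨ha, hb⟩
        refine hab.2 ?_
        simp only [f, ha, hb, dif_pos]
        refine congrArg _ (Subtype.ext ((hrep a ha).1.eq (hrep b hb).1 ?_))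
        refine (hrep a ha).2.symm.trans (SimpleGraph.Reachable.trans
          (SimpleGraph.Adj.reachable ?_) (hrep b hb).2)
        refine ⟨ha, hb, ?_⟩
        by_cases hs : Settled G a ∧ Settled G b
        · exact Or.inr ⟨hs.1, hs.2, (hA a hs.1 b).1 hab.1⟩
        · exact Or.inl ⟨hs, hH.1.1 ▸ le_square H hab.1⟩
      have hk : KnownEdge G a b := by
        by_cases ha : Settled G a
        · exact (hA a ha b).1 hab.1
        · have hb : Settled G b := by
            by_contra hb
            exact hnc ⟨Or.inl ha, Or.inl hb⟩
          exact ((hA b hb a).1 hab.1.symm).symm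
      rw [if_pos hab, if_pos ⟨hk, hnc⟩]
    · rw [if_neg hab]
      exact Nat.zero_le _
  have h5 := Fintype.card_subtype_le (InCore G)
  -- In terms of edge numbers all counts of ordered pairs are seen to be even, so the division by
  -- two is exact.
  rw [TreePlusK.adjCount_eq, TreePlusK.adjCount_eq (coreOf G H)] at h1
  rw [TreePlusK.adjCount_eq] at h2
  rw [TreePlusK.adjCount_eq] at h3
  refine ⟨(outCount G + 2 + 2 * Fintype.card {x // InCore G x} - 2 * Fintype.card V -
    2 * repCount G) / 2, by omega, by omega⟩

/-- A bound for the number of vertices of the kernel. -/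
def kernelBound (k : ℕ) : ℕ := 36 * (k * k) + 26 * k + 8

/-- In a connected graph without large classes of twins that is larger than the kernel may be, the
existence of a square root with few edges implies that the kernel exists. -/
theorem kernel_of_solvable {G : SimpleGraph V} {k : ℕ} (hG : G.Connected)
    (hT : ∀ T : Finset V, (∀ x ∈ T, ∀ y ∈ T, Twin G x y) → T.card ≤ 6 * k + 3)
    (hn : kernelBound k < Fintype.card V) (hs : Solvable (plainLabel G) k) :
    Consistent G ∧ ∃ δ, Fintype.card {x // InCore G x} + (δ + 2) ≤ kernelBound k ∧
      2 * δ + 2 * Fintype.card V + 2 * repCount G =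
        outCount G + 2 + 2 * Fintype.card {x // InCore G x} := by
  obtain ⟨H, hH⟩ := solvable_plainLabel.1 hs
  obtain ⟨H, hH⟩ := exists_isMinRoot hH
  have hn' : kernelBound k = 36 * (k * k) + 26 * k + 8 := rfl
  -- For `t = 6 * k + 3` the requirement is `12 * k + 8 < |V|`, which explains the summand `8` of
  -- `kernelBound`. The core takes `36 * k ^ 2 + 24 * k` vertices and the gadget at most `k + 2`.
  have h1 := card_inCore_le hG hH hT (by nlinarith)
  rw [← Fintype.card_subtype] at h1
  have h1' : Fintype.card {x // InCore G x} ≤ 36 * (k * k) + 24 * k := by nlinarith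
  have h2 : ∃ x, Settled G x := by
    by_contra hcon
    push Not at hcon
    have : Fintype.card {x // InCore G x} = Fintype.card V :=
      Fintype.card_congr (Equiv.subtypeUnivEquiv fun x => Or.inl (hcon x))
    omega
  have h3 := hH.consistent hG h2
  obtain ⟨δ, hδ, h4⟩ := hH.exists_excess hG h3
  exact ⟨h3, δ, by omega, h4⟩

end Kernel

end TreePlusK

namespace TreePlusK

/-! ### Expressions and their compilation -/

section Machine

/-- Expressions, evaluated by machine programs. `sum x e` is the sum of the values of `e` for
`x = 0, …, N - 1`, where `N` is the content of register `1`; meanwhile register `x + 1` holds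
`x * N`. -/
inductive Ex where
  | lit (n : ℕ)
  | var (r : ℕ)
  | add (a b : Ex)
  | sub (a b : Ex)
  | half (a : Ex)
  | ld (a : Ex)
  | ite (a b c : Ex)
  | sum (x : ℕ) (e : Ex)

/-- Assign `i` and `i * N` to the registers `x` and `x + 1`. -/
def bindVar (ρ : ℕ → ℕ) (x i N : ℕ) : ℕ → ℕ :=
  Function.update (Function.update ρ x i) (x + 1) (i * N)

/-- The value of an expression. -/
def Ex.eval : Ex → (ℕ → ℕ) → (ℕ → ℕ) → ℕ
  | .lit n, _, _ => n
  | .var r, ρ, _ => ρ r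
  | .add a b, ρ, m => a.eval ρ m + b.eval ρ m
  | .sub a b, ρ, m => a.eval ρ m - b.eval ρ m
  | .half a, ρ, m => a.eval ρ m / 2
  | .ld a, ρ, m => m (a.eval ρ m)
  | .ite a b c, ρ, m => if 0 < a.eval ρ m then b.eval ρ m else c.eval ρ m
  | .sum x e, ρ, m => ∑ i ∈ Finset.range (ρ 1), e.eval (bindVar ρ x i (ρ 1)) m

/-- The number of steps of the evaluation of an expression. -/
def Ex.cost : Ex → (ℕ → ℕ) → (ℕ → ℕ) → ℕ
  | .lit _, _, _ => 1
  | .var _, _, _ => 1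
  | .add a b, ρ, m => a.cost ρ m + (b.cost ρ m + 1)
  | .sub a b, ρ, m => a.cost ρ m + (b.cost ρ m + 1)
  | .half a, ρ, m => a.cost ρ m + 1
  | .ld a, ρ, m => a.cost ρ m + 1
  | .ite a b c, ρ, m => a.cost ρ m + ((if 0 < a.eval ρ m then b.cost ρ m else c.cost ρ m) + 1)
  | .sum x e, ρ, m => ∑ i ∈ Finset.range (ρ 1), (e.cost (bindVar ρ x i (ρ 1)) m + 5) + 10

/-- The expression mentions registers below `d` only. -/
def Ex.Wf : Ex → ℕ → Prop
  | .lit _, _ => True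
  | .var r, d => r < d
  | .add a b, d => a.Wf d ∧ b.Wf d
  | .sub a b, d => a.Wf d ∧ b.Wf d
  | .half a, d => a.Wf d
  | .ld a, d => a.Wf d
  | .ite a b c, d => a.Wf d ∧ b.Wf d ∧ c.Wf d
  | .sum x e, d => 2 ≤ x ∧ x + 1 < d ∧ e.Wf d

theorem Ex.Wf.mono {e : Ex} {d d' : ℕ} (h : e.Wf d) (hd : d ≤ d') : e.Wf d' := by
  induction e with
  | lit n => trivial
  | var r => exact lt_of_lt_of_le h hd
  | add a b iha ihb => exact ⟨iha h.1, ihb h.2⟩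
  | sub a b iha ihb => exact ⟨iha h.1, ihb h.2⟩
  | half a ih => exact ih h
  | ld a ih => exact ih h
  | ite a b c iha ihb ihc => exact ⟨iha h.1, ihb h.2.1, ihc h.2.2⟩
  | sum x e ih => exact ⟨h.1, h.2.1.trans_le hd, ih h.2.2⟩

theorem bindVar_congr {ρ ρ' : ℕ → ℕ} {d x i N : ℕ} (h : ∀ r < d, ρ r = ρ' r) :
    ∀ r < d, bindVar ρ x i N r = bindVar ρ' x i N r := by
  intro r hr
  unfold bindVar
  simp only [Function.update_apply]
  split_ifs <;> first | rfl | exact h r hr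

/-- Compiled code uses the registers from `d` on as scratch space, which must not influence
expressions over the registers below `d`. -/
theorem Ex.congr {e : Ex} {d : ℕ} (he : e.Wf d) :
    ∀ {ρ ρ' : ℕ → ℕ} {m : ℕ → ℕ}, (∀ r < d, ρ r = ρ' r) →
      e.eval ρ m = e.eval ρ' m ∧ e.cost ρ m = e.cost ρ' m := by
  induction e with
  | lit n => exact fun _ => ⟨rfl, rfl⟩
  | var r => exact fun h => ⟨h r he, rfl⟩
  | add a b iha ihb =>
    intro ρ ρ' m h
    simp only [Ex.eval, Ex.cost, iha he.1 h, ihb he.2 h, and_self]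
  | sub a b iha ihb =>
    intro ρ ρ' m h
    simp only [Ex.eval, Ex.cost, iha he.1 h, ihb he.2 h, and_self]
  | half a ih =>
    intro ρ ρ' m h
    simp only [Ex.eval, Ex.cost, ih he h, and_self]
  | ld a ih =>
    intro ρ ρ' m h
    simp only [Ex.eval, Ex.cost, ih he h, and_self]
  | ite a b c iha ihb ihc =>
    intro ρ ρ' m h
    simp only [Ex.eval, Ex.cost, iha he.1 h, ihb he.2.1 h, ihc he.2.2 h, and_self]
  | sum x e ih =>
    intro ρ ρ' m h
    have h1 : ρ 1 = ρ' 1 := h 1 (by have := he.1; have := he.2.1; omega)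
    simp only [Ex.eval, Ex.cost, h1]
    refine ⟨Finset.sum_congr rfl fun i _ => (ih he.2.2 (bindVar_congr h)).1, ?_⟩
    congr 1
    exact Finset.sum_congr rfl fun i _ => by rw [(ih he.2.2 (bindVar_congr h)).2]

/-- The program that evaluates an expression into register `d`, with auxiliary registers above
`d`. -/
def Ex.compile : Ex → ℕ → Prog
  | .lit n, d => .const d n
  | .var r, d => .move d r
  | .add a b, d => .seq (a.compile d) (.seq (b.compile (d + 1)) (.add d d (d + 1)))
  | .sub a b, d => .seq (a.compile d) (.seq (b.compile (d + 1)) (.sub d d (d + 1)))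
  | .half a, d => .seq (a.compile d) (.half d d)
  | .ld a, d => .seq (a.compile d) (.load d d)
  | .ite a b c, d => .seq (a.compile d) (.ifPos d (b.compile d) (c.compile d))
  | .sum x e, d =>
    .seq (.move (d + 1) x) (.seq (.move (d + 2) (x + 1)) (.seq (.move (d + 3) 1)
      (.seq (.const (d + 4) 1) (.seq (.const d 0) (.seq (.const x 0) (.seq (.const (x + 1) 0)
        (.seq (.whilePos (d + 3)
          (.seq (e.compile (d + 5)) (.seq (.add d d (d + 5)) (.seq (.add x x (d + 4))
            (.seq (.add (x + 1) (x + 1) 1) (.sub (d + 3) (d + 3) (d + 4)))))))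
          (.seq (.move x (d + 1)) (.move (x + 1) (d + 2))))))))))

theorem exec_cast {p : Prog} {s s' : State} {t t' : ℕ} (h : Exec p s t s') (ht : t = t') :
    Exec p s t' s' := ht ▸ h

/-- Induction on the number `j` of remaining rounds. Register `d + 3` counts down, `d` accumulates,
and `x` and `x + 1` advance by `1` and `N`, so that `x * N` is available without multiplication. -/
theorem Ex.compile_loop {e : Ex} {x d N : ℕ} (hx : 2 ≤ x) (hxd : x + 1 < d)
    (hc : ∀ s : State, ∃ s', Exec (e.compile (d + 5)) s (e.cost s.reg s.mem) s' ∧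
      s'.reg (d + 5) = e.eval s.reg s.mem ∧ (∀ r < d + 5, s'.reg r = s.reg r) ∧ s'.mem = s.mem)
    (he : e.Wf d) (ρ m : ℕ → ℕ) (hρ : ρ 1 = N) (j : ℕ) :
    ∀ (i : ℕ) (s : State), i + j = N → s.mem = m → s.reg (d + 3) = j → s.reg (d + 4) = 1 →
      (∀ r < d, s.reg r = bindVar ρ x i N r) →
      ∃ s', Exec (.whilePos (d + 3)
          (.seq (e.compile (d + 5)) (.seq (.add d d (d + 5)) (.seq (.add x x (d + 4))
            (.seq (.add (x + 1) (x + 1) 1) (.sub (d + 3) (d + 3) (d + 4))))))) s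
          (∑ i' ∈ Finset.range j, (e.cost (bindVar ρ x (i + i') N) m + 5) + 1) s' ∧
        s'.reg d = s.reg d + ∑ i' ∈ Finset.range j, e.eval (bindVar ρ x (i + i') N) m ∧
        (∀ r < d, r ≠ x → r ≠ x + 1 → s'.reg r = ρ r) ∧ s'.reg (d + 1) = s.reg (d + 1) ∧
        s'.reg (d + 2) = s.reg (d + 2) ∧ s'.mem = m := by
  induction j with
  | zero =>
    intro i s _ hm h3 _ hr
    refine ⟨s, exec_cast (.while_zero h3) (by simp), by simp, ?_, rfl, rfl, hm⟩
    intro r hrd h1 h2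
    rw [hr r hrd]
    simp [bindVar, h1, h2]
  | succ j ih =>
    intro i s hij hm h3 h4 hr
    obtain ⟨s1, hs1, hv, hlow, hmem⟩ := hc s
    obtain ⟨hev, hco⟩ := Ex.congr he (m := m) hr
    rw [hm] at hs1 hv
    rw [hev] at hv
    rw [hco] at hs1
    have hx1 : s1.reg x = i := by
      rw [hlow x (by omega), hr x (by omega)]; simp [bindVar]
    have hx2 : s1.reg (x + 1) = i * N := by
      rw [hlow _ (by omega), hr _ (by omega)]; simp [bindVar]
    have h11 : s1.reg 1 = N := by
      rw [hlow 1 (by omega), hr 1 (by omega)]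
      have h1 : 1 ≠ x := by omega
      have h2 : 1 ≠ x + 1 := by omega
      unfold bindVar
      rw [Function.update_of_ne h2, Function.update_of_ne h1, hρ]
    let s2 := s1.setReg d (s1.reg d + s1.reg (d + 5))
    let s3 := s2.setReg x (s2.reg x + s2.reg (d + 4))
    let s4 := s3.setReg (x + 1) (s3.reg (x + 1) + s3.reg 1)
    let s5 := s4.setReg (d + 3) (s4.reg (d + 3) - s4.reg (d + 4))
    have hs5 : ∀ r, s5.reg r = if r = d + 3 then j else if r = x + 1 then (i + 1) * N
        else if r = x then i + 1 else if r = d then s1.reg d + e.eval (bindVar ρ x i N) m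
        else s1.reg r := by
      intro r
      have e1 := hlow (d + 3) (by omega)
      have e2 := hlow (d + 4) (by omega)
      have n1 : d ≠ x := by omega
      have n2 : d ≠ x + 1 := by omega
      have n3 : d + 4 ≠ x := by omega
      have n4 : d + 4 ≠ x + 1 := by omega
      have n5 : d + 3 ≠ x := by omega
      have n6 : d + 3 ≠ x + 1 := by omega
      have n7 : 1 ≠ x := by omega
      have n8 : 1 ≠ d := by omega
      have n9 : 1 ≠ x + 1 := by omega
      simp only [s5, s4, s3, s2, State.setReg, Function.update_apply]
      split_ifs <;> first | omega | rfl | simp_all [Nat.succ_mul]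
    obtain ⟨s', hs', hd', hl', h1', h2', hm'⟩ := ih (i + 1) s5 (by omega) (hmem.trans hm)
      (by rw [hs5]; simp)
      (by
        rw [hs5]
        have n1 : d + 4 ≠ x + 1 := by omega
        have n2 : d + 4 ≠ x := by omega
        simp [n1, n2, hlow, h4])
      (by
        intro r hrd
        rw [hs5]
        have n1 : r ≠ d + 3 := by omega
        have n2 : r ≠ d := by omega
        rw [if_neg n1, if_neg n2]
        by_cases q1 : r = x + 1
        · simp [q1, bindVar]
        · by_cases q2 : r = x
          · simp [q2, bindVar]
          · rw [if_neg q1, if_neg q2, hlow r (by omega), hr r hrd]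
            simp [bindVar, q1, q2])
    refine ⟨s', ?_, ?_, hl', ?_, ?_, hm'⟩
    · refine exec_cast (.while_pos (by omega) (.seq hs1 (.seq (.add s1 d d (d + 5))
        (.seq (.add s2 x x (d + 4)) (.seq (.add s3 (x + 1) (x + 1) 1)
          (.sub s4 (d + 3) (d + 3) (d + 4)))))) hs') ?_
      -- The round just executed is the first term of the sum, so this term is split off at the
      -- front.
      rw [Finset.sum_range_succ' _ j]
      simp only [Nat.add_zero, Nat.add_right_comm i 1, Nat.add_assoc]
      omega
    · rw [hd', hs5]
      have n1 : d ≠ x + 1 := by omega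
      have n2 : d ≠ x := by omega
      rw [if_neg (by omega), if_neg n1, if_neg n2, if_pos rfl, hlow d (by omega),
        Finset.sum_range_succ' _ j]
      simp only [Nat.add_zero, Nat.add_right_comm i 1, Nat.add_assoc]
      omega
    · rw [h1', hs5, if_neg (by omega), if_neg (by omega), if_neg (by omega), if_neg (by omega),
        hlow _ (by omega)]
    · rw [h2', hs5, if_neg (by omega), if_neg (by omega), if_neg (by omega), if_neg (by omega),
        hlow _ (by omega)]

/-- A sum overwrites the registers `x` and `x + 1` below `d`; they are saved in `d + 1` and `d + 2`
and restored, so all registers below `d` survive. -/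
theorem Ex.compile_spec (e : Ex) : ∀ (d : ℕ) (s : State), e.Wf d →
    ∃ s', Exec (e.compile d) s (e.cost s.reg s.mem) s' ∧ s'.reg d = e.eval s.reg s.mem ∧
      (∀ r < d, s'.reg r = s.reg r) ∧ s'.mem = s.mem := by
  have low : ∀ (s : State) (d n : ℕ), ∀ r < d, (s.setReg d n).reg r = s.reg r := by
    intro s d n r hr
    simp [State.setReg, hr.ne]
  have bin : ∀ (a b : Ex) (op : ℕ → ℕ → ℕ) (P : ℕ → Prog),
      (∀ s d, Exec (P d) s 1 (s.setReg d (op (s.reg d) (s.reg (d + 1))))) →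
      (∀ (d : ℕ) (s : State), a.Wf d → ∃ s', Exec (a.compile d) s (a.cost s.reg s.mem) s' ∧
        s'.reg d = a.eval s.reg s.mem ∧ (∀ r < d, s'.reg r = s.reg r) ∧ s'.mem = s.mem) →
      (∀ (d : ℕ) (s : State), b.Wf d → ∃ s', Exec (b.compile d) s (b.cost s.reg s.mem) s' ∧
        s'.reg d = b.eval s.reg s.mem ∧ (∀ r < d, s'.reg r = s.reg r) ∧ s'.mem = s.mem) →
      ∀ (d : ℕ) (s : State), a.Wf d → b.Wf d →
      ∃ s', Exec (.seq (a.compile d) (.seq (b.compile (d + 1)) (P d))) s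
          (a.cost s.reg s.mem + (b.cost s.reg s.mem + 1)) s' ∧
        s'.reg d = op (a.eval s.reg s.mem) (b.eval s.reg s.mem) ∧
        (∀ r < d, s'.reg r = s.reg r) ∧ s'.mem = s.mem := by
    intro a b op P hP iha ihb d s ha hb
    obtain ⟨s1, h1, h2, h3, h4⟩ := iha d s ha
    obtain ⟨s2, h5, h6, h7, h8⟩ := ihb (d + 1) s1 (hb.mono (by omega))
    obtain ⟨c1, c2⟩ := Ex.congr hb (m := s.mem) (fun r hr => h3 r hr)
    rw [h4] at h5 h6
    rw [c2] at h5
    rw [c1] at h6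
    refine ⟨_, .seq h1 (.seq h5 (hP s2 d)), ?_, ?_, h8.trans h4⟩
    · simp [State.setReg, h6, h7 d (by omega), h2]
    · intro r hr
      rw [low _ _ _ r hr, h7 r (by omega), h3 r hr]
  induction e with
  | lit n => exact fun d s _ => ⟨_, .const s d n, by simp [State.setReg, Ex.eval], low s d n, rfl⟩
  | var r => exact fun d s _ => ⟨_, .move s d r, by simp [State.setReg, Ex.eval], low s d _, rfl⟩
  | add a b iha ihb =>
    exact fun d s h => bin a b (· + ·) (fun d => .add d d (d + 1))
      (fun s d => .add s d d (d + 1)) iha ihb d s h.1 h.2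
  | sub a b iha ihb =>
    exact fun d s h => bin a b (· - ·) (fun d => .sub d d (d + 1))
      (fun s d => .sub s d d (d + 1)) iha ihb d s h.1 h.2
  | half a ih =>
    intro d s h
    obtain ⟨s1, h1, h2, h3, h4⟩ := ih d s h
    refine ⟨_, .seq h1 (.half s1 d d), by simp [State.setReg, Ex.eval, h2], ?_, h4⟩
    intro r hr
    rw [low _ _ _ r hr, h3 r hr]
  | ld a ih =>
    intro d s h
    obtain ⟨s1, h1, h2, h3, h4⟩ := ih d s h
    refine ⟨_, .seq h1 (.load s1 d d), by simp [State.setReg, Ex.eval, h2, h4], ?_, h4⟩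
    intro r hr
    rw [low _ _ _ r hr, h3 r hr]
  | ite a b c iha ihb ihc =>
    intro d s h
    obtain ⟨s1, h1, h2, h3, h4⟩ := iha d s h.1
    by_cases hp : 0 < a.eval s.reg s.mem
    · obtain ⟨s2, h5, h6, h7, h8⟩ := ihb d s1 h.2.1
      obtain ⟨c1, c2⟩ := Ex.congr h.2.1 (m := s.mem) (fun r hr => h3 r hr)
      rw [h4] at h5 h6
      rw [c2] at h5
      rw [c1] at h6
      refine ⟨s2, exec_cast (.seq h1 (.if_pos (by omega) h5)) ?_, ?_, ?_, h8.trans h4⟩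
      · simp [Ex.cost, hp]
      · simp [Ex.eval, hp, h6]
      · intro r hr; rw [h7 r hr, h3 r hr]
    · obtain ⟨s2, h5, h6, h7, h8⟩ := ihc d s1 h.2.2
      obtain ⟨c1, c2⟩ := Ex.congr h.2.2 (m := s.mem) (fun r hr => h3 r hr)
      rw [h4] at h5 h6
      rw [c2] at h5
      rw [c1] at h6
      refine ⟨s2, exec_cast (.seq h1 (.if_zero (by omega) h5)) ?_, ?_, ?_, h8.trans h4⟩
      · simp [Ex.cost, hp]
      · simp [Ex.eval, hp, h6]
      · intro r hr; rw [h7 r hr, h3 r hr]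
  | sum x e ih =>
    intro d s ⟨hx, hxd, he⟩
    let s1 := s.setReg (d + 1) (s.reg x)
    let s2 := s1.setReg (d + 2) (s1.reg (x + 1))
    let s3 := s2.setReg (d + 3) (s2.reg 1)
    let s4 := s3.setReg (d + 4) 1
    let s5 := s4.setReg d 0
    let s6 := s5.setReg x 0
    let s7 := s6.setReg (x + 1) 0
    have hs7 : ∀ r, s7.reg r = if r = x + 1 then 0 else if r = x then 0 else if r = d then 0
        else if r = d + 4 then 1 else if r = d + 3 then s.reg 1 else if r = d + 2 then s.reg (x + 1)
        else if r = d + 1 then s.reg x else s.reg r := by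
      intro r
      have n1 : x + 1 ≠ d + 1 := by omega
      have n2 : 1 ≠ d + 2 := by omega
      have n3 : 1 ≠ d + 1 := by omega
      simp only [s7, s6, s5, s4, s3, s2, s1, State.setReg, Function.update_apply, n1, n2, n3, if_false]
    obtain ⟨s8, h8, hd8, hl8, h18, h28, hm8⟩ := Ex.compile_loop hx hxd
      (fun s => ih (d + 5) s (he.mono (by omega))) he s.reg s.mem rfl (s.reg 1) 0 s7 (by omega) rfl
      (by rw [hs7]; grind) (by rw [hs7]; grind)
      (by
        intro r hr
        rw [hs7]
        unfold bindVar
        simp only [Function.update_apply, zero_mul]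
        grind)
    refine ⟨_, exec_cast (.seq (.move s (d + 1) x) (.seq (.move s1 (d + 2) (x + 1))
      (.seq (.move s2 (d + 3) 1) (.seq (.const s3 (d + 4) 1) (.seq (.const s4 d 0)
        (.seq (.const s5 x 0) (.seq (.const s6 (x + 1) 0) (.seq h8
          (.seq (.move s8 x (d + 1)) (.move _ (x + 1) (d + 2))))))))))) ?_, ?_, ?_, hm8⟩
    · simp only [Ex.cost, Nat.zero_add]
      omega
    · have n1 : d ≠ x := by omega
      have n2 : d ≠ x + 1 := by omega
      simp only [State.setReg, Function.update_apply, n1, n2, if_false, Ex.eval, hd8, Nat.zero_add]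
      rw [hs7]
      grind
    · intro r hr
      have n1 : d + 2 ≠ x := by omega
      simp only [State.setReg, Function.update_apply, n1, if_false, h18, h28, hs7]
      have := hl8 r hr
      grind

/-- A factor in a bound for the cost of an expression. -/
def Ex.size : Ex → ℕ
  | .lit _ => 1
  | .var _ => 1
  | .add a b => a.size + b.size + 1
  | .sub a b => a.size + b.size + 1
  | .half a => a.size + 1
  | .ld a => a.size + 1
  | .ite a b c => a.size + b.size + c.size + 1
  | .sum _ e => e.size + 10

/-- The depth to which sums are nested in an expression. -/
def Ex.depth : Ex → ℕ
  | .lit _ => 0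
  | .var _ => 0
  | .add a b => max a.depth b.depth
  | .sub a b => max a.depth b.depth
  | .half a => a.depth
  | .ld a => a.depth
  | .ite a b c => max a.depth (max b.depth c.depth)
  | .sum _ e => e.depth + 1

theorem bindVar_one {ρ : ℕ → ℕ} {x i N : ℕ} (hx : 2 ≤ x) : bindVar ρ x i N 1 = ρ 1 := by
  have h1 : 1 ≠ x := by omega
  have h2 : 1 ≠ x + 1 := by omega
  unfold bindVar
  rw [Function.update_of_ne h2, Function.update_of_ne h1]

/-- Only sums multiply the cost. An arbitrary exponent `q` above the depth lets subexpressions of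
different depths share one bound. -/
theorem Ex.cost_le {e : Ex} {d : ℕ} (he : e.Wf d) (m : ℕ → ℕ) : ∀ (ρ : ℕ → ℕ) (q : ℕ),
    e.depth ≤ q → e.cost ρ m ≤ e.size * (ρ 1 + 1) ^ q := by
  have one : ∀ (ρ : ℕ → ℕ) (q : ℕ), 1 ≤ (ρ 1 + 1) ^ q := fun ρ q => Nat.one_le_pow _ _ (by omega)
  induction e with
  | lit n => intro ρ q _; simpa [Ex.cost, Ex.size] using one ρ q
  | var r => intro ρ q _; simpa [Ex.cost, Ex.size] using one ρ q
  | add a b iha ihb =>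
    intro ρ q hq
    simp only [Ex.depth, max_le_iff] at hq
    have h1 := iha he.1 ρ q hq.1
    have h2 := ihb he.2 ρ q hq.2
    have := one ρ q
    simp only [Ex.cost, Ex.size]
    nlinarith
  | sub a b iha ihb =>
    intro ρ q hq
    simp only [Ex.depth, max_le_iff] at hq
    have h1 := iha he.1 ρ q hq.1
    have h2 := ihb he.2 ρ q hq.2
    have := one ρ q
    simp only [Ex.cost, Ex.size]
    nlinarith
  | half a ih =>
    intro ρ q hq
    have h1 := ih he ρ q hq
    have := one ρ q
    simp only [Ex.cost, Ex.size]
    nlinarith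
  | ld a ih =>
    intro ρ q hq
    have h1 := ih he ρ q hq
    have := one ρ q
    simp only [Ex.cost, Ex.size]
    nlinarith
  | ite a b c iha ihb ihc =>
    intro ρ q hq
    simp only [Ex.depth, max_le_iff] at hq
    have h1 := iha he.1 ρ q hq.1
    have h2 := ihb he.2.1 ρ q hq.2.1
    have h3 := ihc he.2.2 ρ q hq.2.2
    have := one ρ q
    simp only [Ex.cost, Ex.size, add_mul, one_mul]
    split_ifs <;> omega
  | sum x e ih =>
    intro ρ q hq
    obtain ⟨q, rfl⟩ : ∃ q', q = q' + 1 := ⟨q - 1, by simp only [Ex.depth] at hq; omega⟩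
    simp only [Ex.depth, Nat.add_le_add_iff_right] at hq
    simp only [Ex.cost, Ex.size]
    have h1 : ∑ i ∈ Finset.range (ρ 1), (e.cost (bindVar ρ x i (ρ 1)) m + 5) ≤
        ρ 1 * (e.size * (ρ 1 + 1) ^ q + 5) := by
      refine (Finset.sum_le_card_nsmul _ _ (e.size * (ρ 1 + 1) ^ q + 5) fun i _ => ?_).trans ?_
      · have := ih he.2.2 (bindVar ρ x i (ρ 1)) q hq
        rw [bindVar_one he.1] at this
        omega
      · simp
    have h2 := one ρ q
    rw [pow_succ]
    generalize (ρ 1 + 1) ^ q = A at *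
    nlinarith [Nat.zero_le (ρ 1 * A), Nat.zero_le (e.size * A),
      Nat.mul_le_mul_left (ρ 1) h2]

end Machine

end TreePlusK

namespace TreePlusK

/-! ### Statements, their compilation and their cost -/

section Statements

/-- Statements: a structured language on top of expressions. In `iter x p` the statement `p` is
executed for `x = 0, …, N - 1`, where `N` is the content of register `1`, and register `x + 1`
holds `x * N`. In `rep e p` the statement `p` is executed as many times as the value of `e` says. -/
inductive St where
  | skip
  | set (x : ℕ) (e : Ex)
  | put (a e : Ex)
  | seq (p q : St)
  | ite (e : Ex) (p q : St)
  | iter (x : ℕ) (p : St)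
  | rep (e : Ex) (p : St)

/-- Apply `f 0`, …, `f (n - 1)` in turn. -/
def applyUpTo (f : ℕ → State → State) : ℕ → State → State
  | 0, σ => σ
  | n + 1, σ => f n (applyUpTo f n σ)

/-- The state in which a loop body is started. -/
def State.enter (σ : State) (x i N : ℕ) : State := ⟨bindVar σ.reg x i N, σ.mem⟩

/-- Restore the loop registers. -/
def State.leave (σ : State) (x a b : ℕ) : State :=
  ⟨Function.update (Function.update σ.reg x a) (x + 1) b, σ.mem⟩

/-- The effect of a statement. -/
def St.run : St → State → State
  | .skip, σ => σ
  | .set x e, σ => σ.setReg x (e.eval σ.reg σ.mem)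
  | .put a e, σ => σ.setMem (a.eval σ.reg σ.mem) (e.eval σ.reg σ.mem)
  | .seq p q, σ => q.run (p.run σ)
  | .ite e p q, σ => if 0 < e.eval σ.reg σ.mem then p.run σ else q.run σ
  | .iter x p, σ =>
    (applyUpTo (fun i τ => p.run (τ.enter x i (σ.reg 1))) (σ.reg 1) σ).leave x
      (σ.reg x) (σ.reg (x + 1))
  | .rep e p, σ => applyUpTo (fun _ τ => p.run τ) (e.eval σ.reg σ.mem) σ

/-- The number of steps of a statement. -/
def St.cost : St → State → ℕ
  | .skip, _ => 1
  | .set _ e, σ => e.cost σ.reg σ.mem + 1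
  | .put a e, σ => a.cost σ.reg σ.mem + (e.cost σ.reg σ.mem + 1)
  | .seq p q, σ => p.cost σ + q.cost (p.run σ)
  | .ite e p q, σ =>
    e.cost σ.reg σ.mem + ((if 0 < e.eval σ.reg σ.mem then p.cost σ else q.cost σ) + 1)
  | .iter x p, σ =>
    ∑ i ∈ Finset.range (σ.reg 1), (p.cost ((applyUpTo (fun i τ => p.run (τ.enter x i (σ.reg 1)))
      i σ).enter x i (σ.reg 1)) + 6) + 10
  | .rep e p, σ =>
    e.cost σ.reg σ.mem + (∑ i ∈ Finset.range (e.eval σ.reg σ.mem),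
      (p.cost (applyUpTo (fun _ τ => p.run τ) i σ) + 2) + 2)

/-- The statement mentions registers below `d` only. -/
def St.Wf : St → ℕ → Prop
  | .skip, _ => True
  | .set x e, d => x < d ∧ e.Wf d
  | .put a e, d => a.Wf d ∧ e.Wf d
  | .seq p q, d => p.Wf d ∧ q.Wf d
  | .ite e p q, d => e.Wf d ∧ p.Wf d ∧ q.Wf d
  | .iter x p, d => 2 ≤ x ∧ x + 1 < d ∧ p.Wf d
  | .rep e p, d => e.Wf d ∧ p.Wf d

/-- The machine program of a statement; it uses auxiliary registers from `d` on. -/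
def St.compile : St → ℕ → Prog
  | .skip, d => .const d 0
  | .set x e, d => .seq (e.compile d) (.move x d)
  | .put a e, d => .seq (a.compile d) (.seq (e.compile (d + 1)) (.store d (d + 1)))
  | .seq p q, d => .seq (p.compile d) (q.compile d)
  | .ite e p q, d => .seq (e.compile d) (.ifPos d (p.compile d) (q.compile d))
  | .iter x p, d =>
    .seq (.move d x) (.seq (.move (d + 1) (x + 1)) (.seq (.move (d + 2) 1) (.seq (.move (d + 3) 1)
      (.seq (.const (d + 4) 1) (.seq (.const (d + 5) 0) (.seq (.const (d + 6) 0)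
        (.seq (.whilePos (d + 2)
          (.seq (.move x (d + 5)) (.seq (.move (x + 1) (d + 6)) (.seq (p.compile (d + 7))
            (.seq (.add (d + 5) (d + 5) (d + 4)) (.seq (.add (d + 6) (d + 6) (d + 3))
              (.sub (d + 2) (d + 2) (d + 4))))))))
          (.seq (.move x d) (.move (x + 1) (d + 1))))))))))
  | .rep e p, d =>
    .seq (e.compile d) (.seq (.const (d + 1) 1)
      (.whilePos d (.seq (p.compile (d + 2)) (.sub d d (d + 1)))))

/-- Two states agree on the memory and on the registers below `d`. -/
def Agree (d : ℕ) (s σ : State) : Prop := (∀ r < d, s.reg r = σ.reg r) ∧ s.mem = σ.mem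

/-- The compiled program simulates the statement. -/
def Simulates (p : St) (d : ℕ) : Prop :=
  ∀ (d' : ℕ), d ≤ d' → ∀ s σ : State, Agree d s σ →
    ∃ s', Exec (p.compile d') s (p.cost σ) s' ∧ Agree d s' (p.run σ) ∧
      ∀ r, d ≤ r → r < d' → s'.reg r = s.reg r

theorem Ex.compile_agree {e : Ex} {d d' : ℕ} (he : e.Wf d) (hd : d ≤ d') {s σ : State}
    (h : Agree d s σ) : ∃ s', Exec (e.compile d') s (e.cost σ.reg σ.mem) s' ∧
      s'.reg d' = e.eval σ.reg σ.mem ∧ (∀ r < d', s'.reg r = s.reg r) ∧ s'.mem = s.mem := by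
  obtain ⟨s', h1, h2, h3, h4⟩ := e.compile_spec d' s (he.mono hd)
  obtain ⟨c1, c2⟩ := Ex.congr he (m := s.mem) h.1
  rw [c2, h.2] at h1
  rw [c1, h.2] at h2
  exact ⟨s', h1, h2, h3, h4⟩

/-- Between rounds, program and statement need not agree on the loop registers, so the invariant
compares the states after both have been overwritten by `leave x 0 0`. The counters themselves are
kept above `d'`, out of reach of the body. -/
theorem iter_loop {p : St} {x d d' N : ℕ} (hxd : x + 1 < d) (hd : d ≤ d')
    (hp : Simulates p d) (σ : State) (j : ℕ) :
    ∀ (i : ℕ) (s : State), i + j = N →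
      Agree d (s.leave x 0 0)
        ((applyUpTo (fun i τ => p.run (τ.enter x i N)) i σ).leave x 0 0) →
      s.reg (d' + 2) = j → s.reg (d' + 3) = N → s.reg (d' + 4) = 1 →
      s.reg (d' + 5) = i → s.reg (d' + 6) = i * N →
      ∃ s', Exec (.whilePos (d' + 2)
          (.seq (.move x (d' + 5)) (.seq (.move (x + 1) (d' + 6)) (.seq (p.compile (d' + 7))
            (.seq (.add (d' + 5) (d' + 5) (d' + 4)) (.seq (.add (d' + 6) (d' + 6) (d' + 3))
              (.sub (d' + 2) (d' + 2) (d' + 4)))))))) s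
          (∑ i' ∈ Finset.range j, (p.cost ((applyUpTo (fun i τ => p.run (τ.enter x i N))
            (i + i') σ).enter x (i + i') N) + 6) + 1) s' ∧
        Agree d (s'.leave x 0 0)
          ((applyUpTo (fun i τ => p.run (τ.enter x i N)) N σ).leave x 0 0) ∧
        ∀ r, d ≤ r → r < d' + 2 → s'.reg r = s.reg r := by
  induction j with
  | zero =>
    intro i s hij hA h2 _ _ _ _
    obtain rfl : i = N := by omega
    exact ⟨s, exec_cast (.while_zero h2) (by simp), hA, fun _ _ _ => rfl⟩
  | succ j ih =>
    intro i s hij hA h2 h3 h4 h5 h6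
    let s1 := s.setReg x (s.reg (d' + 5))
    let s2 := s1.setReg (x + 1) (s1.reg (d' + 6))
    have e2 : ∀ r, s2.reg r = if r = x + 1 then i * N else if r = x then i else s.reg r := by
      intro r
      have n1 : d' + 6 ≠ x := by omega
      simp only [s2, s1, State.setReg, Function.update_apply, n1, if_false, h5, h6]
    have hA2 : Agree d s2 ((applyUpTo (fun i τ => p.run (τ.enter x i N)) i σ).enter x i N) := by
      refine ⟨fun r hr => ?_, hA.2⟩
      have := hA.1 r hr
      rw [e2]
      simp only [State.leave, State.enter, bindVar, Function.update_apply] at this ⊢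
      split_ifs with q1 q2
      · rfl
      · rfl
      · rw [if_neg q1, if_neg q2, if_neg q1, if_neg q2] at this
        exact this
    obtain ⟨s3, he3, hA3, hh3⟩ := hp (d' + 7) (by omega) _ _ hA2
    let s4 := s3.setReg (d' + 5) (s3.reg (d' + 5) + s3.reg (d' + 4))
    let s5 := s4.setReg (d' + 6) (s4.reg (d' + 6) + s4.reg (d' + 3))
    let s6 := s5.setReg (d' + 2) (s5.reg (d' + 2) - s5.reg (d' + 4))
    have hh : ∀ r, d ≤ r → r < d' + 7 → s3.reg r = s.reg r := by
      intro r h1 h2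
      rw [hh3 r h1 h2, e2, if_neg (by omega), if_neg (by omega)]
    have e6 : ∀ r, s6.reg r = if r = d' + 2 then j else if r = d' + 6 then (i + 1) * N
        else if r = d' + 5 then i + 1 else s3.reg r := by
      intro r
      have q2 := hh (d' + 2) (by omega) (by omega)
      have q3 := hh (d' + 3) (by omega) (by omega)
      have q4 := hh (d' + 4) (by omega) (by omega)
      have q5 := hh (d' + 5) (by omega) (by omega)
      have q6 := hh (d' + 6) (by omega) (by omega)
      simp only [s6, s5, s4, State.setReg, Function.update_apply]
      split_ifs <;> first | omega | rfl | rw [q6, h6, q3, h3, Nat.succ_mul]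
    obtain ⟨s', hs', hA', hh'⟩ := ih (i + 1) s6 (by omega)
      (by
        refine ⟨fun r hr => ?_, hA3.2⟩
        have := hA3.1 r hr
        simp only [State.leave, Function.update_apply, e6]
        split_ifs <;> first | omega | rfl | exact this)
      (by rw [e6]; simp)
      (by rw [e6, if_neg (by omega), if_neg (by omega), if_neg (by omega),
            hh _ (by omega) (by omega), h3])
      (by rw [e6, if_neg (by omega), if_neg (by omega), if_neg (by omega),
            hh _ (by omega) (by omega), h4])
      (by rw [e6, if_neg (by omega), if_neg (by omega), if_pos rfl])
      (by rw [e6, if_neg (by omega), if_pos rfl])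
    refine ⟨s', ?_, hA', ?_⟩
    · refine exec_cast (.while_pos (by omega) (.seq (.move s x (d' + 5))
        (.seq (.move s1 (x + 1) (d' + 6)) (.seq he3 (.seq (.add s3 (d' + 5) (d' + 5) (d' + 4))
          (.seq (.add s4 (d' + 6) (d' + 6) (d' + 3)) (.sub s5 (d' + 2) (d' + 2) (d' + 4)))))))
            hs') ?_
      rw [Finset.sum_range_succ' _ j]
      simp only [Nat.add_zero, Nat.add_right_comm i 1, Nat.add_assoc]
      omega
    · intro r h1 h2
      rw [hh' r h1 h2, e6, if_neg (by omega), if_neg (by omega), if_neg (by omega),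
        hh r h1 (by omega)]

theorem rep_loop {p : St} {d d' : ℕ} (hd : d ≤ d') (hp : Simulates p d) (σ : State) (j : ℕ) :
    ∀ (i : ℕ) (s : State),
      Agree d s (applyUpTo (fun _ τ => p.run τ) i σ) →
      s.reg d' = j → s.reg (d' + 1) = 1 →
      ∃ s', Exec (.whilePos d' (.seq (p.compile (d' + 2)) (.sub d' d' (d' + 1)))) s
          (∑ i' ∈ Finset.range j, (p.cost (applyUpTo (fun _ τ => p.run τ) (i + i') σ) + 2) + 1)
          s' ∧
        Agree d s' (applyUpTo (fun _ τ => p.run τ) (i + j) σ) ∧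
        ∀ r, d ≤ r → r < d' → s'.reg r = s.reg r := by
  induction j with
  | zero =>
    intro i s hA h1 _
    exact ⟨s, exec_cast (.while_zero h1) (by simp), hA, fun _ _ _ => rfl⟩
  | succ j ih =>
    intro i s hA h1 h2
    obtain ⟨s1, he1, hA1, hh1⟩ := hp (d' + 2) (by omega) _ _ hA
    let s2 := s1.setReg d' (s1.reg d' - s1.reg (d' + 1))
    have e2 : ∀ r, s2.reg r = if r = d' then j else s1.reg r := by
      intro r
      have q1 := hh1 d' (by omega) (by omega)
      have q2 := hh1 (d' + 1) (by omega) (by omega)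
      simp only [s2, State.setReg, Function.update_apply]
      split_ifs <;> omega
    obtain ⟨s', hs', hA', hh'⟩ := ih (i + 1) s2
      ⟨fun r hr => by rw [e2, if_neg (by omega)]; exact hA1.1 r hr, hA1.2⟩
      (by rw [e2, if_pos rfl])
      (by rw [e2, if_neg (by omega), hh1 _ (by omega) (by omega), h2])
    refine ⟨s', ?_, ?_, ?_⟩
    · refine exec_cast (.while_pos (by omega) (.seq he1 (.sub s1 d' d' (d' + 1))) hs') ?_
      rw [Finset.sum_range_succ' _ j]
      simp only [Nat.add_zero, Nat.add_right_comm i 1, Nat.add_assoc]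
      omega
    · rw [show i + (j + 1) = i + 1 + j by omega]
      exact hA'
    · intro r q1 q2
      rw [hh' r q1 q2, e2, if_neg (by omega), hh1 r q1 (by omega)]

/-- Besides the effect, the registers between `d` and `d'` have to be preserved, since enclosing
loops keep their counters there. -/
theorem St.simulates (p : St) {d : ℕ} (hp : p.Wf d) : Simulates p d := by
  induction p with
  | skip =>
    intro d' hd s σ h
    refine ⟨_, .const s d' 0, ⟨fun r hr => ?_, h.2⟩, fun r _ hr => ?_⟩
    · have : r ≠ d' := by omega
      simpa [State.setReg, Function.update_of_ne this, St.run] using h.1 r hr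
    · have : r ≠ d' := by omega
      simp [State.setReg, Function.update_of_ne this]
  | set x e =>
    intro d' hd s σ h
    obtain ⟨s1, h1, h2, h3, h4⟩ := Ex.compile_agree hp.2 hd h
    have hx := hp.1
    refine ⟨_, .seq h1 (.move s1 x d'), ⟨fun r hr => ?_, h4.trans h.2⟩, fun r h5 h6 => ?_⟩
    · simp only [State.setReg, St.run, Function.update_apply, h2]
      split_ifs
      · rfl
      · rw [h3 r (by omega), h.1 r hr]
    · have : r ≠ x := by omega
      simp [State.setReg, Function.update_of_ne this, h3 r h6]
  | put a e =>
    intro d' hd s σ h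
    obtain ⟨s1, h1, h2, h3, h4⟩ := Ex.compile_agree hp.1 hd h
    obtain ⟨s2, g1, g2, g3, g4⟩ := Ex.compile_agree (d' := d' + 1) hp.2 (by omega)
      (s := s1) (σ := σ) ⟨fun r hr => (h3 r (by omega)).trans (h.1 r hr), h4.trans h.2⟩
    refine ⟨_, .seq h1 (.seq g1 (.store s2 d' (d' + 1))), ⟨fun r hr => ?_, ?_⟩, fun r h5 h6 => ?_⟩
    · simp only [State.setMem, St.run]
      rw [g3 r (by omega), h3 r (by omega), h.1 r hr]
    · simp only [State.setMem, St.run, g2, g3 d' (by omega), h2, g4, h4, h.2]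
    · simp only [State.setMem]
      rw [g3 r (by omega), h3 r (by omega)]
  | seq p q ihp ihq =>
    intro d' hd s σ h
    obtain ⟨s1, h1, h2, h3⟩ := ihp hp.1 d' hd s σ h
    obtain ⟨s2, h4, h5, h6⟩ := ihq hp.2 d' hd s1 _ h2
    exact ⟨s2, .seq h1 h4, h5, fun r q1 q2 => (h6 r q1 q2).trans (h3 r q1 q2)⟩
  | ite e p q ihp ihq =>
    intro d' hd s σ h
    obtain ⟨s1, h1, h2, h3, h4⟩ := Ex.compile_agree hp.1 hd h
    have hA : Agree d s1 σ := ⟨fun r hr => (h3 r (by omega)).trans (h.1 r hr), h4.trans h.2⟩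
    by_cases hc : 0 < e.eval σ.reg σ.mem
    · obtain ⟨s2, g1, g2, g3⟩ := ihp hp.2.1 d' hd s1 σ hA
      refine ⟨s2, exec_cast (.seq h1 (.if_pos (by omega) g1)) ?_, ?_,
        fun r q1 q2 => (g3 r q1 q2).trans (h3 r q2)⟩
      · simp [St.cost, hc]
      · simpa [St.run, hc] using g2
    · obtain ⟨s2, g1, g2, g3⟩ := ihq hp.2.2 d' hd s1 σ hA
      refine ⟨s2, exec_cast (.seq h1 (.if_zero (by omega) g1)) ?_, ?_,
        fun r q1 q2 => (g3 r q1 q2).trans (h3 r q2)⟩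
      · simp [St.cost, hc]
      · simpa [St.run, hc] using g2
  | iter x p ih =>
    intro d' hd s σ h
    obtain ⟨hx, hxd, hpw⟩ := hp
    let s1 := s.setReg d' (s.reg x)
    let s2 := s1.setReg (d' + 1) (s1.reg (x + 1))
    let s3 := s2.setReg (d' + 2) (s2.reg 1)
    let s4 := s3.setReg (d' + 3) (s3.reg 1)
    let s5 := s4.setReg (d' + 4) 1
    let s6 := s5.setReg (d' + 5) 0
    let s7 := s6.setReg (d' + 6) 0
    have e7 : ∀ r, s7.reg r = if r = d' + 6 then 0 else if r = d' + 5 then 0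
        else if r = d' + 4 then 1 else if r = d' + 3 then σ.reg 1 else if r = d' + 2 then σ.reg 1
        else if r = d' + 1 then σ.reg (x + 1) else if r = d' then σ.reg x else s.reg r := by
      intro r
      have n1 : x + 1 ≠ d' := by omega
      have n2 : 1 ≠ d' + 1 := by omega
      have n3 : 1 ≠ d' := by omega
      have n4 : 1 ≠ d' + 2 := by omega
      simp only [s7, s6, s5, s4, s3, s2, s1, State.setReg, Function.update_apply, n1, n2, n3, n4,
        if_false, h.1 1 (by omega), h.1 x (by omega), h.1 (x + 1) hxd]
    obtain ⟨s8, g1, g2, g3⟩ := iter_loop (N := σ.reg 1) hxd hd (ih hpw) σ (σ.reg 1) 0 s7 (by omega)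
      ⟨fun r hr => by
        simp only [applyUpTo, State.leave, Function.update_apply, e7]
        split_ifs <;> first | omega | rfl | exact h.1 r hr, h.2⟩
      (by rw [e7]; simp) (by rw [e7]; simp) (by rw [e7]; simp) (by rw [e7]; simp)
      (by rw [e7]; simp)
    have k1 : s8.reg d' = σ.reg x := by
      rw [g3 d' hd (by omega), e7]
      simp
    have k2 : s8.reg (d' + 1) = σ.reg (x + 1) := by
      rw [g3 (d' + 1) (by omega) (by omega), e7]
      simp
    have n1 : d' + 1 ≠ x := by omega
    refine ⟨_, exec_cast (.seq (.move s d' x) (.seq (.move s1 (d' + 1) (x + 1))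
      (.seq (.move s2 (d' + 2) 1) (.seq (.move s3 (d' + 3) 1) (.seq (.const s4 (d' + 4) 1)
        (.seq (.const s5 (d' + 5) 0) (.seq (.const s6 (d' + 6) 0) (.seq g1
          (.seq (.move s8 x d') (.move _ (x + 1) (d' + 1))))))))))) ?_, ⟨fun r hr => ?_, g2.2⟩,
        fun r h5 h6 => ?_⟩
    · simp only [St.cost, Nat.zero_add]
      omega
    · have := g2.1 r hr
      simp only [State.setReg, St.run, State.leave, Function.update_apply, n1, if_false, k1, k2]
        at this ⊢
      split_ifs with q1 q2
      · rfl
      · rfl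
      · rw [if_neg q1, if_neg q2, if_neg q1, if_neg q2] at this
        exact this
    · have m1 : r ≠ x := by omega
      have m2 : r ≠ x + 1 := by omega
      simp only [State.setReg, Function.update_apply, m1, m2, if_false]
      rw [g3 r h5 (by omega), e7]
      repeat rw [if_neg (by omega)]
  | rep e p ih =>
    intro d' hd s σ h
    obtain ⟨s1, h1, h2, h3, h4⟩ := Ex.compile_agree hp.1 hd h
    let s2 := s1.setReg (d' + 1) 1
    have e2 : ∀ r, s2.reg r = if r = d' + 1 then 1 else s1.reg r := by
      intro r
      simp only [s2, State.setReg, Function.update_apply]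
    obtain ⟨s3, g1, g2, g3⟩ := rep_loop hd (ih hp.2) σ (e.eval σ.reg σ.mem) 0 s2
      ⟨fun r hr => by rw [e2, if_neg (by omega), h3 r (by omega), h.1 r hr]; rfl, h4.trans h.2⟩
      (by rw [e2, if_neg (by omega), h2]) (by rw [e2, if_pos rfl])
    refine ⟨s3, exec_cast (.seq h1 (.seq (.const s1 (d' + 1) 1) g1)) ?_, ?_, fun r q1 q2 => ?_⟩
    · simp only [St.cost, Nat.zero_add]
      omega
    · simpa [St.run] using g2
    · rw [g3 r q1 q2, e2, if_neg (by omega), h3 r q2]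

theorem St.exec (p : St) {d : ℕ} (hp : p.Wf d) (σ : State) :
    ∃ s', Exec (p.compile d) σ (p.cost σ) s' ∧ Agree d s' (p.run σ) := by
  obtain ⟨s', h1, h2, _⟩ := p.simulates hp d le_rfl σ σ ⟨fun _ _ => rfl, rfl⟩
  exact ⟨s', h1, h2⟩

/-- The expression has the form `N - a`, where `N` is the content of register `1`. -/
def Ex.IsDiff : Ex → Prop
  | .sub (.var 1) _ => True
  | _ => False

theorem Ex.IsDiff.eval_le {e : Ex} (h : e.IsDiff) (ρ m : ℕ → ℕ) : e.eval ρ m ≤ ρ 1 := by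
  unfold Ex.IsDiff at h
  split at h
  · exact Nat.sub_le _ _
  · exact h.elim

/-- The statement does not increase register `1` and contains no `rep`. -/
def St.Simple : St → Prop
  | .skip => True
  | .set x e => (x ≠ 1 ∨ e.IsDiff) ∧ ∃ d, e.Wf d
  | .put a e => ∃ d, a.Wf d ∧ e.Wf d
  | .seq p q => p.Simple ∧ q.Simple
  | .ite e p q => (∃ d, e.Wf d) ∧ p.Simple ∧ q.Simple
  | .iter x p => 2 ≤ x ∧ p.Simple
  | .rep _ _ => False

/-- A factor in a bound for the cost of a statement. -/
def St.size : St → ℕ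
  | .skip => 1
  | .set _ e => e.size + 1
  | .put a e => a.size + e.size + 1
  | .seq p q => p.size + q.size
  | .ite e p q => e.size + p.size + q.size + 1
  | .iter _ p => p.size + 10
  | .rep _ _ => 0

/-- The depth to which loops and sums are nested. -/
def St.depth : St → ℕ
  | .skip => 0
  | .set _ e => e.depth
  | .put a e => max a.depth e.depth
  | .seq p q => max p.depth q.depth
  | .ite e p q => max e.depth (max p.depth q.depth)
  | .iter _ p => p.depth + 1
  | .rep _ _ => 0

theorem applyUpTo_induction {f : ℕ → State → State} {P : ℕ → State → Prop} {σ : State}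
    (h0 : P 0 σ) {n : ℕ} (hs : ∀ i < n, ∀ τ, P i τ → P (i + 1) (f i τ)) :
    P n (applyUpTo f n σ) := by
  induction n with
  | zero => exact h0
  | succ n ih => exact hs n (by omega) _ (ih fun i hi => hs i (by omega))

/-- Loops run up to the current content of register `1`, so its initial value bounds every loop.
Assignments of the form `N - a` respect this. -/
theorem St.Simple.reg_one {p : St} (hp : p.Simple) (σ : State) :
    (p.run σ).reg 1 ≤ σ.reg 1 := by
  induction p generalizing σ with
  | skip => exact le_rfl
  | set x e =>
    rcases hp.1 with h | h
    · simp [St.run, State.setReg, Function.update_of_ne h.symm]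
    · simp only [St.run, State.setReg, Function.update_apply]
      split_ifs
      · exact h.eval_le _ _
      · exact le_rfl
  | put a e => exact le_rfl
  | seq p q ihp ihq => exact (ihq hp.2 _).trans (ihp hp.1 _)
  | ite e p q ihp ihq =>
    simp only [St.run]
    split_ifs
    · exact ihp hp.2.1 σ
    · exact ihq hp.2.2 σ
  | iter x p ih =>
    obtain ⟨hx, hp⟩ := hp
    have n1 : 1 ≠ x := by omega
    have n2 : 1 ≠ x + 1 := by omega
    simp only [St.run, State.leave, Function.update_of_ne n1, Function.update_of_ne n2]
    refine applyUpTo_induction (P := fun _ τ => τ.reg 1 ≤ σ.reg 1) le_rfl fun i _ τ hτ => ?_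
    exact (ih hp _).trans ((bindVar_one hx).le.trans hτ)
  | rep e p => exact hp.elim

theorem St.Simple.cost_le {p : St} (hp : p.Simple) : ∀ (σ : State) (q : ℕ), p.depth ≤ q →
    p.cost σ ≤ p.size * (σ.reg 1 + 1) ^ q := by
  have one : ∀ (σ : State) (q : ℕ), 1 ≤ (σ.reg 1 + 1) ^ q :=
    fun σ q => Nat.one_le_pow _ _ (by omega)
  induction p with
  | skip => intro σ q _; simpa [St.cost, St.size] using one σ q
  | set x e =>
    intro σ q hq
    obtain ⟨d, hd⟩ := hp.2
    have h1 := Ex.cost_le hd σ.mem σ.reg q hq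
    have := one σ q
    simp only [St.cost, St.size, add_mul, one_mul]
    omega
  | put a e =>
    intro σ q hq
    obtain ⟨d, ha, he⟩ := hp
    simp only [St.depth, max_le_iff] at hq
    have h1 := Ex.cost_le ha σ.mem σ.reg q hq.1
    have h2 := Ex.cost_le he σ.mem σ.reg q hq.2
    have := one σ q
    simp only [St.cost, St.size, add_mul, one_mul]
    omega
  | seq p r ihp ihr =>
    intro σ q hq
    simp only [St.depth, max_le_iff] at hq
    have h1 := ihp hp.1 σ q hq.1
    have h2 := ihr hp.2 (p.run σ) q hq.2
    have h3 := Nat.mul_le_mul_left r.size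
      (Nat.pow_le_pow_left (Nat.add_le_add_right (hp.1.reg_one σ) 1) q)
    simp only [St.cost, St.size, add_mul]
    omega
  | ite e p r ihp ihr =>
    intro σ q hq
    simp only [St.depth, max_le_iff] at hq
    obtain ⟨⟨d, he⟩, hp1, hp2⟩ := hp
    have h0 := Ex.cost_le he σ.mem σ.reg q hq.1
    have h1 := ihp hp1 σ q hq.2.1
    have h2 := ihr hp2 σ q hq.2.2
    have := one σ q
    simp only [St.cost, St.size, add_mul, one_mul]
    split_ifs <;> omega
  | iter x p ih =>
    intro σ q hq
    obtain ⟨hx, hp⟩ := hp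
    obtain ⟨q, rfl⟩ : ∃ q', q = q' + 1 := ⟨q - 1, by simp only [St.depth] at hq; omega⟩
    simp only [St.depth, Nat.add_le_add_iff_right] at hq
    simp only [St.cost, St.size]
    set f : ℕ → State → State := fun i τ => p.run (τ.enter x i (σ.reg 1)) with hf
    have hreg : ∀ i, (applyUpTo f i σ).reg 1 ≤ σ.reg 1 := by
      intro i
      refine applyUpTo_induction (P := fun _ τ => τ.reg 1 ≤ σ.reg 1) le_rfl fun i _ τ hτ => ?_
      exact (hp.reg_one _).trans ((bindVar_one hx).le.trans hτ)
    have h1 : ∑ i ∈ Finset.range (σ.reg 1),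
        (p.cost ((applyUpTo f i σ).enter x i (σ.reg 1)) + 6) ≤
        σ.reg 1 * (p.size * (σ.reg 1 + 1) ^ q + 6) := by
      refine (Finset.sum_le_card_nsmul _ _ (p.size * (σ.reg 1 + 1) ^ q + 6) fun i _ => ?_).trans ?_
      · have := ih hp ((applyUpTo f i σ).enter x i (σ.reg 1)) q hq
        rw [State.enter] at this
        simp only [bindVar_one hx] at this
        exact Nat.add_le_add_right (this.trans (Nat.mul_le_mul_left _
          (Nat.pow_le_pow_left (Nat.add_le_add_right (hreg i) 1) q))) 6
      · simp
    have h2 := one σ q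
    rw [pow_succ]
    generalize (σ.reg 1 + 1) ^ q = A at *
    nlinarith [Nat.zero_le (σ.reg 1 * A), Nat.zero_le (p.size * A),
      Nat.mul_le_mul_left (σ.reg 1) h2]
  | rep e p => exact hp.elim

/-- The statement does not increase register `1` and contains no `rep`. -/
def St.Plain : St → Prop
  | .skip => True
  | .set x e => x ≠ 1 ∨ e.IsDiff
  | .put _ _ => True
  | .seq p q => p.Plain ∧ q.Plain
  | .ite _ p q => p.Plain ∧ q.Plain
  | .iter _ p => p.Plain
  | .rep _ _ => False

/-- For concrete programs `Plain` and `Wf` are evaluated by `decide`; `Simple` hides the register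
bound and suits the induction on cost. -/
theorem St.Plain.simple {p : St} (hp : p.Plain) {d : ℕ} (hd : p.Wf d) : p.Simple := by
  induction p with
  | skip => trivial
  | set x e => exact ⟨hp, d, hd.2⟩
  | put a e => exact ⟨d, hd⟩
  | seq p q ihp ihq => exact ⟨ihp hp.1 hd.1, ihq hp.2 hd.2⟩
  | ite e p q ihp ihq => exact ⟨⟨d, hd.1⟩, ihp hp.1 hd.2.1, ihq hp.2 hd.2.2⟩
  | iter x p ih => exact ⟨hd.1, ih hp hd.2.2⟩
  | rep e p => exact hp.elim

instance Ex.decidableWf : ∀ (e : Ex) (d : ℕ), Decidable (e.Wf d)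
  | .lit _, _ => .isTrue trivial
  | .var r, d => inferInstanceAs (Decidable (r < d))
  | .add a b, d => @instDecidableAnd _ _ (a.decidableWf d) (b.decidableWf d)
  | .sub a b, d => @instDecidableAnd _ _ (a.decidableWf d) (b.decidableWf d)
  | .half a, d => a.decidableWf d
  | .ld a, d => a.decidableWf d
  | .ite a b b', d => @instDecidableAnd _ _ (a.decidableWf d)
    (@instDecidableAnd _ _ (b.decidableWf d) (b'.decidableWf d))
  | .sum x e, d => @instDecidableAnd _ _ (inferInstanceAs (Decidable (2 ≤ x)))
    (@instDecidableAnd _ _ (inferInstanceAs (Decidable (x + 1 < d))) (e.decidableWf d))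

instance Ex.decidableIsDiff (e : Ex) : Decidable e.IsDiff := by
  unfold Ex.IsDiff
  split <;> infer_instance

instance St.decidableWf : ∀ (p : St) (d : ℕ), Decidable (p.Wf d)
  | .skip, _ => .isTrue trivial
  | .set x e, d => @instDecidableAnd _ _ (inferInstanceAs (Decidable (x < d))) (e.decidableWf d)
  | .put a e, d => @instDecidableAnd _ _ (a.decidableWf d) (e.decidableWf d)
  | .seq p q, d => @instDecidableAnd _ _ (p.decidableWf d) (q.decidableWf d)
  | .ite e p q, d => @instDecidableAnd _ _ (e.decidableWf d)
    (@instDecidableAnd _ _ (p.decidableWf d) (q.decidableWf d))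
  | .iter x p, d => @instDecidableAnd _ _ (inferInstanceAs (Decidable (2 ≤ x)))
    (@instDecidableAnd _ _ (inferInstanceAs (Decidable (x + 1 < d))) (p.decidableWf d))
  | .rep e p, d => @instDecidableAnd _ _ (e.decidableWf d) (p.decidableWf d)

instance St.decidablePlain : ∀ p : St, Decidable p.Plain
  | .skip => .isTrue trivial
  | .set x e => inferInstanceAs (Decidable (x ≠ 1 ∨ e.IsDiff))
  | .put _ _ => .isTrue trivial
  | .seq p q => @instDecidableAnd _ _ p.decidablePlain q.decidablePlain
  | .ite _ p q => @instDecidableAnd _ _ p.decidablePlain q.decidablePlain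
  | .iter _ p => p.decidablePlain
  | .rep _ _ => .isFalse id

/-- A bound for the cost of a plain statement. -/
theorem St.Plain.cost_le {p : St} (hp : p.Plain) {d : ℕ} (hd : p.Wf d) {q : ℕ} (hq : p.depth ≤ q)
    (σ : State) : p.cost σ ≤ p.size * (σ.reg 1 + 1) ^ q :=
  (hp.simple hd).cost_le σ q hq

end Statements

end TreePlusK

namespace TreePlusK
open scoped Classical

/-! ### Expressions as first-order formulas -/

section Formulas

/-- The value is positive: expressions as formulas. -/
def Ex.T (e : Ex) (ρ m : ℕ → ℕ) : Prop := 0 < e.eval ρ m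

def Ex.bool (e : Ex) : Ex := .ite e (.lit 1) (.lit 0)
def Ex.and (a b : Ex) : Ex := .ite a b (.lit 0)
def Ex.or (a b : Ex) : Ex := .ite a (.lit 1) b
def Ex.not (a : Ex) : Ex := .ite a (.lit 0) (.lit 1)
def Ex.imp (a b : Ex) : Ex := .ite a b (.lit 1)
def Ex.iff (a b : Ex) : Ex := .ite a b b.not
def Ex.lt (a b : Ex) : Ex := .sub b a
-- Of the two cut-off differences both vanish only for equal numbers.
def Ex.eq (a b : Ex) : Ex := .not (.add (.sub a b) (.sub b a))
-- A quantifier is a loop of length `N`, so the quantifier depth becomes the exponent of the running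
-- time.
def Ex.ex (x : ℕ) (e : Ex) : Ex := .sum x e.bool
def Ex.all (x : ℕ) (e : Ex) : Ex := .not (.ex x e.not)

/-- The registers `x` and `y` contain the same number. -/
def Ex.same (x y : ℕ) : Ex := .eq (.var x) (.var y)

/-- The entry in row `x` and column `y` of table `t`. -/
def Ex.tab (t x y : ℕ) : Ex := .ld (.add (.var (10 + t)) (.add (.var (x + 1)) (.var y)))

/-- The entry in column `x` of the first row of table `t`. -/
def Ex.row (t x : ℕ) : Ex := .ld (.add (.var (10 + t)) (.var x))

variable {ρ m : ℕ → ℕ} {a b e : Ex} {n x : ℕ}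

theorem Ex.eval_lit : (Ex.lit n).eval ρ m = n := rfl

theorem Ex.eval_var : (Ex.var x).eval ρ m = ρ x := rfl

theorem Ex.eval_add : (Ex.add a b).eval ρ m = a.eval ρ m + b.eval ρ m := rfl

theorem Ex.eval_ld : (Ex.ld a).eval ρ m = m (a.eval ρ m) := rfl

theorem Ex.eval_bool : e.bool.eval ρ m = if e.T ρ m then 1 else 0 := by
  by_cases h : 0 < e.eval ρ m <;> simp [Ex.bool, Ex.eval, Ex.T, h]

theorem Ex.eval_ite : (Ex.ite e a b).eval ρ m = if e.T ρ m then a.eval ρ m else b.eval ρ m := by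
  by_cases h : 0 < e.eval ρ m <;> simp [Ex.eval, Ex.T, h]

theorem Ex.eval_sum (h : ρ 1 = n) :
    (Ex.sum x e).eval ρ m = ∑ i : Fin n, e.eval (bindVar ρ x i n) m := by
  subst h
  rw [Ex.eval, Finset.sum_range]

theorem Ex.T_and : (a.and b).T ρ m ↔ a.T ρ m ∧ b.T ρ m := by
  unfold Ex.T Ex.and
  simp only [Ex.eval]
  split_ifs with h <;> simp [h]

theorem Ex.T_or : (a.or b).T ρ m ↔ a.T ρ m ∨ b.T ρ m := by
  unfold Ex.T Ex.or
  simp only [Ex.eval]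
  split_ifs with h <;> simp [h]

theorem Ex.T_not : a.not.T ρ m ↔ ¬ a.T ρ m := by
  unfold Ex.T Ex.not
  simp only [Ex.eval]
  split_ifs with h <;> simp [h]

theorem Ex.T_imp : (a.imp b).T ρ m ↔ (a.T ρ m → b.T ρ m) := by
  unfold Ex.T Ex.imp
  simp only [Ex.eval]
  split_ifs with h <;> simp [h]

theorem Ex.T_iff : (a.iff b).T ρ m ↔ (a.T ρ m ↔ b.T ρ m) := by
  have : (a.iff b).T ρ m ↔ if a.T ρ m then b.T ρ m else b.not.T ρ m := by
    unfold Ex.iff Ex.T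
    simp only [Ex.eval]
    split_ifs <;> rfl
  rw [this, Ex.T_not]
  split_ifs with h <;> simp [h]

theorem Ex.T_lt : (a.lt b).T ρ m ↔ a.eval ρ m < b.eval ρ m := by
  unfold Ex.T Ex.lt
  simp only [Ex.eval]
  omega

theorem Ex.T_eq : (a.eq b).T ρ m ↔ a.eval ρ m = b.eval ρ m := by
  unfold Ex.eq
  rw [Ex.T_not]
  unfold Ex.T
  simp only [Ex.eval]
  omega

theorem Ex.T_same {y : ℕ} : (Ex.same x y).T ρ m ↔ ρ x = ρ y := Ex.T_eq

theorem Ex.T_bool : e.bool.T ρ m ↔ e.T ρ m := by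
  unfold Ex.T Ex.bool
  simp only [Ex.eval]
  split_ifs with h <;> simp [h]

theorem Ex.T_ex (h : ρ 1 = n) : (Ex.ex x e).T ρ m ↔ ∃ i : Fin n, e.T (bindVar ρ x i n) m := by
  unfold Ex.ex
  rw [Ex.T, Ex.eval_sum h, Finset.sum_pos_iff]
  simp only [Finset.mem_univ, true_and]
  exact exists_congr fun i => Ex.T_bool

theorem Ex.T_all (h : ρ 1 = n) : (Ex.all x e).T ρ m ↔ ∀ i : Fin n, e.T (bindVar ρ x i n) m := by
  unfold Ex.all
  rw [Ex.T_not, Ex.T_ex h]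
  simp only [Ex.T_not, not_exists, not_not]

theorem Ex.T_tab {t y : ℕ} :
    (Ex.tab t x y).T ρ m ↔ 0 < m (ρ (10 + t) + (ρ (x + 1) + ρ y)) := Iff.rfl

theorem Ex.eval_tab {t y : ℕ} :
    (Ex.tab t x y).eval ρ m = m (ρ (10 + t) + (ρ (x + 1) + ρ y)) := rfl

theorem Ex.T_row {t : ℕ} : (Ex.row t x).T ρ m ↔ 0 < m (ρ (10 + t) + ρ x) := Iff.rfl

theorem bindVar_apply {i N r : ℕ} :
    bindVar ρ x i N r = if r = x + 1 then i * N else if r = x then i else ρ r := by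
  simp only [bindVar, Function.update_apply]

theorem bindVar_eq {ρ' : ℕ → ℕ} {i N : ℕ} (h : ∀ r, r ≠ x → r ≠ x + 1 → ρ r = ρ' r) :
    bindVar ρ x i N = bindVar ρ' x i N := by
  funext r
  simp only [bindVar_apply]
  split_ifs with h1 h2
  · rfl
  · rfl
  · exact h r h2 h1

end Formulas

/-! ### Tables in memory -/

section Fill

/-- Fill the square table whose address is in register `r`; the expression may use the registers
`30` and `32` for the row and the column. -/
def St.fillAt (r : ℕ) (e : Ex) : St :=
  .iter 30 (.iter 32 (.put (.add (.var r) (.add (.var 31) (.var 32))) e))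

theorem St.run_iter {x N : ℕ} {p : St} {σ : State} (hN : σ.reg 1 = N) (P : ℕ → State → Prop)
    (h0 : P 0 σ) (hs : ∀ i < N, ∀ τ, P i τ → P (i + 1) (p.run (τ.enter x i N))) :
    ∃ τ, P N τ ∧ (St.iter x p).run σ = τ.leave x (σ.reg x) (σ.reg (x + 1)) := by
  subst hN
  exact ⟨_, applyUpTo_induction h0 hs, rfl⟩

theorem leave_reg {σ τ : State} {x : ℕ} (h : ∀ r, r ≠ x → r ≠ x + 1 → τ.reg r = σ.reg r) :
    (τ.leave x (σ.reg x) (σ.reg (x + 1))).reg = σ.reg := by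
  funext r
  simp only [State.leave, Function.update_apply]
  split_ifs with h1 h2
  · rw [h1]
  · rw [h2]
  · exact h r h2 h1

theorem leave_mem {τ : State} {x a b : ℕ} : (τ.leave x a b).mem = τ.mem := rfl

theorem cell_lt {n i j : ℕ} (hi : i < n) (hj : j < n) : i * n + j < n * n := by
  nlinarith

theorem cell_inj {n i j i' j' : ℕ} (hj : j < n) (hj' : j' < n) (h : i * n + j = i' * n + j') :
    i = i' ∧ j = j' := by
  have h1 : i = i' := by
    rcases lt_trichotomy i i' with h2 | h2 | h2
    · nlinarith
    · exact h2
    · nlinarith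
  subst h1
  exact ⟨rfl, by omega⟩

/-- Entries are computed while the table is half written, so `he` asks for the value of `e` in every
memory that agrees with the initial one outside the table. -/
theorem St.run_fillAt {σ : State} {n r c : ℕ} {e : Ex} {f : Fin n → Fin n → ℕ} (hn : σ.reg 1 = n)
    (hc : σ.reg r = c) (hr : r < 30)
    (he : ∀ m, (∀ a, a < c ∨ c + n * n ≤ a → m a = σ.mem a) → ∀ i j : Fin n,
      e.eval (bindVar (bindVar σ.reg 30 i n) 32 j n) m = f i j) :
    ((St.fillAt r e).run σ).reg = σ.reg ∧
      (∀ a, a < c ∨ c + n * n ≤ a → ((St.fillAt r e).run σ).mem a = σ.mem a) ∧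
      ∀ i j : Fin n, ((St.fillAt r e).run σ).mem (c + (i * n + j)) = f i j := by
  obtain ⟨τ, ⟨h1, h2, h3⟩, h4⟩ := St.run_iter
    (p := .iter 32 (.put (.add (.var r) (.add (.var 31) (.var 32))) e)) (x := 30) hn
    (fun i τ => (∀ r, r ≠ 30 → r ≠ 31 → τ.reg r = σ.reg r) ∧
      (∀ a, a < c ∨ c + n * n ≤ a → τ.mem a = σ.mem a) ∧
      ∀ i' j' : Fin n, i'.val < i → τ.mem (c + (i' * n + j')) = f i' j')
    ⟨fun _ _ _ => rfl, fun _ _ => rfl, fun _ _ h => absurd h (Nat.not_lt_zero _)⟩ (by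
      rintro i hi τ ⟨h1, h2, h3⟩
      have hreg : (τ.enter 30 i n).reg = bindVar σ.reg 30 i n := bindVar_eq h1
      obtain ⟨υ, ⟨g1, g2, g3, g4⟩, g5⟩ := St.run_iter
        (p := .put (.add (.var r) (.add (.var 31) (.var 32))) e) (x := 32) (σ := τ.enter 30 i n)
        (N := n) (by rw [hreg, bindVar_one (by omega), hn])
        (fun j υ => (∀ r, r ≠ 32 → r ≠ 33 → υ.reg r = (τ.enter 30 i n).reg r) ∧
          (∀ a, a < c ∨ c + n * n ≤ a → υ.mem a = σ.mem a) ∧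
          (∀ i' j' : Fin n, i'.val < i → υ.mem (c + (i' * n + j')) = f i' j') ∧
          ∀ i' j' : Fin n, i'.val = i → j'.val < j → υ.mem (c + (i' * n + j')) = f i' j')
        ⟨fun _ _ _ => rfl, h2, h3, fun _ _ _ h => absurd h (Nat.not_lt_zero _)⟩ (by
          rintro j hj υ ⟨g1, g2, g3, g4⟩
          have hreg2 : (υ.enter 32 j n).reg = bindVar (bindVar σ.reg 30 i n) 32 j n := by
            rw [← hreg]; exact bindVar_eq g1
          have hmem : ((St.put (.add (.var r) (.add (.var 31) (.var 32))) e).run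
              (υ.enter 32 j n)).mem = Function.update υ.mem (c + (i * n + j)) (f ⟨i, hi⟩ ⟨j, hj⟩) := by
            simp only [St.run, State.setMem, hreg2, Ex.eval]
            rw [← he υ.mem g2 ⟨i, hi⟩ ⟨j, hj⟩]
            have n1 : r ≠ 30 := by omega
            have n2 : r ≠ 31 := by omega
            have n3 : r ≠ 32 := by omega
            have n4 : r ≠ 33 := by omega
            simp [bindVar_apply, n1, n2, n3, n4, hc, State.enter]
          refine ⟨?_, ?_, ?_, ?_⟩
          · intro r h1 h2
            simp only [St.run, State.setMem]
            rw [State.enter]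
            simp only [bindVar_apply]
            rw [if_neg h2, if_neg h1, g1 r h1 h2]
          · intro a ha
            have := cell_lt hi hj
            rw [hmem, Function.update_of_ne (by omega), g2 a ha]
          · intro i' j' h
            rw [hmem, Function.update_of_ne, g3 i' j' h]
            intro heq
            have := (cell_inj j'.2 hj (Nat.add_left_cancel heq)).1
            omega
          · intro i' j' h1 h2
            rw [hmem]
            rcases Nat.lt_succ_iff_lt_or_eq.1 h2 with h | h
            · rw [Function.update_of_ne, g4 i' j' h1 h]
              intro heq
              have := (cell_inj j'.2 hj (Nat.add_left_cancel heq)).2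
              omega
            · rw [h1, h, Function.update_self]
              congr 1
              · exact Fin.ext h1.symm
              · exact Fin.ext h.symm)
      rw [g5]
      have hreg3 := leave_reg g1
      refine ⟨?_, g2, ?_⟩
      · intro r h1' h2'
        rw [hreg3, hreg]
        simp only [bindVar_apply]
        rw [if_neg h2', if_neg h1']
      · intro i' j' h
        rw [leave_mem]
        rcases Nat.lt_succ_iff_lt_or_eq.1 h with h | h
        · exact g3 i' j' h
        · exact g4 i' j' h j'.2)
  unfold St.fillAt
  rw [h4]
  exact ⟨leave_reg h1, h2, fun i j => h3 i j i.2⟩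

/-- The registers of a machine that works with tables of order `n`. -/
structure Layout (n : ℕ) (ρ : ℕ → ℕ) : Prop where
  order : ρ 1 = n
  base : ∀ t < 20, ρ (10 + t) = 2 + t * (n * n)

/-- Table `t` contains `f`. -/
def Tab (n : ℕ) (m : ℕ → ℕ) (t : ℕ) (f : Fin n → Fin n → ℕ) : Prop :=
  ∀ i j : Fin n, m (2 + t * (n * n) + (i * n + j)) = f i j

theorem Tab.row {n t : ℕ} {m : ℕ → ℕ} {g : Fin n → ℕ} (h : Tab n m t fun _ j => g j) (j : Fin n) :
    m (2 + t * (n * n) + j) = g j := by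
  have := h ⟨0, j.pos⟩ j
  simpa using this

theorem Tab.of_eq {n t : ℕ} {m m' : ℕ → ℕ} {f : Fin n → Fin n → ℕ} (h : Tab n m t f)
    (heq : ∀ a, 2 + t * (n * n) ≤ a → a < 2 + (t + 1) * (n * n) → m' a = m a) : Tab n m' t f := by
  intro i j
  have := cell_lt i.2 j.2
  rw [heq _ (by omega) (by rw [Nat.succ_mul]; omega)]
  exact h i j

theorem St.run_fill {σ : State} {n t : ℕ} {e : Ex} {f : Fin n → Fin n → ℕ} (hσ : Layout n σ.reg)
    (ht : t < 20)
    (he : ∀ m, (∀ t', t' ≠ t → ∀ g, Tab n σ.mem t' g → Tab n m t' g) → ∀ i j : Fin n,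
      e.eval (bindVar (bindVar σ.reg 30 i n) 32 j n) m = f i j) :
    ((St.fillAt (10 + t) e).run σ).reg = σ.reg ∧
      Tab n ((St.fillAt (10 + t) e).run σ).mem t f ∧
      ∀ t', t' ≠ t → ∀ g, Tab n σ.mem t' g → Tab n ((St.fillAt (10 + t) e).run σ).mem t' g := by
  have key : ∀ m : ℕ → ℕ, (∀ a, a < 2 + t * (n * n) ∨ 2 + t * (n * n) + n * n ≤ a →
      m a = σ.mem a) → ∀ t', t' ≠ t → ∀ g, Tab n σ.mem t' g → Tab n m t' g := by
    intro m hm t' ht' g hg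
    refine hg.of_eq fun a h1 h2 => hm a ?_
    rcases lt_or_gt_of_ne ht' with h | h
    · left
      have := Nat.mul_le_mul_right (n * n) (show t' + 1 ≤ t from h)
      omega
    · right
      have := Nat.mul_le_mul_right (n * n) (show t + 1 ≤ t' from h)
      rw [Nat.succ_mul] at this
      omega
  obtain ⟨h1, h2, h3⟩ := St.run_fillAt hσ.order (hσ.base t ht) (by omega)
    (fun m hm => he m (key m hm))
  exact ⟨h1, h3, key _ h2⟩

/-- The tables `0`, `1`, … contain the members of a list. -/
def Tabs (n : ℕ) (m : ℕ → ℕ) (L : List (Fin n → Fin n → ℕ)) : Prop :=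
  ∀ t f, L[t]? = some f → Tab n m t f

/-- The registers are `ρ`, and the tables contain the members of the list. -/
structure Stores (n : ℕ) (ρ : ℕ → ℕ) (L : List (Fin n → Fin n → ℕ)) (σ : State) : Prop where
  reg : σ.reg = ρ
  layout : Layout n ρ
  tabs : Tabs n σ.mem L

theorem Stores.fill {n t : ℕ} {ρ : ℕ → ℕ} {L : List (Fin n → Fin n → ℕ)} {σ : State}
    (h : Stores n ρ L σ) (ht : L.length = t) (ht' : t < 20) {e : Ex} (f : Fin n → Fin n → ℕ)
    (he : ∀ m, Tabs n m L → ∀ i j : Fin n,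
      e.eval (bindVar (bindVar ρ 30 i n) 32 j n) m = f i j) :
    Stores n ρ (L ++ [f]) ((St.fillAt (10 + t) e).run σ) := by
  have hlt : ∀ {t' g}, L[t']? = some g → t' < t := fun hg => by
    rw [← ht]; exact (List.getElem?_eq_some_iff.1 hg).1
  obtain ⟨h1, h2, h3⟩ := St.run_fill (f := f) (e := e) (t := t) (σ := σ)
    (h.reg ▸ h.layout) ht' (by
      intro m hm
      rw [h.reg]
      exact he m fun t' g hg => hm t' (hlt hg).ne g (h.tabs t' g hg))
  refine ⟨h1.trans h.reg, h.layout, fun t' g hg => ?_⟩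
  rcases lt_trichotomy t' t with hl | hl | hl
  · rw [List.getElem?_append_left (by omega)] at hg
    exact h3 t' hl.ne g (h.tabs t' g hg)
  · subst hl
    rw [← ht] at hg
    simp only [List.getElem?_concat_length, Option.some.injEq] at hg
    exact hg ▸ h2
  · rw [List.getElem?_eq_none (by simp; omega)] at hg
    cases hg

theorem Stores.set {n x : ℕ} {ρ : ℕ → ℕ} {L : List (Fin n → Fin n → ℕ)} {σ : State}
    (h : Stores n ρ L σ) (hx : x ≠ 1 ∧ x < 10) {e : Ex} :
    Stores n (Function.update ρ x (e.eval ρ σ.mem)) L ((St.set x e).run σ) := by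
  refine ⟨?_, ⟨?_, fun t ht => ?_⟩, h.tabs⟩
  · simp only [St.run, State.setReg, h.reg]
  · rw [Function.update_of_ne (by omega), h.layout.order]
  · rw [Function.update_of_ne (by omega), h.layout.base t ht]

/-- Compute the addresses of the tables, from the size of a table in register `3`. -/
def St.bases : ℕ → St
  | 0 => .set 10 (.lit 2)
  | t + 1 => .seq (St.bases t) (.set (11 + t) (.add (.var (10 + t)) (.var 3)))

theorem St.run_bases (q : ℕ) (σ : State) :
    ((St.bases q).run σ).mem = σ.mem ∧ (∀ r < 10, ((St.bases q).run σ).reg r = σ.reg r) ∧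
      ∀ t ≤ q, ((St.bases q).run σ).reg (10 + t) = 2 + t * σ.reg 3 := by
  induction q with
  | zero =>
    refine ⟨rfl, fun r hr => ?_, fun t ht => ?_⟩
    · simp [St.bases, St.run, State.setReg, show r ≠ 10 by omega]
    · obtain rfl : t = 0 := by omega
      simp [St.bases, St.run, State.setReg, Ex.eval]
  | succ q ih =>
    obtain ⟨h1, h2, h3⟩ := ih
    refine ⟨h1, fun r hr => ?_, fun t ht => ?_⟩
    · simp only [St.bases, St.run, State.setReg]
      rw [Function.update_of_ne (by omega), h2 r hr]
    · simp only [St.bases, St.run, State.setReg, Ex.eval]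
      rcases Nat.lt_succ_iff_lt_or_eq.1 (Nat.lt_succ_of_le ht) with h | h
      · rw [Function.update_of_ne (by omega), h3 t (by omega)]
      · rw [h, show 10 + (q + 1) = 11 + q by omega, Function.update_self, h3 q le_rfl,
          h2 3 (by omega), Nat.succ_mul]
        omega

/-- Prepare for work with the matrix in memory. -/
def St.setup : St :=
  .seq (.set 2 (.ld (.lit 1))) (.seq (.set 3 (.sum 30 (.sum 32 (.lit 1)))) (St.bases 19))

/-- The memory holds `n`, `k` and a matrix. -/
structure Matrix (n k : ℕ) (ℓ : Fin n → Fin n → ℕ) (m : ℕ → ℕ) : Prop where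
  order : m 0 = n
  parameter : m 1 = k
  entry : ∀ i j : Fin n, m (2 + i * n + j) = ℓ i j

/-- Table `0` starts at address `2`, so the matrix in memory already is table `0`; only the
addresses have to be computed. -/
theorem stores_setup {n k : ℕ} {ℓ : Fin n → Fin n → ℕ} {σ : State} (h : Matrix n k ℓ σ.mem)
    (h1 : σ.reg 1 = n) :
    ∃ ρ, ρ 2 = k ∧ Stores n ρ [ℓ] (St.setup.run σ) := by
  set τ := ((St.set 3 (.sum 30 (.sum 32 (.lit 1)))).run ((St.set 2 (.ld (.lit 1))).run σ)) with hτ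
  have e1 : τ.mem = σ.mem := rfl
  have e2 : τ.reg 1 = n := by
    simp [hτ, St.run, State.setReg, h1]
  have e3 : τ.reg 2 = k := by
    simp [hτ, St.run, State.setReg, Ex.eval, h.parameter]
  have e4 : τ.reg 3 = n * n := by
    simp [hτ, St.run, State.setReg, Ex.eval, h.parameter, h1, bindVar_apply]
  obtain ⟨g1, g2, g3⟩ := St.run_bases 19 τ
  refine ⟨_, (g2 2 (by omega)).trans e3, rfl, ⟨(g2 1 (by omega)).trans e2, fun t ht => ?_⟩, ?_⟩
  · rw [← e4]; exact g3 t (by omega)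
  · intro t f hf
    have ht : t = 0 := by
      have := (List.getElem?_eq_some_iff.1 hf).1
      simpa using this
    subst ht
    simp only [List.length_cons, List.length_nil, zero_add, Nat.lt_add_one, getElem?_pos,
      List.getElem_cons_zero, Option.some.injEq] at hf
    subst hf
    intro i j
    have : (St.setup.run σ).mem = σ.mem := g1.trans e1
    rw [this, ← h.entry]
    congr 1
    omega

/-- Replace the matrix in memory by a matrix whose order is in register `5`; this order must not
exceed the present one. -/
def St.emit (e : Ex) : St :=
  .seq (.set 1 (.sub (.var 1) (.sub (.var 1) (.var 5))))
    (.seq (.fillAt 10 e) (.seq (.put (.lit 0) (.var 1)) (.put (.lit 1) (.var 2))))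

/-- The new matrix has order `c ≤ n` and fits into the place of table `0`. All other tables remain
readable while it is written, and `e` may rely on these only. -/
theorem Stores.emit {n c k : ℕ} {ρ : ℕ → ℕ} {L : List (Fin n → Fin n → ℕ)} {σ : State}
    (h : Stores n ρ L σ) (hc : ρ 5 = c) (hk : ρ 2 = k) (hcn : c ≤ n) {e : Ex}
    {f : Fin c → Fin c → ℕ}
    (he : ∀ m, (∀ t g, t ≠ 0 → L[t]? = some g → Tab n m t g) → ∀ i j : Fin c,
      e.eval (bindVar (bindVar (Function.update ρ 1 c) 30 i c) 32 j c) m = f i j) :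
    Matrix c k f ((St.emit e).run σ).mem := by
  set τ := (St.set 1 (.sub (.var 1) (.sub (.var 1) (.var 5)))).run σ with hτ
  have e1 : τ.reg = Function.update ρ 1 c := by
    simp only [hτ, St.run, State.setReg, h.reg, Ex.eval, hc, h.layout.order]
    -- The order is assigned as `n - (n - c)`, because `Plain` permits only differences of this form
    -- in register `1`.
    rw [Nat.sub_sub_self hcn]
  obtain ⟨g1, g2, g3⟩ := St.run_fillAt (σ := τ) (n := c) (r := 10) (c := 2) (e := e) (f := f)
    (by rw [e1]; simp) (by rw [e1, Function.update_of_ne (by omega)]; simpa using h.layout.base 0)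
    (by omega) (by
      intro m hm
      rw [e1]
      refine he m fun t g ht hg => (h.tabs t g hg).of_eq fun a h1 _ => hm a (Or.inr ?_)
      have h2 : 1 * (n * n) ≤ t * (n * n) := Nat.mul_le_mul_right _ (by omega)
      have h3 := Nat.mul_le_mul hcn hcn
      omega)
  set υ := (St.fillAt 10 e).run τ with hυ
  have e5 : ((St.emit e).run σ).mem = Function.update (Function.update υ.mem 0 c) 1 k := by
    simp only [St.emit, St.run, State.setMem, Ex.eval]
    have q1 : υ.reg 1 = c := by rw [g1, e1]; simp
    have q2 : υ.reg 2 = k := by rw [g1, e1, Function.update_of_ne (by omega), hk]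
    rw [← q1, ← q2]
    rfl
  rw [e5]
  refine ⟨by simp, by simp, fun i j => ?_⟩
  rw [Function.update_of_ne (by omega), Function.update_of_ne (by omega), ← g3, Nat.add_assoc]

end Fill

end TreePlusK

namespace TreePlusK
open scoped Classical

/-! ### Listing the members of a set -/

section Select

/-- The members of a set of numbers below `n` in increasing order. -/
theorem exists_enumeration {n c : ℕ} (P : Fin n → Prop) (hc : (∑ x, if P x then 1 else 0) = c) :
    ∃ e : Fin c ≃ {x // P x}, ∀ (a : Fin c) (g : Fin n → ℕ),
      (∑ x, if P x ∧ (∑ j, if P j ∧ j.val < x.val then 1 else 0) = a.val then g x else 0) =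
        g (e a) := by
  let e := Fintype.orderIsoFinOfCardEq {x // P x} (k := c)
    (by rw [Fintype.card_subtype, ← hc, Finset.sum_boole, Nat.cast_id])
  refine ⟨e.toEquiv, fun a g => ?_⟩
  have rank : ∀ a, (∑ j, if P j ∧ j.val < (e a).1.val then 1 else 0) = a.val := by
    intro a
    have h1 : (∑ j, if P j ∧ j.val < (e a).1.val then 1 else 0) =
        ∑ y : {x // P x}, if y < e a then 1 else 0 := by
      have := sum_subtype_indicator P fun j => if j.val < (e a).1.val then 1 else 0
      simp only [← ite_and] at this
      rw [← this]
      exact Finset.sum_congr rfl fun y _ => if_congr Iff.rfl rfl rfl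
    have h2 : (∑ y : {x // P x}, if y < e a then 1 else 0) =
        ∑ b : Fin c, if b < a then 1 else 0 := by
      rw [← e.toEquiv.sum_comp]
      refine Finset.sum_congr rfl fun b _ => ?_
      simp
    rw [h1, h2, Finset.sum_boole, Nat.cast_id, ← Fin.card_Iio a]
    congr 1
    ext b
    simp
  -- A member is determined by its rank, so exactly one term survives.
  rw [Finset.sum_eq_single (e a).1]
  · rw [if_pos ⟨(e a).2, rank a⟩]
    rfl
  · intro x _ hx
    rw [if_neg]
    rintro ⟨hP, h⟩
    obtain ⟨b, hb⟩ := e.surjective ⟨x, hP⟩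
    have := rank b
    rw [hb] at this
    have hab : a = b := Fin.ext (h.symm.trans this)
    exact hx (by rw [hab, hb])
  · simp

/-- For the member of the set in table `s` whose rank is the column, the value of `v`, which may
refer to this member by register `34`. -/
def Ex.member (s : ℕ) (v : Ex) : Ex :=
  .sum 34 (.ite (.and (.row s 34)
    (.eq (.sum 36 (.bool (.and (.row s 36) (.lt (.var 36) (.var 34))))) (.var 32))) v (.lit 0))

theorem Ex.eval_row {ρ m : ℕ → ℕ} {n s : ℕ} (hρ : Layout n ρ) {g : Fin n → ℕ} (hs : s < 20)
    (h : Tab n m s fun _ j => g j) (j : Fin n) : m (ρ (10 + s) + j) = g j := by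
  rw [hρ.base s hs]
  exact h.row j

theorem Ex.eval_member {ρ m : ℕ → ℕ} {n s : ℕ} (hρ : Layout n ρ) {P : Fin n → Prop} (hs : s < 20)
    (h : Tab n m s fun _ j => if P j then 1 else 0) (i j : Fin n) {v : Ex} {g : Fin n → ℕ}
    (hv : ∀ x : Fin n,
      v.eval (bindVar (bindVar (bindVar ρ 30 i n) 32 j n) 34 x n) m = g x) :
    (Ex.member s v).eval (bindVar (bindVar ρ 30 i n) 32 j n) m =
      ∑ x, if P x ∧ (∑ j, if P j ∧ j.val < x.val then 1 else 0) = j.val then g x else 0 := by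
  have h1 := hρ.order
  have hrow : ∀ j : Fin n, m (ρ (10 + s) + j) = if P j then 1 else 0 :=
    fun j => Ex.eval_row hρ hs h j
  have hsum := fun (x : ℕ) (e : Ex) (ρ' : ℕ → ℕ) (h : ρ' 1 = n) => Ex.eval_sum (x := x) (e := e)
    (m := m) h
  have n1 : 10 + s ≠ 30 := by omega
  have n2 : 10 + s ≠ 31 := by omega
  have n3 : 10 + s ≠ 32 := by omega
  have n4 : 10 + s ≠ 33 := by omega
  have n5 : 10 + s ≠ 34 := by omega
  have n6 : 10 + s ≠ 35 := by omega
  have n7 : 10 + s ≠ 36 := by omega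
  have n8 : 10 + s ≠ 37 := by omega
  unfold Ex.member
  rw [hsum 34 _ _ (by simp [bindVar_apply, h1])]
  refine Finset.sum_congr rfl fun x _ => ?_
  rw [Ex.eval_ite, hv]
  have hsum2 := hsum 36 (.bool (.and (.row s 36) (.lt (.var 36) (.var 34))))
    (bindVar (bindVar (bindVar ρ 30 i n) 32 j n) 34 x n) (by simp [bindVar_apply, h1])
  refine if_congr ?_ rfl rfl
  rw [Ex.T_and, Ex.T_eq, hsum2]
  have hpos : ∀ j : Fin n, 0 < m (ρ (10 + s) + j) ↔ P j := fun j => by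
    rw [hrow]; split_ifs with h <;> simp [h]
  simp only [Ex.eval_bool, Ex.T_and, Ex.T_row, Ex.T_lt, Ex.eval_var, bindVar_apply, n1, n2, n3, n4,
    n5, n6, n7, n8, if_false]
  simp [hpos]

end Select

/-! ### Reachability -/

section Closure

/-- The table of a binary relation. -/
noncomputable def relTable {n : ℕ} (P : Fin n → Fin n → Prop) (i j : Fin n) : ℕ :=
  if P i j then 1 else 0

/-- Table `t` becomes the reachability relation of the graph in table `a`. -/
def St.closure (a t : ℕ) : St :=
  .seq (.fillAt (10 + t) (.bool (.same 30 32)))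
    (.iter 34 (.seq (.fillAt (10 + (t + 1)) (.bool (.or (.tab t 30 32)
      (.ex 36 (.and (.tab t 30 36) (.tab a 36 32)))))) (.fillAt (10 + t) (.tab (t + 1) 30 32))))

theorem Layout.bindVar {n x i N : ℕ} {ρ : ℕ → ℕ} (h : Layout n ρ) (hx : 30 ≤ x) :
    Layout n (bindVar ρ x i N) := by
  refine ⟨?_, fun t ht => ?_⟩
  · rw [bindVar_one (by omega), h.order]
  · rw [bindVar_apply, if_neg (by omega), if_neg (by omega), h.base t ht]

theorem Layout.tab {n t : ℕ} {ρ m : ℕ → ℕ} (h : Layout n ρ) (ht : t < 20)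
    {f : Fin n → Fin n → ℕ} (hf : Tab n m t f) (i j : Fin n) :
    m (ρ (10 + t) + (i * n + j)) = f i j := by
  rw [h.base t ht]
  exact hf i j

theorem exists_walk_length_succ {V : Type*} {A : SimpleGraph V} {x y : V} {i : ℕ} :
    (∃ w : A.Walk x y, w.length ≤ i + 1) ↔ (∃ w : A.Walk x y, w.length ≤ i) ∨
      ∃ z, (∃ w : A.Walk x z, w.length ≤ i) ∧ A.Adj z y := by
  constructor
  · rintro ⟨w, hw⟩
    cases w using SimpleGraph.Walk.concatRec with
    | Hnil => exact Or.inl ⟨.nil, by simp⟩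
    | Hconcat p h _ =>
      rw [SimpleGraph.Walk.length_concat] at hw
      exact Or.inr ⟨_, ⟨p, by omega⟩, h⟩
  · rintro (⟨w, hw⟩ | ⟨z, ⟨w, hw⟩, h⟩)
    · exact ⟨w, by omega⟩
    · exact ⟨w.concat h, by rw [SimpleGraph.Walk.length_concat]; omega⟩

theorem exists_walk_length_le {V : Type*} [Fintype V] {A : SimpleGraph V} {x y : V} :
    (∃ w : A.Walk x y, w.length ≤ Fintype.card V) ↔ A.Reachable x y := by
  refine ⟨fun ⟨w, _⟩ => ⟨w⟩, fun ⟨w⟩ => ⟨w.toPath.1, ?_⟩⟩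
  exact w.toPath.2.length_lt.le

/-- After `i` rounds table `t` tells which pairs are joined by a walk of length at most `i`; `n`
rounds suffice, because paths are shorter than `n`. Each round is computed in the scratch table `t +
1` and copied back, since `run_fill` does not allow reading the table being written. -/
theorem Stores.closure {n t a : ℕ} {ρ : ℕ → ℕ} {L : List (Fin n → Fin n → ℕ)} {σ : State}
    (h : Stores n ρ L σ) (ht : L.length = t) (ht' : t + 1 < 20) {A : SimpleGraph (Fin n)}
    (ha : L[a]? = some (plainLabel A)) :
    Stores n ρ (L ++ [relTable A.Reachable]) ((St.closure a t).run σ) := by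
  have hlt : ∀ {t' g}, L[t']? = some g → t' < t := fun hg => by
    rw [← ht]; exact (List.getElem?_eq_some_iff.1 hg).1
  have hat := hlt ha
  set R : ℕ → Fin n → Fin n → ℕ :=
    fun i x y => if ∃ w : A.Walk x y, w.length ≤ i then 1 else 0 with hR
  obtain ⟨g1, g2, g3⟩ := St.run_fill (f := R 0) (e := .bool (.same 30 32)) (t := t) (σ := σ)
    (h.reg ▸ h.layout) (by omega) (by
      intro m _ i j
      rw [Ex.eval_bool, Ex.T_same]
      simp only [bindVar_apply, hR]
      refine if_congr ?_ rfl rfl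
      constructor
      · intro hij
        obtain rfl : i = j := Fin.ext (by simpa using hij)
        exact ⟨.nil, by simp⟩
      · rintro ⟨w, hw⟩
        rw [SimpleGraph.Walk.eq_of_length_eq_zero (Nat.le_zero.1 hw)]
        simp)
  set τ := (St.fillAt (10 + t) (.bool (.same 30 32))).run σ with hτ
  have hreg : τ.reg = ρ := g1.trans h.reg
  obtain ⟨υ, ⟨h1, h2, h3⟩, h4⟩ := St.run_iter (x := 34) (N := n) (σ := τ)
    (p := .seq (.fillAt (10 + (t + 1)) (.bool (.or (.tab t 30 32)
      (.ex 36 (.and (.tab t 30 36) (.tab a 36 32)))))) (.fillAt (10 + t) (.tab (t + 1) 30 32)))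
    (by rw [hreg, h.layout.order])
    (fun i υ => (∀ r, r ≠ 34 → r ≠ 35 → υ.reg r = τ.reg r) ∧ Tab n υ.mem t (R i) ∧
      ∀ t', t' ≠ t → t' ≠ t + 1 → ∀ g, Tab n τ.mem t' g → Tab n υ.mem t' g)
    ⟨fun _ _ _ => rfl, g2, fun _ _ _ _ h => h⟩ (by
      rintro i hi υ ⟨h1, h2, h3⟩
      have hreg2 : (υ.enter 34 i n).reg = bindVar ρ 34 i n := by
        rw [← hreg]; exact bindVar_eq h1
      have hlay : Layout n (υ.enter 34 i n).reg := by
        rw [hreg2]; exact h.layout.bindVar (by omega)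
      obtain ⟨k1, k2, k3⟩ := St.run_fill (f := R (i + 1)) (e := .bool (.or (.tab t 30 32)
        (.ex 36 (.and (.tab t 30 36) (.tab a 36 32))))) (t := t + 1) (σ := υ.enter 34 i n)
        hlay ht' (by
          intro m hm x y
          have ht1 := hm t (by omega) _ h2
          have ht2 := hm a (by omega) _ (h3 a (by omega) (by omega) _
            (g3 a (by omega) _ (h.tabs a _ ha)))
          rw [Ex.eval_bool]
          refine if_congr ?_ rfl rfl
          rw [exists_walk_length_succ, Ex.T_or, Ex.T_ex (n := n) (((hlay.bindVar
            (by omega)).bindVar (by omega)).order)]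
          simp only [Ex.T_and]
          refine or_congr ?_ (exists_congr fun z => and_congr ?_ ?_)
          · have := ((hlay.bindVar (x := 30) (i := x) (N := n) (by omega)).bindVar (x := 32)
              (i := y) (N := n) (by omega)).tab (by omega) ht1 x y
            rw [Ex.T_tab, show bindVar (bindVar (υ.enter 34 i n).reg 30 x n) 32 y n (30 + 1) =
              x * n by simp [bindVar_apply], show bindVar (bindVar (υ.enter 34 i n).reg 30 x n) 32
              y n 32 = y by simp [bindVar_apply], this, hR]
            simp only
            split_ifs with h <;> simp [h]
          · have := (((hlay.bindVar (x := 30) (i := x) (N := n) (by omega)).bindVar (x := 32)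
              (i := y) (N := n) (by omega)).bindVar (x := 36) (i := z) (N := n) (by omega)).tab
                (by omega) ht1 x z
            simp only [Ex.T_tab]
            rw [show bindVar (bindVar (bindVar (υ.enter 34 i n).reg 30 x n) 32 y n) 36 z n (30 + 1)
              = x * n by simp [bindVar_apply], show bindVar (bindVar (bindVar (υ.enter 34 i n).reg
              30 x n) 32 y n) 36 z n 36 = z by simp [bindVar_apply], this, hR]
            simp only
            split_ifs with h <;> simp [h]
          · have := (((hlay.bindVar (x := 30) (i := x) (N := n) (by omega)).bindVar (x := 32)
              (i := y) (N := n) (by omega)).bindVar (x := 36) (i := z) (N := n) (by omega)).tab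
                (by omega) ht2 z y
            simp only [Ex.T_tab]
            rw [show bindVar (bindVar (bindVar (υ.enter 34 i n).reg 30 x n) 32 y n) 36 z n (36 + 1)
              = z * n by simp [bindVar_apply], show bindVar (bindVar (bindVar (υ.enter 34 i n).reg
              30 x n) 32 y n) 36 z n 32 = y by simp [bindVar_apply], this, plainLabel]
            split_ifs with h <;> simp [h])
      set φ := (St.fillAt (10 + (t + 1)) (.bool (.or (.tab t 30 32)
        (.ex 36 (.and (.tab t 30 36) (.tab a 36 32)))))).run (υ.enter 34 i n) with hφ
      obtain ⟨q1, q2, q3⟩ := St.run_fill (f := R (i + 1)) (e := .tab (t + 1) 30 32)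
        (t := t) (σ := φ) (k1 ▸ hlay) (by omega) (by
          intro m hm x y
          have := (((k1 ▸ hlay : Layout n φ.reg).bindVar (x := 30) (i := x) (N := n)
            (by omega)).bindVar (x := 32) (i := y) (N := n) (by omega)).tab (by omega)
              (hm (t + 1) (by omega) _ k2) x y
          rw [← this]
          simp only [Ex.tab, Ex.eval]
          rw [show bindVar (bindVar φ.reg 30 x n) 32 y n (30 + 1) = x * n by simp [bindVar_apply],
            show bindVar (bindVar φ.reg 30 x n) 32 y n 32 = y by simp [bindVar_apply]])
      refine ⟨fun r r1 r2 => ?_, q2, fun t' u1 u2 g hg => ?_⟩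
      · have : ((St.fillAt (10 + t) (.tab (t + 1) 30 32)).run φ).reg r = υ.reg r := by
          rw [q1, k1, State.enter]
          simp only [bindVar_apply]
          rw [if_neg r2, if_neg r1]
        exact this.trans (h1 r r1 r2)
      · exact q3 t' u1 g (k3 t' u2 g (h3 t' u1 u2 g hg)))
  have h5 : (St.closure a t).run σ = υ.leave 34 (τ.reg 34) (τ.reg (34 + 1)) := h4
  rw [h5]
  refine ⟨(leave_reg h1).trans hreg, h.layout, fun t' g hg => ?_⟩
  rw [leave_mem]
  rcases lt_trichotomy t' t with hl | hl | hl
  · rw [List.getElem?_append_left (by omega)] at hg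
    exact h3 t' hl.ne (by omega) g (g3 t' hl.ne g (h.tabs t' g hg))
  · subst hl
    rw [← ht] at hg
    simp only [List.getElem?_concat_length, Option.some.injEq] at hg
    rw [← hg]
    have e : R n = relTable A.Reachable := by
      funext i j
      have := exists_walk_length_le (A := A) (x := i) (y := j)
      rw [Fintype.card_fin] at this
      simp only [hR, this, relTable]
      congr
    rw [← e]
    exact h2
  · rw [List.getElem?_eq_none (by simp; omega)] at hg
    cases hg

end Closure

end TreePlusK

namespace TreePlusK
open scoped Classical

/-! ### The reduction of twins as a program -/

section Reduction

theorem pos_indicator {p : Prop} [Decidable p] : 0 < (if p then 1 else 0) ↔ p := by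
  split_ifs with h <;> simp [h]

/-- The vertices with registers `x` and `y` are twins; `z` is an auxiliary register. -/
def Ex.twin (x y z : ℕ) : Ex :=
  .all z (.iff (.or (.tab 0 x z) (.same z x)) (.or (.tab 0 y z) (.same z y)))

/-- The vertex in register `32` is among the first vertices of its class of twins. -/
def Ex.isKept : Ex :=
  .lt (.sum 34 (.bool (.and (.lt (.var 34) (.var 32)) (.twin 32 34 36)))) (.var 4)

/-- Keep a limited number of vertices of every class of twins. -/
def St.reduceTwins : St :=
  .seq .setup
    (.seq (.set 4 (.add (.add (.add (.var 2) (.var 2)) (.add (.var 2) (.var 2)))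
      (.add (.add (.var 2) (.var 2)) (.lit 3))))
    (.seq (.fillAt 11 (.bool .isKept))
    (.seq (.fillAt 12 (.member 1 (.var 34)))
    (.seq (.fillAt 13 (.member 1 (.var 35)))
    (.seq (.fillAt 14 (.tab 0 30 32))
      (.set 5 (.sum 34 (.row 1 34))))))))

/-- An entry of the submatrix of table `4` that belongs to a set of rows given by the tables `2`
and `3`. -/
def Ex.entry : Ex :=
  .ld (.add (.var 14) (.add (.ld (.add (.var 13) (.var 30))) (.ld (.add (.var 12) (.var 32)))))

/-- The reduced instance is written to the memory. -/
def St.twinRule : St :=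
  .seq (.set 1 (.ld (.lit 0))) (.seq .reduceTwins (.emit .entry))

theorem mem_kept_iff {n t : ℕ} {G : SimpleGraph (Fin n)} {j : Fin n} :
    j ∈ kept G t ↔ (∑ i, if i.val < j.val ∧ Twin G j i then 1 else 0) < t := by
  unfold kept
  rw [Finset.mem_filter, Finset.sum_boole, Nat.cast_id]
  simp only [Finset.mem_univ, true_and]
  exact Iff.rfl

/-- Tables `2` and `3` give, for each new index, the old vertex and its multiple by `n`, that is,
the column and the row offset. Table `4` is a copy of the matrix, because the output overwrites
table `0`. -/
theorem run_twinRule {n k : ℕ} {G : SimpleGraph (Fin n)} {σ : State}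
    (h : Matrix n k (plainLabel G) σ.mem) :
    ∃ (c : ℕ) (e : Fin c ≃ {x // x ∈ kept G (6 * k + 3)}),
      Matrix c k (plainLabel (G.comap fun i => (e i).1)) (St.twinRule.run σ).mem := by
  set τ := (St.set 1 (.ld (.lit 0))).run σ with hτ
  have hm0 : τ.mem = σ.mem := rfl
  obtain ⟨ρ, hk, h0⟩ := stores_setup (σ := τ) (hm0 ▸ h) (by
    simp [hτ, St.run, State.setReg, Ex.eval, h.order])
  obtain ⟨P, hP⟩ : ∃ P : Fin n → Prop, ∀ x, P x ↔ x ∈ kept G (6 * k + 3) := ⟨_, fun _ => Iff.rfl⟩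
  obtain ⟨c, hc⟩ : ∃ c, (∑ x, if P x then 1 else 0) = c := ⟨_, rfl⟩
  obtain ⟨e, he⟩ := exists_enumeration P hc
  refine ⟨c, e.trans (Equiv.subtypeEquivRight hP), ?_⟩
  have h1 := h0.set (x := 4) (e := .add (.add (.add (.var 2) (.var 2)) (.add (.var 2) (.var 2)))
      (.add (.add (.var 2) (.var 2)) (.lit 3))) (by omega)
  set ρ' := Function.update ρ 4 _ with hρ'
  have hk' : ρ' 2 = k := by rw [hρ', Function.update_of_ne (by omega), hk]
  have ht : ρ' 4 = 6 * k + 3 := by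
    rw [hρ', Function.update_self]
    simp only [Ex.eval, hk]
    omega
  clear_value ρ'
  have hL := h1.layout
  have hn : ρ' 1 = n := hL.order
  have hsum := fun (x : ℕ) (e : Ex) (ρ' m : ℕ → ℕ) (h : ρ' 1 = n) => Ex.eval_sum (x := x) (e := e)
    (m := m) h
  have hall := fun (x : ℕ) (e : Ex) (ρ' m : ℕ → ℕ) (h : ρ' 1 = n) => Ex.T_all (x := x) (e := e)
    (m := m) h
  have h2 := h1.fill (t := 1) rfl (by omega) (e := .bool .isKept)
    (fun _ j => if P j then 1 else 0) (by
      intro m hm i j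
      have a0 : ∀ x y : Fin n, m (ρ' 10 + (x * n + y)) = plainLabel G x y :=
        hL.tab (by omega) (hm 0 _ rfl)
      rw [Ex.eval_bool]
      refine if_congr ?_ rfl rfl
      rw [hP, mem_kept_iff, Ex.isKept, Ex.T_lt, hsum _ _ _ _ (by simp [bindVar_apply, hn])]
      simp [Ex.twin, Ex.T_lt, Ex.eval_var, Ex.eval_bool, Ex.T_and, Ex.T_iff, Ex.T_or,
        Ex.T_tab, Ex.T_same, hn, ht, hall, bindVar_apply, a0, plainLabel, pos_indicator, Twin,
        Fin.val_inj])
  have h3 := h2.fill (t := 2) rfl (by omega) (e := .member 1 (.var 34))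
    (fun _ j => ∑ x, if P x ∧ (∑ j, if P j ∧ j.val < x.val then 1 else 0) = j.val then x.val else 0)
    (by
      intro m hm i j
      exact Ex.eval_member hL (by omega) (hm 1 _ rfl) i j
        fun x => by simp [Ex.eval_var, bindVar_apply])
  have h4 := h3.fill (t := 3) rfl (by omega) (e := .member 1 (.var 35))
    (fun _ j => ∑ x, if P x ∧ (∑ j, if P j ∧ j.val < x.val then 1 else 0) = j.val
      then x.val * n else 0)
    (by
      intro m hm i j
      exact Ex.eval_member hL (by omega) (hm 1 _ rfl) i j
        fun x => by simp [Ex.eval_var, bindVar_apply])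
  have h5 := h4.fill (t := 4) rfl (by omega) (e := .tab 0 30 32) (plainLabel G) (by
      intro m hm i j
      have a0 : ∀ x y : Fin n, m (ρ' 10 + (x * n + y)) = plainLabel G x y :=
        hL.tab (by omega) (hm 0 _ rfl)
      simp [Ex.tab, Ex.eval, bindVar_apply, a0])
  have h6 := h5.set (x := 5) (e := .sum 34 (.row 1 34)) (by omega)
  set ρ'' := Function.update ρ' 5 _ with hρ''
  have hL' := h6.layout
  have hc' : ρ'' 5 = c := by
    rw [hρ'', Function.update_self, hsum _ _ _ _ hn, ← hc]
    refine Finset.sum_congr rfl fun x _ => ?_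
    have := Ex.eval_row hL (by omega) (h5.tabs 1 _ rfl) x
    simp only [Nat.reduceAdd] at this
    simp [Ex.row, Ex.eval, bindVar_apply, this]
  have hcn : c ≤ n := by
    rw [← hc, Finset.sum_boole, Nat.cast_id]
    exact (Finset.card_le_univ _).trans (by simp)
  refine h6.emit hc' (by rw [hρ'', Function.update_of_ne (by omega), hk']) hcn ?_
  intro m hm i j
  have b2 := fun x => (hm 2 _ (by omega) rfl).row x
  have b3 := fun x => (hm 3 _ (by omega) rfl).row x
  have b4 := hm 4 _ (by omega) rfl (e i) (e j)
  have c2 : m (2 + 2 * (n * n) + j) = (e j).1 := (b2 ⟨j, by omega⟩).trans (he j fun x => x.val)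
  have c3 : m (2 + 3 * (n * n) + i) = (e i).1 * n :=
    (b3 ⟨i, by omega⟩).trans (he i fun x => x.val * n)
  have d2 := hL'.base 2 (by omega)
  have d3 := hL'.base 3 (by omega)
  have d4 := hL'.base 4 (by omega)
  simp only [Nat.reduceAdd] at d2 d3 d4
  change _ = plainLabel G (e i).1 (e j).1
  simp [Ex.entry, Ex.eval, bindVar_apply, d2, d3, d4, c2, c3, b4]

end Reduction

end TreePlusK

namespace TreePlusK
open scoped Classical

/-! ### Tables of recognizable edges, core, components and labels -/

section KernelTables

/-- The table of a set; only the first row is of interest. -/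
noncomputable def setTable {n : ℕ} (P : Fin n → Prop) (_ j : Fin n) : ℕ := if P j then 1 else 0

theorem Layout.pos_tab {n t : ℕ} {ρ m : ℕ → ℕ} (h : Layout n ρ) (ht : t < 20)
    {P : Fin n → Fin n → Prop} (hP : Tab n m t (relTable P)) (i j : Fin n) :
    0 < m (ρ (10 + t) + (i * n + j)) ↔ P i j := by
  rw [h.tab ht hP]
  exact pos_indicator

theorem Layout.pos_row {n t : ℕ} {ρ m : ℕ → ℕ} (h : Layout n ρ) (ht : t < 20)
    {P : Fin n → Prop} (hP : Tab n m t (setTable P)) (j : Fin n) :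
    0 < m (ρ (10 + t) + j) ↔ P j := by
  rw [h.base t ht, hP.row j]
  exact pos_indicator

def Ex.side (u v x z : ℕ) : Ex :=
  .and (.tab 0 u z) (.and (.tab 0 v z) (.or (.same z x) (.tab 0 z x)))

def Ex.otherSide (u v x z : ℕ) : Ex :=
  .and (.tab 0 u z) (.and (.tab 0 v z) (.and (.not (.same z x)) (.not (.tab 0 z x))))

/-- The conjuncts share the registers `36` and `38`, so the nesting depth is two. With the three
loops over `u`, `v` and `x` this gives the exponent five. -/
def Ex.recog (u v x : ℕ) : Ex :=
  .and (.tab 0 u v) (.and (.tab 0 u x) (.and (.tab 0 v x) (.and (.ex 36 (.otherSide u v x 36))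
    (.and (.all 36 (.all 38 (.imp (.not (.same 36 38)) (.imp (.or
        (.and (.side u v x 36) (.side u v x 38))
        (.and (.otherSide u v x 36) (.otherSide u v x 38))) (.tab 0 36 38)))))
    (.and (.all 36 (.all 38 (.imp (.side u v x 36) (.imp (.otherSide u v x 38)
      (.not (.tab 0 36 38))))))
    (.and (.all 36 (.all 38 (.imp (.tab 0 u 36) (.imp (.not (.same 36 v)) (.imp
      (.not (.tab 0 v 36)) (.imp (.otherSide u v x 38) (.not (.tab 0 36 38))))))))
    (.and (.all 36 (.all 38 (.imp (.tab 0 v 36) (.imp (.not (.same 36 u)) (.imp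
      (.not (.tab 0 u 36)) (.imp (.side u v x 38) (.not (.tab 0 36 38))))))))
    (.ex 36 (.and (.not (.same 36 u)) (.and (.not (.same 36 v))
      (.not (.iff (.tab 0 u 36) (.tab 0 v 36)))))))))))))

def Ex.known : Ex :=
  .or (.tab 1 30 32) (.and (.all 34 (.not (.tab 1 30 34))) (.and (.ex 34 (.tab 1 32 34))
    (.all 34 (.iff (.or (.tab 0 30 34) (.same 34 30)) (.or (.same 34 32) (.tab 1 32 34))))))

/-- The tables of known edges, settled vertices, gates, and core vertices. -/
def St.recognize : St :=
  .seq (.fillAt 11 (.bool (.ex 34 (.or (.recog 30 34 32) (.recog 30 32 34)))))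
    (.seq (.fillAt 12 (.bool .known))
    (.seq (.fillAt 13 (.bool (.ex 34 (.tab 2 32 34))))
    (.seq (.fillAt 14 (.bool (.and (.row 3 32) (.ex 34 (.and (.not (.row 3 34)) (.tab 2 32 34))))))
      (.fillAt 15 (.bool (.or (.not (.row 3 32)) (.row 4 32)))))))

/-- Each table uses the earlier ones instead of their definitions, which keeps the nesting depth
within five. -/
theorem run_recognize {n : ℕ} {G : SimpleGraph (Fin n)} {ρ : ℕ → ℕ} {σ : State}
    (h0 : Stores n ρ [plainLabel G] σ) :
    Stores n ρ [plainLabel G, relTable (NearRecog G), relTable (Known G), setTable (Settled G),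
      setTable (IsGate G), setTable (InCore G)] (St.recognize.run σ) := by
  have hL := h0.layout
  have hn : ρ 1 = n := hL.order
  have hall := fun (x : ℕ) (e : Ex) (ρ' m : ℕ → ℕ) (h : ρ' 1 = n) => Ex.T_all (x := x) (e := e)
    (m := m) h
  have hex := fun (x : ℕ) (e : Ex) (ρ' m : ℕ → ℕ) (h : ρ' 1 = n) => Ex.T_ex (x := x) (e := e)
    (m := m) h
  have h1 := h0.fill (t := 1) rfl (by omega)
    (e := .bool (.ex 34 (.or (.recog 30 34 32) (.recog 30 32 34)))) (relTable (NearRecog G)) (by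
      intro m hm i j
      have a0 : ∀ x y : Fin n, 0 < m (ρ 10 + (x * n + y)) ↔ G.Adj x y :=
        hL.pos_tab (by omega) (hm 0 _ rfl)
      rw [Ex.eval_bool]
      refine if_congr ?_ rfl rfl
      rw [hex _ _ _ _ (by simp [bindVar_apply, hn])]
      refine exists_congr fun v => ?_
      rw [Ex.T_or]
      refine or_congr ?_ ?_ <;>
      simp [Ex.recog, Ex.side, Ex.otherSide, Ex.T_and, Ex.T_or, Ex.T_not, Ex.T_imp, Ex.T_iff,
        Ex.T_tab, Ex.T_same, hall, hex, bindVar_apply, hn, a0, Fin.val_inj, Recog, Side, OtherSide])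
  have h2 := h1.fill (t := 2) rfl (by omega) (e := .bool .known) (relTable (Known G)) (by
      intro m hm i j
      have a0 : ∀ x y : Fin n, 0 < m (ρ 10 + (x * n + y)) ↔ G.Adj x y :=
        hL.pos_tab (by omega) (hm 0 _ rfl)
      have a1 : ∀ x y : Fin n, 0 < m (ρ 11 + (x * n + y)) ↔ NearRecog G x y :=
        hL.pos_tab (by omega) (hm 1 _ rfl)
      rw [Ex.eval_bool]
      refine if_congr ?_ rfl rfl
      simp [Ex.known, Ex.T_and, Ex.T_or, Ex.T_not, Ex.T_iff, Ex.T_tab, Ex.T_same, hall, hex,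
        bindVar_apply, hn, a0, a1, Fin.val_inj, Known])
  have h3 := h2.fill (t := 3) rfl (by omega) (e := .bool (.ex 34 (.tab 2 32 34)))
    (setTable (Settled G)) (by
      intro m hm i j
      have a2 : ∀ x y : Fin n, 0 < m (ρ 12 + (x * n + y)) ↔ Known G x y :=
        hL.pos_tab (by omega) (hm 2 _ rfl)
      rw [Ex.eval_bool]
      refine if_congr ?_ rfl rfl
      simp [Ex.T_tab, hex, bindVar_apply, hn, a2, Settled])
  have h4 := h3.fill (t := 4) rfl (by omega)
    (e := .bool (.and (.row 3 32) (.ex 34 (.and (.not (.row 3 34)) (.tab 2 32 34)))))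
    (setTable (IsGate G)) (by
      intro m hm i j
      have a2 : ∀ x y : Fin n, 0 < m (ρ 12 + (x * n + y)) ↔ Known G x y :=
        hL.pos_tab (by omega) (hm 2 _ rfl)
      have a3 : ∀ x : Fin n, 0 < m (ρ 13 + x) ↔ Settled G x :=
        hL.pos_row (by omega) (hm 3 _ rfl)
      rw [Ex.eval_bool]
      refine if_congr ?_ rfl rfl
      simp [Ex.T_and, Ex.T_not, Ex.T_tab, Ex.T_row, hex, bindVar_apply, hn, a2, a3, IsGate])
  exact h4.fill (t := 5) rfl (by omega) (e := .bool (.or (.not (.row 3 32)) (.row 4 32)))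
    (setTable (InCore G)) (by
      intro m hm i j
      have a3 : ∀ x : Fin n, 0 < m (ρ 13 + x) ↔ Settled G x :=
        hL.pos_row (by omega) (hm 3 _ rfl)
      have a4 : ∀ x : Fin n, 0 < m (ρ 14 + x) ↔ IsGate G x :=
        hL.pos_row (by omega) (hm 4 _ rfl)
      rw [Ex.eval_bool]
      refine if_congr ?_ rfl rfl
      simp [Ex.T_or, Ex.T_not, Ex.T_row, bindVar_apply, a3, a4, InCore])

def Ex.knownEdge (x y : ℕ) : Ex := .or (.tab 2 x y) (.tab 2 y x)

def Ex.coreAdj : Ex :=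
  .and (.row 5 30) (.and (.row 5 32) (.or
    (.and (.not (.and (.row 3 30) (.row 3 32))) (.tab 0 30 32))
    (.and (.row 3 30) (.and (.row 3 32) (.knownEdge 30 32)))))

/-- The tables of the adjacency and the reachability in the core, and of the first gates of the
components. -/
def St.components : St :=
  .seq (.fillAt 16 (.bool .coreAdj)) (.seq (.closure 6 7)
    (.fillAt 18 (.bool (.and (.row 4 32) (.all 34 (.imp (.row 4 34) (.imp (.tab 7 32 34)
      (.not (.lt (.var 34) (.var 32))))))))))

theorem run_components {n : ℕ} {G : SimpleGraph (Fin n)} {ρ : ℕ → ℕ} {σ : State}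
    (h0 : Stores n ρ [plainLabel G, relTable (NearRecog G), relTable (Known G),
      setTable (Settled G), setTable (IsGate G), setTable (InCore G)] σ) :
    Stores n ρ [plainLabel G, relTable (NearRecog G), relTable (Known G), setTable (Settled G),
      setTable (IsGate G), setTable (InCore G), plainLabel (coreGraph G),
      relTable (coreGraph G).Reachable, setTable (IsRep G)] (St.components.run σ) := by
  have hL := h0.layout
  have hn : ρ 1 = n := hL.order
  have hall := fun (x : ℕ) (e : Ex) (ρ' m : ℕ → ℕ) (h : ρ' 1 = n) => Ex.T_all (x := x) (e := e)
    (m := m) h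
  have h1 := h0.fill (t := 6) rfl (by omega) (e := .bool .coreAdj) (plainLabel (coreGraph G)) (by
      intro m hm i j
      have a0 : ∀ x y : Fin n, 0 < m (ρ 10 + (x * n + y)) ↔ G.Adj x y :=
        hL.pos_tab (by omega) (hm 0 _ rfl)
      have a2 : ∀ x y : Fin n, 0 < m (ρ 12 + (x * n + y)) ↔ Known G x y :=
        hL.pos_tab (by omega) (hm 2 _ rfl)
      have a3 : ∀ x : Fin n, 0 < m (ρ 13 + x) ↔ Settled G x :=
        hL.pos_row (by omega) (hm 3 _ rfl)
      have a5 : ∀ x : Fin n, 0 < m (ρ 15 + x) ↔ InCore G x :=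
        hL.pos_row (by omega) (hm 5 _ rfl)
      rw [Ex.eval_bool]
      refine if_congr ?_ rfl rfl
      simp [Ex.coreAdj, Ex.knownEdge, Ex.T_and, Ex.T_or, Ex.T_not, Ex.T_tab, Ex.T_row,
        bindVar_apply, a0, a2, a3, a5, coreGraph, KnownEdge])
  have h2 := h1.closure (t := 7) (a := 6) rfl (by omega) (A := coreGraph G) rfl
  exact h2.fill (t := 8) rfl (by omega) (e := .bool (.and (.row 4 32) (.all 34 (.imp (.row 4 34)
    (.imp (.tab 7 32 34) (.not (.lt (.var 34) (.var 32)))))))) (setTable (IsRep G)) (by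
      intro m hm i j
      have a4 : ∀ x : Fin n, 0 < m (ρ 14 + x) ↔ IsGate G x :=
        hL.pos_row (by omega) (hm 4 _ rfl)
      have a7 : ∀ x y : Fin n, 0 < m (ρ 17 + (x * n + y)) ↔ (coreGraph G).Reachable x y :=
        hL.pos_tab (by omega) (hm 7 _ rfl)
      rw [Ex.eval_bool]
      refine if_congr ?_ rfl rfl
      simp [Ex.T_and, Ex.T_imp, Ex.T_not, Ex.T_tab, Ex.T_row, Ex.T_lt, Ex.eval_var, hall,
        bindVar_apply, hn, a4, a7, IsRep])

def Ex.kernelAdj : Ex :=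
  .or (.and (.not (.and (.row 3 30) (.row 3 32))) (.tab 0 30 32))
    (.and (.row 3 30) (.and (.row 3 32) (.and (.not (.same 30 32)) (.or (.knownEdge 30 32)
      (.or (.ex 34 (.and (.row 5 34) (.and (.knownEdge 30 34) (.knownEdge 34 32))))
        (.and (.row 8 30) (.row 8 32)))))))

def Ex.coreLabel : Ex :=
  .ite (.knownEdge 30 32) (.lit 2) (.ite .kernelAdj (.ite (.or (.row 3 30) (.row 3 32)) (.lit 3)
    (.lit 1)) (.lit 0))

/-- The tables of the labels of the kernel, and of the positions of the core vertices. -/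
def St.labels : St :=
  .seq (.fillAt 19 .coreLabel)
    (.seq (.fillAt 20 (.ite (.row 8 32) (.lit 2)
      (.ite (.ex 34 (.and (.row 8 34) (.knownEdge 32 34))) (.lit 3) (.lit 0))))
    (.seq (.fillAt 21 (.ite (.row 8 32) (.lit 3) (.lit 0)))
    (.seq (.fillAt 22 (.member 5 (.var 34))) (.fillAt 23 (.member 5 (.var 35))))))

/-- The table that contains the values of `g` on a set in the order of its members. -/
noncomputable def memberTable {n : ℕ} (P : Fin n → Prop) (g : Fin n → ℕ) (_ j : Fin n) : ℕ :=
  ∑ x, if P x ∧ (∑ j, if P j ∧ j.val < x.val then 1 else 0) = j.val then g x else 0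

/-- The tables that describe the kernel. -/
noncomputable def kernelTables {n : ℕ} (G : SimpleGraph (Fin n)) : List (Fin n → Fin n → ℕ) :=
  [plainLabel G, relTable (NearRecog G), relTable (Known G), setTable (Settled G),
    setTable (IsGate G), setTable (InCore G), plainLabel (coreGraph G),
    relTable (coreGraph G).Reachable, setTable (IsRep G), coreLabel G,
    fun _ j => gadgetLabel G j 0, fun _ j => gadgetLabel G j 1,
    memberTable (InCore G) fun x => x, memberTable (InCore G) fun x => x * n]

/-- A gadget label depends only on whether the gadget vertex is the first one, so two tables suffice
for the whole gadget. -/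
theorem run_labels {n : ℕ} {G : SimpleGraph (Fin n)} {ρ : ℕ → ℕ} {σ : State}
    (h0 : Stores n ρ [plainLabel G, relTable (NearRecog G), relTable (Known G),
      setTable (Settled G), setTable (IsGate G), setTable (InCore G), plainLabel (coreGraph G),
      relTable (coreGraph G).Reachable, setTable (IsRep G)] σ) :
    Stores n ρ (kernelTables G) (St.labels.run σ) := by
  have hL := h0.layout
  have hn : ρ 1 = n := hL.order
  have hex := fun (x : ℕ) (e : Ex) (ρ' m : ℕ → ℕ) (h : ρ' 1 = n) => Ex.T_ex (x := x) (e := e)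
    (m := m) h
  have h1 := h0.fill (t := 9) rfl (by omega) (e := .coreLabel) (coreLabel G) (by
      intro m hm i j
      have a0 : ∀ x y : Fin n, 0 < m (ρ 10 + (x * n + y)) ↔ G.Adj x y :=
        hL.pos_tab (by omega) (hm 0 _ rfl)
      have a2 : ∀ x y : Fin n, 0 < m (ρ 12 + (x * n + y)) ↔ Known G x y :=
        hL.pos_tab (by omega) (hm 2 _ rfl)
      have a3 : ∀ x : Fin n, 0 < m (ρ 13 + x) ↔ Settled G x :=
        hL.pos_row (by omega) (hm 3 _ rfl)
      have a5 : ∀ x : Fin n, 0 < m (ρ 15 + x) ↔ InCore G x :=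
        hL.pos_row (by omega) (hm 5 _ rfl)
      have a8 : ∀ x : Fin n, 0 < m (ρ 18 + x) ↔ IsRep G x :=
        hL.pos_row (by omega) (hm 8 _ rfl)
      simp only [Ex.coreLabel, Ex.eval_ite, Ex.eval_lit, coreLabel]
      refine if_congr ?_ rfl (if_congr ?_ (if_congr ?_ rfl rfl) rfl) <;>
      simp [Ex.kernelAdj, Ex.knownEdge, Ex.T_and, Ex.T_or, Ex.T_not, Ex.T_tab, Ex.T_row,
        Ex.T_same, hex, hn, bindVar_apply, a0, a2, a3, a5, a8, KernelAdj, KnownEdge, Fin.val_inj])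
  have h2 := h1.fill (t := 10) rfl (by omega) (e := .ite (.row 8 32) (.lit 2)
      (.ite (.ex 34 (.and (.row 8 34) (.knownEdge 32 34))) (.lit 3) (.lit 0)))
      (fun _ j => gadgetLabel G j 0) (by
      intro m hm i j
      have a2 : ∀ x y : Fin n, 0 < m (ρ 12 + (x * n + y)) ↔ Known G x y :=
        hL.pos_tab (by omega) (hm 2 _ rfl)
      have a8 : ∀ x : Fin n, 0 < m (ρ 18 + x) ↔ IsRep G x :=
        hL.pos_row (by omega) (hm 8 _ rfl)
      simp only [Ex.eval_ite, Ex.eval_lit, gadgetLabel, if_true]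
      refine if_congr ?_ rfl (if_congr ?_ rfl rfl) <;>
      simp [Ex.knownEdge, Ex.T_and, Ex.T_or, Ex.T_tab, Ex.T_row, hex, hn, bindVar_apply, a2, a8,
        KnownEdge])
  have h3 := h2.fill (t := 11) rfl (by omega) (e := .ite (.row 8 32) (.lit 3) (.lit 0))
      (fun _ j => gadgetLabel G j 1) (by
      intro m hm i j
      have a8 : ∀ x : Fin n, 0 < m (ρ 18 + x) ↔ IsRep G x :=
        hL.pos_row (by omega) (hm 8 _ rfl)
      simp only [Ex.eval_ite, Ex.eval_lit, gadgetLabel]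
      simp [Ex.T_row, bindVar_apply, a8])
  have h4 := h3.fill (t := 12) rfl (by omega) (e := .member 5 (.var 34))
    (memberTable (InCore G) fun x => x) (by
      intro m hm i j
      exact Ex.eval_member hL (by omega) (hm 5 _ rfl) i j
        fun x => by simp [Ex.eval_var, bindVar_apply])
  exact h4.fill (t := 13) rfl (by omega) (e := .member 5 (.var 35))
    (memberTable (InCore G) fun x => x * n) (by
      intro m hm i j
      exact Ex.eval_member hL (by omega) (hm 5 _ rfl) i j
        fun x => by simp [Ex.eval_var, bindVar_apply])

end KernelTables

end TreePlusK

namespace TreePlusK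
open scoped Classical

/-! ### The kernel as a program -/

section Kernel

/-- A symmetric matrix of labels, with zero diagonal, of a connected graph. -/
structure IsLabelling {V : Type*} (ℓ : V → V → ℕ) : Prop where
  symm : ∀ x y, ℓ x y = ℓ y x
  self : ∀ x, ℓ x x = 0
  le : ∀ x y, ℓ x y ≤ 3
  connected : (labelGraph ℓ symm self).Connected

theorem isLabelling_plainLabel {V : Type*} {G : SimpleGraph V} (hG : G.Connected) :
    IsLabelling (plainLabel G) := by
  have hs : ∀ x y, plainLabel G x y = plainLabel G y x := fun x y => by
    unfold plainLabel; rw [G.adj_comm]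
  have h0 : ∀ x, plainLabel G x x = 0 := fun x => by simp [plainLabel]
  refine ⟨hs, h0, fun x y => ?_, ?_⟩
  · unfold plainLabel
    split_ifs <;> omega
  · have : labelGraph (plainLabel G) hs h0 = G := by
      ext x y
      simp [labelGraph, plainLabel]
    rwa [this]

theorem IsLabelling.comap {V W : Type*} {ℓ : W → W → ℕ} (h : IsLabelling ℓ) (e : V ≃ W) :
    IsLabelling fun x y => ℓ (e x) (e y) := by
  refine ⟨fun x y => h.symm _ _, fun x => h.self _, fun x y => h.le _ _, ?_⟩
  exact (SimpleGraph.Iso.comap e (labelGraph ℓ h.symm h.self)).connected_iff.2 h.connected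

theorem Consistent.isLabelling {V : Type*} [LinearOrder V] {G : SimpleGraph V} (h : Consistent G)
    (δ : ℕ) : IsLabelling (kernelLabel G δ) :=
  ⟨kernelLabel_symm G δ, kernelLabel_self G δ, kernelLabel_le G δ, h.connected δ⟩

/-- The path with three vertices, which has no square root. -/
def cherry : SimpleGraph (Fin 3) where
  Adj i j := ¬ (i = 1 ↔ j = 1)
  symm := ⟨fun _ _ h h' => h h'.symm⟩
  loopless := ⟨fun _ h => h Iff.rfl⟩

theorem cherry_connected : cherry.Connected := by
  have h : ∀ x, cherry.Reachable x 1 := by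
    intro x
    by_cases hx : x = 1
    · rw [hx]
    · exact SimpleGraph.Adj.reachable (show ¬ (x = 1 ↔ (1 : Fin 3) = 1) by simpa using hx)
  exact SimpleGraph.Connected.mk fun x y => (h x).trans (h y).symm

/-- As the ends of the path are not adjacent in the square, both edges of the path must belong to
the root, which puts the ends at distance two. -/
theorem not_solvable_cherry (k : ℕ) : ¬ Solvable (plainLabel cherry) k := by
  rw [solvable_plainLabel]
  rintro ⟨H, h, -⟩
  rw [square_eq_iff] at h
  have h02 : ¬ WithinTwo H 0 2 := fun hc => by
    have := (h 0 2 (by decide)).2 hc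
    simp [cherry] at this
  have h01 : WithinTwo H 0 1 := (h 0 1 (by decide)).1 (by simp [cherry])
  have h12 : WithinTwo H 1 2 := (h 1 2 (by decide)).1 (by simp [cherry])
  have key : ∀ c : Fin 3, c = 0 ∨ c = 1 ∨ c = 2 := by decide
  have e01 : H.Adj 0 1 := by
    rcases h01 with h | ⟨c, h1, h2⟩
    · exact h
    · rcases key c with rfl | rfl | rfl
      · exact absurd h1 (H.irrefl)
      · exact h1
      · exact absurd (Or.inl h1) h02
  have e12 : H.Adj 1 2 := by
    rcases h12 with h | ⟨c, h1, h2⟩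
    · exact h
    · rcases key c with rfl | rfl | rfl
      · exact absurd (Or.inl h2) h02
      · exact h2
      · exact absurd h2 (H.irrefl)
  exact h02 (Or.inr ⟨1, e01, e12⟩)

/-- Write constants to consecutive memory cells. -/
def St.write : ℕ → List ℕ → St
  | _, [] => .skip
  | a, v :: l => .seq (.put (.lit a) (.lit v)) (St.write (a + 1) l)

/-- Output the path with three vertices. -/
def St.refuse : St := .seq (.write 2 [0, 1, 0, 1, 0, 1, 0, 1, 0]) (.seq (.put (.lit 0) (.lit 3))
  (.put (.lit 1) (.var 2)))

theorem run_refuse {σ : State} : Matrix 3 (σ.reg 2) (plainLabel cherry) (St.refuse.run σ).mem := by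
  refine ⟨?_, ?_, ?_⟩
  · simp [St.refuse, St.write, St.run, State.setMem, Ex.eval]
  · simp [St.refuse, St.write, St.run, State.setMem, Ex.eval]
  · intro i j
    fin_cases i <;> fin_cases j <;>
      simp [St.refuse, St.write, St.run, State.setMem, Ex.eval, plainLabel, cherry]

def Ex.times : ℕ → Ex → Ex
  | 0, _ => .lit 0
  | c + 1, e => .add e (Ex.times c e)

theorem Ex.eval_times (c : ℕ) (e : Ex) (ρ m : ℕ → ℕ) :
    (Ex.times c e).eval ρ m = c * e.eval ρ m := by
  induction c with
  | zero => simp [Ex.times, Ex.eval]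
  | succ c ih => rw [Ex.times, Ex.eval_add, ih]; ring

def Ex.squareCheck : Ex :=
  .all 30 (.all 32 (.or (.same 30 32) (.or
    (.and (.row 5 30) (.and (.row 5 32) (.not (.and (.row 3 30) (.row 3 32)))))
    (.iff (.tab 0 30 32) (.or (.knownEdge 30 32)
      (.ex 34 (.and (.knownEdge 30 34) (.knownEdge 34 32))))))))

def Ex.reachCheck : Ex :=
  .all 30 (.imp (.row 5 30) (.ex 32 (.and (.row 8 32) (.tab 7 30 32))))

/-- The kernel exists and is small. -/
def Ex.kernelCheck : Ex :=
  .and (.eq (.add (.add (.var 8) (.var 8)) (.add (.add (.var 1) (.var 1)) (.add (.var 7) (.var 7))))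
      (.add (.add (.var 6) (.lit 2)) (.add (.var 5) (.var 5))))
    (.and (.and .squareCheck .reachCheck) (.not (.lt (.var 4) (.add (.var 5) (.add (.var 8) (.lit 2))))))

/-- An entry of the matrix of the kernel. -/
def Ex.kernelEntry : Ex :=
  .ite (.lt (.var 30) (.var 9))
    (.ite (.lt (.var 32) (.var 9))
      (.ld (.add (.var 19) (.add (.ld (.add (.var 23) (.var 30))) (.ld (.add (.var 22) (.var 32))))))
      (.ite (.lt (.var 9) (.var 32)) (.ld (.add (.var 21) (.ld (.add (.var 22) (.var 30)))))
        (.ld (.add (.var 20) (.ld (.add (.var 22) (.var 30)))))))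
    (.ite (.lt (.var 32) (.var 9))
      (.ite (.lt (.var 9) (.var 30)) (.ld (.add (.var 21) (.ld (.add (.var 22) (.var 32)))))
        (.ld (.add (.var 20) (.ld (.add (.var 22) (.var 32))))))
      (.ite (.same 30 32) (.lit 0) (.ite (.or (.lt (.var 30) (.add (.var 9) (.lit 2)))
        (.lt (.var 32) (.add (.var 9) (.lit 2)))) (.lit 2) (.lit 3))))

/-- The numbers of core vertices, of known edges outside the core, and of gates that are first in
their components, and the size of the gadget. -/
def St.sizes : St :=
  .seq (.set 5 (.sum 30 (.bool (.row 5 30))))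
    (.seq (.set 6 (.sum 30 (.sum 32 (.bool (.and (.knownEdge 30 32)
      (.not (.and (.row 5 30) (.row 5 32))))))))
    (.seq (.set 7 (.sum 30 (.bool (.row 8 30))))
      (.set 8 (.half (.sub (.add (.add (.var 6) (.lit 2)) (.add (.var 5) (.var 5)))
        (.add (.add (.var 1) (.var 1)) (.add (.var 7) (.var 7))))))))

/-- Output the kernel that is described by the tables. -/
def St.emitKernel : St :=
  .seq (.set 9 (.var 5)) (.seq (.set 5 (.add (.var 5) (.add (.var 8) (.lit 2)))) (.emit .kernelEntry))

def St.analyse : St := .seq .recognize (.seq .components (.seq .labels .sizes))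

/-- Output the kernel if it exists, and a graph without a square root otherwise. -/
def St.shrink : St := .seq .analyse (.ite .kernelCheck .emitKernel .refuse)

/-- Replace a large matrix by its kernel. -/
def St.kernelRule : St :=
  .seq (.set 1 (.ld (.lit 0))) (.seq .setup (.ite (.lt (.var 2) (.var 1))
    (.seq (.set 6 (.sum 30 (.ite (.lt (.var 30) (.var 2)) (.var 2) (.lit 0))))
      (.seq (.set 4 (.add (.times 36 (.var 6)) (.add (.times 26 (.var 2)) (.lit 8))))
        (.ite (.lt (.var 4) (.var 1)) .shrink .skip))) .skip))

theorem Stores.set_eq {n x v : ℕ} {ρ : ℕ → ℕ} {L : List (Fin n → Fin n → ℕ)} {σ : State}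
    (h : Stores n ρ L σ) (hx : x ≠ 1 ∧ x < 10) {e : Ex} (hv : e.eval ρ σ.mem = v) :
    Stores n (Function.update ρ x v) L ((St.set x e).run σ) := hv ▸ h.set hx

variable {n k : ℕ} {G : SimpleGraph (Fin n)} {ρ : ℕ → ℕ} {σ : State}

theorem run_sizes (h0 : Stores n ρ (kernelTables G) σ) :
    ∃ ρ', Stores n ρ' (kernelTables G) (St.sizes.run σ) ∧ ρ' 2 = ρ 2 ∧ ρ' 4 = ρ 4 ∧
      ρ' 5 = Fintype.card {x // InCore G x} ∧ ρ' 6 = outCount G ∧ ρ' 7 = repCount G ∧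
      ρ' 8 = (outCount G + 2 + 2 * Fintype.card {x // InCore G x} - (2 * n + 2 * repCount G)) / 2 := by
  have hL := h0.layout
  have hsum := fun (x : ℕ) (e : Ex) (ρ' m : ℕ → ℕ) (h : ρ' 1 = n) => Ex.eval_sum (x := x) (e := e)
    (m := m) h
  have row5 : ∀ {ρ'}, Layout n ρ' → ∀ x : Fin n, 0 < σ.mem (ρ' 15 + x) ↔ InCore G x :=
    fun h => h.pos_row (by omega) (h0.tabs 5 _ rfl)
  have row8 : ∀ {ρ'}, Layout n ρ' → ∀ x : Fin n, 0 < σ.mem (ρ' 18 + x) ↔ IsRep G x :=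
    fun h => h.pos_row (by omega) (h0.tabs 8 _ rfl)
  have tab2 : ∀ {ρ'}, Layout n ρ' → ∀ x y : Fin n,
      0 < σ.mem (ρ' 12 + (x * n + y)) ↔ Known G x y :=
    fun h => h.pos_tab (by omega) (h0.tabs 2 _ rfl)
  have h1 := h0.set_eq (x := 5) (v := Fintype.card {x // InCore G x})
    (e := .sum 30 (.bool (.row 5 30))) (by omega) (by
      rw [hsum _ _ _ _ hL.order, Fintype.card_subtype, Finset.card_filter]
      refine Finset.sum_congr rfl fun x _ => ?_
      rw [Ex.eval_bool]
      refine if_congr ?_ rfl rfl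
      simp [Ex.T_row, bindVar_apply, row5 hL])
  set ρ1 := Function.update ρ 5 _ with hρ1
  have h2 := h1.set_eq (x := 6) (v := outCount G) (e := .sum 30 (.sum 32 (.bool
      (.and (.knownEdge 30 32) (.not (.and (.row 5 30) (.row 5 32))))))) (by omega) (by
      have hn := h1.layout.order
      rw [hsum _ _ _ _ hn]
      refine Finset.sum_congr rfl fun x _ => ?_
      rw [hsum _ _ _ _ (by simp [bindVar_apply, hn])]
      refine Finset.sum_congr rfl fun y _ => ?_
      rw [Ex.eval_bool]
      refine if_congr ?_ rfl rfl
      change Ex.T _ _ σ.mem ↔ _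
      simp [Ex.T_row, Ex.T_tab, Ex.knownEdge, Ex.T_and, Ex.T_not, Ex.T_or, bindVar_apply,
        row5 h1.layout, tab2 h1.layout, KnownEdge])
  set ρ2 := Function.update ρ1 6 _ with hρ2
  have h3 := h2.set_eq (x := 7) (v := repCount G)
    (e := .sum 30 (.bool (.row 8 30))) (by omega) (by
      rw [hsum _ _ _ _ h2.layout.order, repCount, Finset.card_filter]
      refine Finset.sum_congr rfl fun x _ => ?_
      rw [Ex.eval_bool]
      refine if_congr ?_ rfl rfl
      change Ex.T _ _ σ.mem ↔ _
      simp [Ex.T_row, bindVar_apply, row8 h2.layout])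
  set ρ3 := Function.update ρ2 7 _ with hρ3
  have h4 := h3.set (x := 8) (e := .half (.sub (.add (.add (.var 6) (.lit 2)) (.add (.var 5) (.var 5)))
    (.add (.add (.var 1) (.var 1)) (.add (.var 7) (.var 7))))) (by omega)
  have hn := h3.layout.order
  refine ⟨_, h4, ?_, ?_, ?_, ?_, ?_, ?_⟩
  · simp [hρ3, hρ2, hρ1]
  · simp [hρ3, hρ2, hρ1]
  · simp [hρ3, hρ2, hρ1]
  · simp [hρ3, hρ2, hρ1]
  · simp [hρ3, hρ2, hρ1]
  · rw [Function.update_self]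
    simp only [Ex.eval, hn]
    have e5 : ρ3 5 = Fintype.card {x // InCore G x} := by simp [hρ3, hρ2, hρ1]
    have e6 : ρ3 6 = outCount G := by simp [hρ3, hρ2]
    have e7 : ρ3 7 = repCount G := by simp [hρ3]
    rw [e5, e6, e7]
    congr 1
    omega

/-- The first equation tests that nothing was lost in the cut-off subtraction and the halving that
computed the size of the gadget. -/
theorem kernelCheck_iff (h0 : Stores n ρ (kernelTables G) σ) {c o r d b : ℕ} (h4 : ρ 4 = b)
    (h5 : ρ 5 = c) (h6 : ρ 6 = o) (h7 : ρ 7 = r) (h8 : ρ 8 = d) :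
    Ex.kernelCheck.T σ.reg σ.mem ↔
      2 * d + 2 * n + 2 * r = o + 2 + 2 * c ∧ Consistent G ∧ c + (d + 2) ≤ b := by
  have hL := h0.layout
  have hn : ρ 1 = n := hL.order
  have hall := fun (x : ℕ) (e : Ex) (ρ' m : ℕ → ℕ) (h : ρ' 1 = n) => Ex.T_all (x := x) (e := e)
    (m := m) h
  have hex := fun (x : ℕ) (e : Ex) (ρ' m : ℕ → ℕ) (h : ρ' 1 = n) => Ex.T_ex (x := x) (e := e)
    (m := m) h
  have a0 : ∀ x y : Fin n, 0 < σ.mem (ρ 10 + (x * n + y)) ↔ G.Adj x y :=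
    hL.pos_tab (by omega) (h0.tabs 0 _ rfl)
  have a2 : ∀ x y : Fin n, 0 < σ.mem (ρ 12 + (x * n + y)) ↔ Known G x y :=
    hL.pos_tab (by omega) (h0.tabs 2 _ rfl)
  have a3 : ∀ x : Fin n, 0 < σ.mem (ρ 13 + x) ↔ Settled G x :=
    hL.pos_row (by omega) (h0.tabs 3 _ rfl)
  have a5 : ∀ x : Fin n, 0 < σ.mem (ρ 15 + x) ↔ InCore G x :=
    hL.pos_row (by omega) (h0.tabs 5 _ rfl)
  have a7 : ∀ x y : Fin n, 0 < σ.mem (ρ 17 + (x * n + y)) ↔ (coreGraph G).Reachable x y :=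
    hL.pos_tab (by omega) (h0.tabs 7 _ rfl)
  have a8 : ∀ x : Fin n, 0 < σ.mem (ρ 18 + x) ↔ IsRep G x :=
    hL.pos_row (by omega) (h0.tabs 8 _ rfl)
  rw [h0.reg, Ex.kernelCheck, Ex.T_and, Ex.T_and, Ex.T_and, Ex.T_not, Ex.T_lt, Ex.T_eq]
  refine and_congr ?_ (and_congr ?_ ?_)
  · simp only [Ex.eval, hn, h5, h6, h7, h8]
    omega
  · have e1 : Ex.squareCheck.T ρ σ.mem ↔ ∀ a b, a = b ∨ ((InCore G a ∧ InCore G b ∧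
        ¬ (Settled G a ∧ Settled G b)) ∨
        (G.Adj a b ↔ KnownEdge G a b ∨ ∃ c, KnownEdge G a c ∧ KnownEdge G c b)) := by
      simp [Ex.squareCheck, Ex.knownEdge, Ex.T_and, Ex.T_or, Ex.T_not, Ex.T_iff, Ex.T_tab,
        Ex.T_row, Ex.T_same, hall, hex, bindVar_apply, hn, a0, a2, a3, a5, KnownEdge, Fin.val_inj]
    have e2 : Ex.reachCheck.T ρ σ.mem ↔ ∀ s, InCore G s →
        ∃ r, IsRep G r ∧ (coreGraph G).Reachable s r := by
      simp [Ex.reachCheck, Ex.T_and, Ex.T_imp, Ex.T_tab, Ex.T_row, hall, hex, bindVar_apply, hn,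
        a5, a7, a8]
    rw [e1, e2]
    constructor
    · rintro ⟨q1, q2⟩
      exact ⟨fun a b hab hs => ((q1 a b).resolve_left hab).resolve_left hs, q2⟩
    · rintro ⟨q1, q2⟩
      exact ⟨fun a b => or_iff_not_imp_left.2 fun hab => or_iff_not_imp_left.2 fun hs =>
        q1 a b hab hs, q2⟩
  · simp only [Ex.eval, h4, h5, h8]
    omega

/-- Core vertices come first in increasing order, then the gadget. Register `9` keeps the number of
core vertices, because register `5` has to hold the new order. -/
theorem run_emitKernel (h0 : Stores n ρ (kernelTables G) σ) {c d : ℕ} (hk : ρ 2 = k) (h5 : ρ 5 = c)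
    (h8 : ρ 8 = d) (hc : Fintype.card {x // InCore G x} = c) (hcn : c + (d + 2) ≤ n) :
    ∃ e : Fin (c + (d + 2)) ≃ {x // InCore G x} ⊕ Fin (d + 2),
      Matrix (c + (d + 2)) k (fun i j => kernelLabel G d (e i) (e j))
        (St.emitKernel.run σ).mem := by
  obtain ⟨e, he⟩ := exists_enumeration (c := c) (InCore G) (by
    rw [← hc, Fintype.card_subtype, Finset.card_filter])
  refine ⟨finSumFinEquiv.symm.trans (e.sumCongr (Equiv.refl _)), ?_⟩
  have h1 := h0.set_eq (x := 9) (v := c) (e := .var 5) (by omega) (by rw [Ex.eval_var, h5])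
  have h2 := h1.set_eq (x := 5) (v := c + (d + 2)) (e := .add (.var 5) (.add (.var 8) (.lit 2)))
    (by omega) (by simp [Ex.eval, h5, h8])
  set ρ2 := Function.update (Function.update ρ 9 c) 5 (c + (d + 2)) with hρ2
  have r9 : ρ2 9 = c := by simp [hρ2]
  have r5 : ρ2 5 = c + (d + 2) := by simp [hρ2]
  have r2 : ρ2 2 = k := by simp [hρ2, hk]
  clear_value ρ2
  refine h2.emit r5 r2 hcn ?_
  intro m hm i j
  have hL := h2.layout
  have d9 := hL.base 9 (by omega)
  have d10 := hL.base 10 (by omega)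
  have d11 := hL.base 11 (by omega)
  have d12 := hL.base 12 (by omega)
  have d13 := hL.base 13 (by omega)
  simp only [Nat.reduceAdd] at d9 d10 d11 d12 d13
  have t9 : ∀ x y : Fin n, m (2 + 9 * (n * n) + (x * n + y)) = coreLabel G x y :=
    hm 9 _ (by omega) rfl
  have t10 : ∀ x : Fin n, m (2 + 10 * (n * n) + x) = gadgetLabel G x 0 :=
    fun x => (hm 10 _ (by omega) rfl).row x
  have t11 : ∀ x : Fin n, m (2 + 11 * (n * n) + x) = gadgetLabel G x 1 :=
    fun x => (hm 11 _ (by omega) rfl).row x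
  have t12 : ∀ a : Fin c, m (2 + 12 * (n * n) + a) = (e a).1 := fun a =>
    ((hm 12 (memberTable (InCore G) fun x => x) (by omega) rfl).row ⟨a, by omega⟩).trans
      (he a fun x => x)
  have t13 : ∀ a : Fin c, m (2 + 13 * (n * n) + a) = (e a).1 * n := fun a =>
    ((hm 13 (memberTable (InCore G) fun x => x * n) (by omega) rfl).row ⟨a, by omega⟩).trans
      (he a fun x => x * n)
  have hpos : ∀ (x : Fin n) (g : ℕ), 0 < g → gadgetLabel G x g = gadgetLabel G x 1 := by
    intro x g hg
    simp [gadgetLabel, hg.ne']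
  induction i using Fin.addCases with
  | left i =>
    induction j using Fin.addCases with
    | left j =>
      simp [Ex.kernelEntry, Ex.eval_ite, Ex.T_lt, Ex.eval_var, Ex.eval_ld, Ex.eval_add,
        bindVar_apply, r9, d9, d12, d13, t12, t13, t9, kernelLabel]
    | right j =>
      have hj : ¬ (c + j.val < c) := by omega
      by_cases hj0 : j.val = 0
      · simp [Ex.kernelEntry, Ex.eval_ite, Ex.T_lt, Ex.eval_var, Ex.eval_ld, Ex.eval_add,
          bindVar_apply, r9, d10, d12, t12, t10, kernelLabel, hj0]
      · have := hpos (e i).1 j.val (by omega)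
        have hj1 : 0 < j.val := by omega
        simp [Ex.kernelEntry, Ex.eval_ite, Ex.T_lt, Ex.eval_var, Ex.eval_ld, Ex.eval_add,
          bindVar_apply, r9, d11, d12, t12, t11, kernelLabel, hj1, this]
  | right i =>
    induction j using Fin.addCases with
    | left j =>
      by_cases hi0 : i.val = 0
      · simp [Ex.kernelEntry, Ex.eval_ite, Ex.T_lt, Ex.eval_var, Ex.eval_ld, Ex.eval_add,
          bindVar_apply, r9, d10, d12, t12, t10, kernelLabel, hi0]
      · have := hpos (e j).1 i.val (by omega)
        have hi1 : 0 < i.val := by omega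
        simp [Ex.kernelEntry, Ex.eval_ite, Ex.T_lt, Ex.eval_var, Ex.eval_ld, Ex.eval_add,
          bindVar_apply, r9, d11, d12, t12, t11, kernelLabel, hi1, this]
    | right j =>
      simp [Ex.kernelEntry, Ex.eval_ite, Ex.T_lt, Ex.eval_var, Ex.eval_lit, Ex.eval_add,
        Ex.T_or, Ex.T_same, bindVar_apply, r9, kernelLabel]

/-- If the check fails, `kernel_of_solvable` shows that there is no solution, so the path with three
vertices is an equivalent instance. -/
theorem run_shrink (h0 : Stores n ρ [plainLabel G] σ) (hk : ρ 2 = k) (hb : ρ 4 = kernelBound k)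
    (hn : kernelBound k < n) (hG : G.Connected)
    (hT : ∀ T : Finset (Fin n), (∀ x ∈ T, ∀ y ∈ T, Twin G x y) → T.card ≤ 6 * k + 3) :
    ∃ (c : ℕ) (ℓ : Fin c → Fin c → ℕ), IsLabelling ℓ ∧ c ≤ kernelBound k ∧
      (Solvable ℓ k ↔ Solvable (plainLabel G) k) ∧ Matrix c k ℓ (St.shrink.run σ).mem := by
  obtain ⟨ρ', h1, r2, r4, r5, r6, r7, r8⟩ := run_sizes (run_labels (run_components (run_recognize h0)))
  have hrun : St.shrink.run σ = (St.ite .kernelCheck .emitKernel .refuse).run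
    (St.sizes.run (St.labels.run (St.components.run (St.recognize.run σ)))) := rfl
  rw [hrun]
  set τ := St.sizes.run (St.labels.run (St.components.run (St.recognize.run σ)))
  clear_value τ
  rw [hk] at r2
  rw [hb] at r4
  set δ := (outCount G + 2 + 2 * Fintype.card {x // InCore G x} - (2 * n + 2 * repCount G)) / 2
    with hδ
  have hcheck := kernelCheck_iff h1 r4 r5 r6 r7 r8
  rw [St.run]
  by_cases hc : Ex.kernelCheck.T τ.reg τ.mem
  · obtain ⟨q1, q2, q3⟩ := hcheck.1 hc
    rw [if_pos (show 0 < Ex.kernelCheck.eval τ.reg τ.mem from hc)]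
    obtain ⟨e, he⟩ := run_emitKernel h1 r2 r5 r8 rfl (q3.trans hn.le)
    refine ⟨_, _, (q2.isLabelling δ).comap e, q3, ?_, he⟩
    rw [solvable_comap_iff e]
    exact solvable_kernelLabel_iff q2 (by rw [Fintype.card_fin]; exact q1)
  · rw [if_neg (show ¬ 0 < Ex.kernelCheck.eval τ.reg τ.mem from hc)]
    refine ⟨3, plainLabel cherry, isLabelling_plainLabel cherry_connected, ?_, ?_, ?_⟩
    · unfold kernelBound
      omega
    · refine iff_of_false (not_solvable_cherry k) fun hs => hc (hcheck.2 ?_)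
      obtain ⟨q1, d, q2, q3⟩ := kernel_of_solvable hG hT (by rwa [Fintype.card_fin]) hs
      rw [Fintype.card_fin] at q3
      have : δ = d := by omega
      rw [this]
      exact ⟨q3, q1, q2⟩
    · have : τ.reg 2 = k := by rw [h1.reg, r2]
      rw [← this]
      exact run_refuse

/-- For `n ≤ k` the matrix is left as it is. Otherwise `k * k` can be computed by a loop of length
`n`, which adds up `k` in its first `k` rounds. -/
theorem run_kernelRule (h : Matrix n k (plainLabel G) σ.mem) (hG : G.Connected)
    (hT : ∀ T : Finset (Fin n), (∀ x ∈ T, ∀ y ∈ T, Twin G x y) → T.card ≤ 6 * k + 3) :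
    ∃ (c : ℕ) (ℓ : Fin c → Fin c → ℕ), IsLabelling ℓ ∧ (c ≤ k ∨ c ≤ kernelBound k) ∧
      (Solvable ℓ k ↔ Solvable (plainLabel G) k) ∧ Matrix c k ℓ (St.kernelRule.run σ).mem := by
  set τ := (St.set 1 (.ld (.lit 0))).run σ with hτ
  obtain ⟨ρ, hk, h0⟩ := stores_setup (σ := τ) (show Matrix n k (plainLabel G) τ.mem from h) (by
    simp [hτ, St.run, State.setReg, Ex.eval, h.order])
  have hmem : (St.setup.run τ).mem = σ.mem := (St.run_bases 19 _).1
  have hrun : St.kernelRule.run σ = (St.ite (.lt (.var 2) (.var 1))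
    (.seq (.set 6 (.sum 30 (.ite (.lt (.var 30) (.var 2)) (.var 2) (.lit 0))))
      (.seq (.set 4 (.add (.times 36 (.var 6)) (.add (.times 26 (.var 2)) (.lit 8))))
        (.ite (.lt (.var 4) (.var 1)) .shrink .skip))) .skip).run (St.setup.run τ) := rfl
  rw [hrun]
  set υ := St.setup.run τ with hυ
  clear_value υ
  have hn : ρ 1 = n := h0.layout.order
  have same : ∀ m : ℕ → ℕ, m = σ.mem → (n ≤ k ∨ n ≤ kernelBound k) →
      ∃ (c : ℕ) (ℓ : Fin c → Fin c → ℕ), IsLabelling ℓ ∧ (c ≤ k ∨ c ≤ kernelBound k) ∧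
      (Solvable ℓ k ↔ Solvable (plainLabel G) k) ∧ Matrix c k ℓ m := by
    rintro m rfl hle
    exact ⟨n, plainLabel G, isLabelling_plainLabel hG, hle, Iff.rfl, h⟩
  by_cases hkn : k < n
  swap
  · rw [St.run, if_neg (by simp only [Ex.lt, Ex.eval, h0.reg, hk, hn]; omega)]
    exact same _ hmem (Or.inl (by omega))
  rw [St.run, if_pos (by simp only [Ex.lt, Ex.eval, h0.reg, hk, hn]; omega)]
  have h1 := h0.set_eq (x := 6) (v := k * k)
    (e := .sum 30 (.ite (.lt (.var 30) (.var 2)) (.var 2) (.lit 0))) (by omega) (by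
      rw [Ex.eval_sum hn]
      have e1 : ∀ x : Fin n, (Ex.ite (.lt (.var 30) (.var 2)) (.var 2) (.lit 0)).eval
          (bindVar ρ 30 x n) υ.mem = if x.val < k then k else 0 := by
        intro x
        rw [Ex.eval_ite]
        simp [Ex.T_lt, Ex.eval, bindVar_apply, hk]
      simp only [e1]
      rw [← Finset.sum_filter, Finset.sum_const, smul_eq_mul, Fin.card_filter_val_lt,
        min_eq_right hkn.le])
  have h2 := h1.set_eq (x := 4) (v := kernelBound k)
    (e := .add (.times 36 (.var 6)) (.add (.times 26 (.var 2)) (.lit 8))) (by omega) (by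
      simp [Ex.eval_add, Ex.eval_times, Ex.eval_var, Ex.eval_lit, hk, kernelBound, add_assoc])
  have hrun2 : ∀ p q r : St, (St.seq p (.seq q r)).run υ = r.run (q.run (p.run υ)) :=
    fun _ _ _ => rfl
  rw [hrun2]
  set φ := (St.set 4 (.add (.times 36 (.var 6)) (.add (.times 26 (.var 2)) (.lit 8)))).run
    ((St.set 6 (.sum 30 (.ite (.lt (.var 30) (.var 2)) (.var 2) (.lit 0)))).run υ) with hφ
  have hφm : φ.mem = σ.mem := hmem
  clear_value φ
  set ρ2 := Function.update (Function.update ρ 6 (k * k)) 4 (kernelBound k) with hρ2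
  have r4 : ρ2 4 = kernelBound k := by simp [hρ2]
  have r2 : ρ2 2 = k := by simp [hρ2, hk]
  clear_value ρ2
  have hn2 : ρ2 1 = n := h2.layout.order
  by_cases hbn : kernelBound k < n
  swap
  · rw [St.run, if_neg (by simp only [Ex.lt, Ex.eval, h2.reg, r4, hn2]; omega)]
    exact same _ hφm (Or.inr (by omega))
  rw [St.run, if_pos (by simp only [Ex.lt, Ex.eval, h2.reg, r4, hn2]; omega)]
  obtain ⟨c, ℓ, g1, g2, g3⟩ := run_shrink h2 r2 r4 hbn hG hT
  exact ⟨c, ℓ, g1, Or.inr g2, g3⟩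

end Kernel

end TreePlusK

namespace TreePlusK
open scoped Classical

/-! ### Exhaustive search -/

section BruteForce

theorem enter_reg {σ : State} {x i N : ℕ} : (σ.enter x i N).reg = bindVar σ.reg x i N := rfl

/-- Two nested loops whose body changes a single register, and perhaps the memory. -/
theorem St.run_grid {σ : State} {n w : ℕ} {b : St} (hn : σ.reg 1 = n) (hw : w ≠ 1) (hw' : w < 10)
    (hb : ∀ τ r, r ≠ w → (b.run τ).reg r = τ.reg r) (Q : ℕ → ℕ → (ℕ → ℕ) → Prop)
    (h0 : Q 0 (σ.reg w) σ.mem)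
    (step : ∀ i < n, ∀ j < n, ∀ τ : State,
      (∀ r, r ≠ w → τ.reg r = bindVar (bindVar σ.reg 30 i n) 32 j n r) →
      Q (i * n + j) (τ.reg w) τ.mem → Q (i * n + j + 1) ((b.run τ).reg w) (b.run τ).mem) :
    (∀ r, r ≠ w → ((St.iter 30 (.iter 32 b)).run σ).reg r = σ.reg r) ∧
      Q (n * n) (((St.iter 30 (.iter 32 b)).run σ).reg w) ((St.iter 30 (.iter 32 b)).run σ).mem := by
  have leave_ne : ∀ {τ : State} {x a c r : ℕ}, r ≠ x → r ≠ x + 1 → (τ.leave x a c).reg r = τ.reg r := by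
    intro τ x a c r h1 h2
    simp only [State.leave, Function.update_apply]
    rw [if_neg h2, if_neg h1]
  have bind_ne : ∀ {ρ : ℕ → ℕ} {x i N r : ℕ}, r ≠ x → r ≠ x + 1 → bindVar ρ x i N r = ρ r := by
    intro ρ x i N r h1 h2
    rw [bindVar_apply, if_neg h2, if_neg h1]
  obtain ⟨τ, ⟨h1, h2⟩, h3⟩ := St.run_iter (p := .iter 32 b) (x := 30) hn
    (fun i τ => (∀ r, r ≠ w → r ≠ 30 → r ≠ 31 → τ.reg r = σ.reg r) ∧ Q (i * n) (τ.reg w) τ.mem)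
    ⟨fun _ _ _ _ => rfl, by simpa using h0⟩ (by
      rintro i hi τ ⟨h1, h2⟩
      have hreg : ∀ r, r ≠ w → (τ.enter 30 i n).reg r = bindVar σ.reg 30 i n r := by
        intro r hr
        rw [enter_reg, bindVar_apply, bindVar_apply]
        split_ifs with q1 q2
        · rfl
        · rfl
        · exact h1 r hr q2 q1
      obtain ⟨υ, ⟨g1, g2⟩, g3⟩ := St.run_iter (p := b) (x := 32) (σ := τ.enter 30 i n) (N := n)
        (by rw [hreg 1 hw.symm, bindVar_one (by omega), hn])
        (fun j υ => (∀ r, r ≠ w → r ≠ 32 → r ≠ 33 → υ.reg r = (τ.enter 30 i n).reg r) ∧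
          Q (i * n + j) (υ.reg w) υ.mem)
        ⟨fun _ _ _ _ => rfl, by
          rw [enter_reg, bind_ne (by omega) (by omega)]
          exact h2⟩ (by
          rintro j hj υ ⟨g1, g2⟩
          have hreg2 : ∀ r, r ≠ w →
              (υ.enter 32 j n).reg r = bindVar (bindVar σ.reg 30 i n) 32 j n r := by
            intro r hr
            rw [enter_reg, bindVar_apply, bindVar_apply]
            split_ifs with q1 q2
            · rfl
            · rfl
            · rw [g1 r hr q2 q1, hreg r hr]
          refine ⟨fun r r1 r2 r3 => ?_, step i hi j hj (υ.enter 32 j n) hreg2 ?_⟩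
          · rw [hb _ r r1, enter_reg, bind_ne r2 r3, g1 r r1 r2 r3]
          · rw [enter_reg, bind_ne (by omega) (by omega)]
            exact g2)
      rw [g3]
      refine ⟨fun r r1 r2 r3 => ?_, ?_⟩
      · by_cases q1 : r = 32
        · simp only [q1, State.leave, Function.update_apply]
          rw [if_neg (by omega), if_pos trivial, hreg _ (by omega), bind_ne (by omega) (by omega)]
        · by_cases q2 : r = 33
          · simp only [q2, State.leave, Function.update_apply]
            rw [if_pos trivial, hreg _ (by omega), bind_ne (by omega) (by omega)]
          · rw [leave_ne q1 q2, g1 r r1 q1 q2, hreg r r1, bind_ne r2 r3]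
      · rw [leave_ne (by omega) (by omega), leave_mem, Nat.succ_mul]
        exact g2)
  rw [h3]
  refine ⟨fun r hr => ?_, ?_⟩
  · by_cases q1 : r = 30
    · simp only [q1, State.leave, Function.update_apply]
      rw [if_neg (by omega), if_pos trivial]
    · by_cases q2 : r = 31
      · simp only [q2, State.leave, Function.update_apply]
        rw [if_pos trivial]
      · rw [leave_ne q1 q2, h1 r hr q1 q2]
  · rw [leave_ne (by omega) (by omega), leave_mem]
    exact h2

/-- The graph encoded by the binary digits of a number. -/
def digitGraph (n c : ℕ) : SimpleGraph (Fin n) where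
  Adj i j := i ≠ j ∧ 0 < c / 2 ^ (i.val * n + j.val) % 2 ∧ 0 < c / 2 ^ (j.val * n + i.val) % 2
  symm := ⟨fun _ _ h => ⟨h.1.symm, h.2.2, h.2.1⟩⟩
  loopless := ⟨fun _ h => h.1 rfl⟩

/-- The adjacency matrix is read as a binary number. `digitGraph` asks for both symmetric digits, so
that every number encodes a graph. -/
theorem exists_digitGraph {n : ℕ} (H : SimpleGraph (Fin n)) :
    ∃ c < 2 ^ (n * n), digitGraph n c = H := by
  let f : Fin (n * n) → Bool := fun p => decide (∃ i j : Fin n, p.val = i.val * n + j.val ∧ H.Adj i j)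
  refine ⟨Nat.ofBits f, Nat.ofBits_lt_two_pow f, ?_⟩
  have key : ∀ i j : Fin n, 0 < Nat.ofBits f / 2 ^ (i.val * n + j.val) % 2 ↔ H.Adj i j := by
    intro i j
    have h1 := Nat.testBit_ofBits_lt f (i.val * n + j.val) (cell_lt i.2 j.2)
    rw [Nat.testBit_eq_decide_div_mod_eq] at h1
    have h2 : f ⟨i.val * n + j.val, cell_lt i.2 j.2⟩ = true ↔ H.Adj i j := by
      simp only [f, decide_eq_true_eq]
      constructor
      · rintro ⟨i', j', h, hadj⟩
        obtain ⟨q1, q2⟩ := cell_inj j.2 j'.2 h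
        rwa [Fin.ext q1, Fin.ext q2]
      · exact fun h => ⟨i, j, rfl, h⟩
    rw [← h2, ← h1, decide_eq_true_eq]
    omega
  ext i j
  simp only [digitGraph, key]
  exact ⟨fun h => h.2.1, fun h => ⟨h.ne, h, h.symm⟩⟩

/-- `H` is a square root as required by the labels. -/
def IsLabelRoot {n : ℕ} (ℓ : Fin n → Fin n → ℕ) (k : ℕ) (H : SimpleGraph (Fin n)) : Prop :=
  (∀ x y, x = y ∨ (0 < ℓ x y ↔ WithinTwo H x y)) ∧ (∀ x y, ℓ x y = 2 → H.Adj x y) ∧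
    (∀ x y, ℓ x y = 3 → ¬ H.Adj x y) ∧ ¬ 2 * n + 2 * k < adjCount H + 2

theorem solvable_iff_exists_digitGraph {n k : ℕ} {ℓ : Fin n → Fin n → ℕ} :
    Solvable ℓ k ↔ ∃ c < 2 ^ (n * n), IsLabelRoot ℓ k (digitGraph n c) := by
  have key : ∀ H, IsLabelRoot ℓ k H ↔ (∀ x y, x ≠ y → (ℓ x y ≠ 0 ↔ WithinTwo H x y)) ∧
      (∀ x y, ℓ x y = 2 → H.Adj x y) ∧ (∀ x y, ℓ x y = 3 → ¬ H.Adj x y) ∧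
      adjCount H + 2 ≤ 2 * Fintype.card (Fin n) + 2 * k := by
    intro H
    refine and_congr ?_ (and_congr Iff.rfl (and_congr Iff.rfl ?_))
    · simp only [or_iff_not_imp_left, Nat.pos_iff_ne_zero, ne_eq]
    · rw [Fintype.card_fin]
      omega
  constructor
  · rintro ⟨H, h⟩
    obtain ⟨c, hc, rfl⟩ := exists_digitGraph H
    exact ⟨c, hc, (key _).2 h⟩
  · rintro ⟨c, _, h⟩
    exact ⟨_, (key _).1 h⟩

def Ex.digitAdj (x y : ℕ) : Ex := .and (.not (.same x y)) (.and (.tab 1 x y) (.tab 1 y x))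

def Ex.rootCheck : Ex :=
  .and (.all 30 (.all 32 (.or (.same 30 32) (.iff (.tab 0 30 32) (.or (.digitAdj 30 32)
      (.ex 34 (.and (.digitAdj 30 34) (.digitAdj 34 32))))))))
    (.and (.all 30 (.all 32 (.imp (.eq (.tab 0 30 32) (.lit 2)) (.digitAdj 30 32))))
    (.and (.all 30 (.all 32 (.imp (.eq (.tab 0 30 32) (.lit 3)) (.not (.digitAdj 30 32)))))
      (.not (.lt (.add (.add (.var 1) (.var 1)) (.add (.var 2) (.var 2)))
        (.add (.sum 30 (.sum 32 (.bool (.digitAdj 30 32)))) (.lit 2))))))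

def St.writeDigit : St :=
  .seq (.put (.add (.var 11) (.add (.var 31) (.var 32)))
    (.sub (.var 8) (.add (.half (.var 8)) (.half (.var 8))))) (.set 8 (.half (.var 8)))

/-- Test the graph that is encoded by the number in register `7`. -/
def St.tryRoot : St :=
  .seq (.set 8 (.var 7)) (.seq (.iter 30 (.iter 32 .writeDigit))
    (.seq (.set 0 (.bool (.or (.var 0) .rootCheck))) (.set 7 (.add (.var 7) (.lit 1)))))

/-- Prepare for the exhaustive search; register `6` becomes the number of candidates. -/
def St.countRoots : St :=
  .seq .setup (.seq (.set 6 (.lit 1)) (.seq (.iter 30 (.iter 32 (.set 6 (.add (.var 6) (.var 6)))))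
    (.seq (.set 7 (.lit 0)) (.set 0 (.lit 0)))))

/-- Decide by exhaustive search whether the matrix in memory has a root. -/
def St.search : St :=
  .seq (.set 1 (.ld (.lit 0))) (.seq .countRoots (.rep (.var 6) .tryRoot))

variable {n k : ℕ} {ℓ : Fin n → Fin n → ℕ} {σ : State}

theorem rootCheck_iff {c : ℕ} {ρ m : ℕ → ℕ} (hL : Layout n ρ) (hk : ρ 2 = k)
    (h0 : Tab n m 0 ℓ) (h1 : Tab n m 1 fun i j => c / 2 ^ (i.val * n + j.val) % 2) :
    Ex.rootCheck.T ρ m ↔ IsLabelRoot ℓ k (digitGraph n c) := by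
  have hn : ρ 1 = n := hL.order
  have hall := fun (x : ℕ) (e : Ex) (ρ' m : ℕ → ℕ) (h : ρ' 1 = n) => Ex.T_all (x := x) (e := e)
    (m := m) h
  have hex := fun (x : ℕ) (e : Ex) (ρ' m : ℕ → ℕ) (h : ρ' 1 = n) => Ex.T_ex (x := x) (e := e)
    (m := m) h
  have hsum := fun (x : ℕ) (e : Ex) (ρ' m : ℕ → ℕ) (h : ρ' 1 = n) => Ex.eval_sum (x := x) (e := e)
    (m := m) h
  have a0 : ∀ x y : Fin n, m (ρ 10 + (x * n + y)) = ℓ x y := hL.tab (by omega) h0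
  have a1 : ∀ x y : Fin n, m (ρ 11 + (x * n + y)) = c / 2 ^ (x.val * n + y.val) % 2 :=
    hL.tab (by omega) h1
  rw [Ex.rootCheck, Ex.T_and, Ex.T_and, Ex.T_and, Ex.T_not, Ex.T_lt]
  refine and_congr ?_ (and_congr ?_ (and_congr ?_ (not_congr ?_)))
  · simp [Ex.digitAdj, Ex.T_and, Ex.T_or, Ex.T_not, Ex.T_iff, Ex.T_tab, Ex.T_same, hall, hex,
      bindVar_apply, hn, a0, a1, Fin.val_inj, WithinTwo, digitGraph]
  · simp [Ex.digitAdj, Ex.T_and, Ex.T_not, Ex.T_imp, Ex.T_tab, Ex.T_same, Ex.T_eq, hall,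
      bindVar_apply, hn, a0, a1, Fin.val_inj, digitGraph, Ex.eval_tab, Ex.eval_lit]
  · simp [Ex.digitAdj, Ex.T_and, Ex.T_not, Ex.T_imp, Ex.T_tab, Ex.T_same, Ex.T_eq, hall,
      bindVar_apply, hn, a0, a1, Fin.val_inj, digitGraph, Ex.eval_tab, Ex.eval_lit]
  · have e1 : (Ex.sum 30 (.sum 32 (.bool (.digitAdj 30 32)))).eval ρ m =
        adjCount (digitGraph n c) := by
      rw [hsum _ _ _ _ hn]
      refine Finset.sum_congr rfl fun x _ => ?_
      rw [hsum _ _ _ _ (by simp [bindVar_apply, hn])]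
      refine Finset.sum_congr rfl fun y _ => ?_
      rw [Ex.eval_bool]
      refine if_congr ?_ rfl rfl
      simp [Ex.digitAdj, Ex.T_and, Ex.T_not, Ex.T_tab, Ex.T_same, bindVar_apply, a1, Fin.val_inj,
        digitGraph]
    simp only [Ex.eval_add, Ex.eval_var, Ex.eval_lit, e1, hn, hk]
    omega

/-- Register `8` holds `c / 2 ^ p` when cell `p` is written, and subtracting twice its half yields
the next digit. Register `0` remembers any success, and register `7` moves on to the next candidate.
-/
theorem run_tryRoot {c : ℕ} {P : Prop} (hL : Layout n σ.reg) (hk : σ.reg 2 = k) (hc : σ.reg 7 = c)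
    (hP : 0 < σ.reg 0 ↔ P) (h0 : Tab n σ.mem 0 ℓ) :
    Layout n (St.tryRoot.run σ).reg ∧ (St.tryRoot.run σ).reg 2 = k ∧
      (St.tryRoot.run σ).reg 7 = c + 1 ∧
      (St.tryRoot.run σ).reg 0 = (if P ∨ IsLabelRoot ℓ k (digitGraph n c) then 1 else 0) ∧
      Tab n (St.tryRoot.run σ).mem 0 ℓ := by
  set τ := (St.set 8 (.var 7)).run σ with hτ
  have e1 : ∀ r, τ.reg r = if r = 8 then c else σ.reg r := by
    intro r
    simp only [hτ, St.run, State.setReg, Function.update_apply, Ex.eval, hc]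
  have hb11 := hL.base 1 (by omega)
  simp only [Nat.reduceAdd, Nat.one_mul] at hb11
  obtain ⟨g1, g2, g3, g4⟩ := St.run_grid (σ := τ) (n := n) (w := 8) (b := .writeDigit)
    (by rw [e1, if_neg (by omega), hL.order]) (by omega) (by omega)
    (by
      intro υ r hr
      simp [St.writeDigit, St.run, State.setReg, State.setMem, hr])
    (fun p v m => v = c / 2 ^ p ∧ (∀ a, a < 2 + n * n → m a = σ.mem a) ∧
      ∀ i j : Fin n, i.val * n + j.val < p →
        m (2 + n * n + (i.val * n + j.val)) = c / 2 ^ (i.val * n + j.val) % 2)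
    ⟨by rw [e1]; simp, fun _ _ => rfl, fun _ _ h => absurd h (Nat.not_lt_zero _)⟩
    (by
      rintro i hi j hj υ hreg ⟨q1, q2, q3⟩
      have r11 : υ.reg 11 = 2 + n * n := by
        rw [hreg 11 (by omega)]
        simp [bindVar_apply, e1, hb11]
      have r31 : υ.reg 31 = i * n := by
        rw [hreg 31 (by omega)]
        simp [bindVar_apply]
      have r32 : υ.reg 32 = j := by
        rw [hreg 32 (by omega)]
        simp [bindVar_apply]
      have hm : (St.writeDigit.run υ).mem = Function.update υ.mem (2 + n * n + (i * n + j))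
          (c / 2 ^ (i * n + j) % 2) := by
        simp only [St.writeDigit, St.run, State.setReg, State.setMem, Ex.eval, r11, r31, r32, q1]
        congr 1
        omega
      have hr : (St.writeDigit.run υ).reg 8 = c / 2 ^ (i * n + j + 1) := by
        simp only [St.writeDigit, St.run, State.setReg, State.setMem, Ex.eval, q1,
          Function.update_self, Nat.pow_succ, Nat.div_div_eq_div_mul]
      refine ⟨hr, fun a ha => ?_, fun i' j' h => ?_⟩
      · rw [hm, Function.update_of_ne (by omega), q2 a ha]
      · rw [hm]
        by_cases heq : i'.val * n + j'.val = i * n + j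
        · rw [heq, Function.update_self]
        · rw [Function.update_of_ne (by omega), q3 i' j' (by omega)])
  have hrun : St.tryRoot.run σ = (St.set 7 (.add (.var 7) (.lit 1))).run
    ((St.set 0 (.bool (.or (.var 0) .rootCheck))).run ((St.iter 30 (.iter 32 .writeDigit)).run τ)) :=
    rfl
  rw [hrun]
  set υ := (St.iter 30 (.iter 32 .writeDigit)).run τ with hυ
  clear_value υ
  have e2 : ∀ r, r ≠ 8 → υ.reg r = σ.reg r := by
    intro r hr
    rw [g1 r hr, e1, if_neg hr]
  have hLυ : Layout n υ.reg := ⟨by rw [e2 1 (by omega), hL.order], fun t ht => by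
    rw [e2 _ (by omega), hL.base t ht]⟩
  have h0' : Tab n υ.mem 0 ℓ := h0.of_eq fun a _ h => g3 a (by simpa using h)
  have h1' : Tab n υ.mem 1 fun i j => c / 2 ^ (i.val * n + j.val) % 2 := by
    intro i j
    rw [Nat.one_mul]
    exact g4 i j (cell_lt i.2 j.2)
  have hcheck := rootCheck_iff hLυ ((e2 2 (by omega)).trans hk) h0' h1'
  set φ := (St.set 0 (.bool (.or (.var 0) .rootCheck))).run υ with hφ
  have e3 : φ.reg = Function.update υ.reg 0
      (if P ∨ IsLabelRoot ℓ k (digitGraph n c) then 1 else 0) := by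
    simp only [hφ, St.run, State.setReg]
    congr 1
    rw [Ex.eval_bool]
    refine if_congr ?_ rfl rfl
    rw [Ex.T_or, hcheck, ← hP, ← e2 0 (by omega)]
    rfl
  have e4 : φ.mem = υ.mem := rfl
  clear_value φ
  have e5 : ((St.set 7 (.add (.var 7) (.lit 1))).run φ).reg = Function.update φ.reg 7 (c + 1) := by
    simp only [St.run, State.setReg, Ex.eval, e3]
    rw [Function.update_of_ne (by omega), e2 7 (by omega), hc]
  rw [e5, e3]
  refine ⟨⟨?_, fun t ht => ?_⟩, ?_, ?_, ?_, ?_⟩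
  · rw [Function.update_of_ne (by omega), Function.update_of_ne (by omega), hLυ.order]
  · rw [Function.update_of_ne (by omega), Function.update_of_ne (by omega), hLυ.base t ht]
  · rw [Function.update_of_ne (by omega), Function.update_of_ne (by omega), e2 2 (by omega), hk]
  · rw [Function.update_self]
  · rw [Function.update_of_ne (by omega), Function.update_self]
  · change Tab n φ.mem 0 ℓ
    rw [e4]
    exact h0'

end BruteForce

end TreePlusK

namespace TreePlusK
open scoped Classical

/-! ### Correctness and cost of the search -/

section Programs

variable {n k : ℕ} {ℓ : Fin n → Fin n → ℕ} {σ : State}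

/-- Doubling once for each cell of the matrix yields the number of candidates without
multiplication. -/
theorem run_countRoots (h : Matrix n k ℓ σ.mem) (hn : σ.reg 1 = n) :
    Layout n (St.countRoots.run σ).reg ∧ (St.countRoots.run σ).reg 2 = k ∧
      (St.countRoots.run σ).reg 7 = 0 ∧ (St.countRoots.run σ).reg 0 = 0 ∧
      (St.countRoots.run σ).reg 6 = 2 ^ (n * n) ∧ Tab n (St.countRoots.run σ).mem 0 ℓ := by
  obtain ⟨ρ, hk, h0⟩ := stores_setup h hn
  have h1 := h0.set_eq (x := 6) (v := 1) (e := .lit 1) (by omega) rfl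
  have hrun : St.countRoots.run σ = (St.set 0 (.lit 0)).run
    ((St.set 7 (.lit 0)).run ((St.iter 30 (.iter 32 (.set 6 (.add (.var 6) (.var 6))))).run
      ((St.set 6 (.lit 1)).run (St.setup.run σ)))) := rfl
  rw [hrun]
  set τ := (St.set 6 (.lit 1)).run (St.setup.run σ) with hτ
  clear_value τ
  obtain ⟨g1, g2, g3⟩ := St.run_grid (σ := τ) (n := n) (w := 6)
    (b := .set 6 (.add (.var 6) (.var 6))) (by rw [h1.reg, h1.layout.order]) (by omega) (by omega)
    (fun υ r hr => by simp [St.run, State.setReg, hr])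
    (fun p v m => v = 2 ^ p ∧ m = τ.mem) ⟨by simp [h1.reg], rfl⟩ (by
      rintro i hi j hj υ _ ⟨q1, q2⟩
      refine ⟨?_, q2⟩
      simp only [St.run, State.setReg, Ex.eval, q1, Function.update_self, pow_succ]
      omega)
  set υ := (St.iter 30 (.iter 32 (.set 6 (.add (.var 6) (.var 6))))).run τ with hυ
  clear_value υ
  set φ := (St.set 0 (.lit 0)).run ((St.set 7 (.lit 0)).run υ) with hφ
  have e1 : ∀ r, r ≠ 6 → r ≠ 0 → r ≠ 7 → φ.reg r = ρ r := by
    intro r r6 r0 r7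
    have : φ.reg r = υ.reg r := by simp [hφ, St.run, State.setReg, r0, r7]
    rw [this, g1 r r6, h1.reg, Function.update_of_ne r6]
  refine ⟨⟨by rw [e1 1 (by omega) (by omega) (by omega), h0.layout.order], fun t ht => by
    rw [e1 _ (by omega) (by omega) (by omega), h0.layout.base t ht]⟩,
    by rw [e1 2 (by omega) (by omega) (by omega), hk], ?_, ?_, ?_, ?_⟩
  · simp [hφ, St.run, State.setReg, Ex.eval]
  · simp [hφ, St.run, State.setReg, Ex.eval]
  · rw [← g2]
    simp [hφ, St.run, State.setReg]
  · have em : φ.mem = τ.mem := g3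
    rw [em]
    exact h1.tabs 0 _ rfl

theorem run_search (h : Matrix n k ℓ σ.mem) :
    (St.search.run σ).reg 0 = (if Solvable ℓ k then 1 else 0) ∧ (St.search.run σ).reg 2 = k := by
  obtain ⟨q1, q2, q3, q4, q5, q6⟩ := run_countRoots (σ := (St.set 1 (.ld (.lit 0))).run σ)
    (show Matrix n k ℓ σ.mem from h) (by simp [St.run, State.setReg, Ex.eval, h.order])
  have hrun : St.search.run σ = (St.rep (.var 6) .tryRoot).run (St.countRoots.run
    ((St.set 1 (.ld (.lit 0))).run σ)) := rfl
  rw [hrun]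
  set φ := St.countRoots.run ((St.set 1 (.ld (.lit 0))).run σ)
  clear_value φ
  obtain ⟨Q, hQ⟩ : ∃ Q : ℕ → Prop, ∀ i, Q i ↔ ∃ c < i, IsLabelRoot ℓ k (digitGraph n c) :=
    ⟨_, fun _ => Iff.rfl⟩
  have key := applyUpTo_induction (f := fun _ τ => St.tryRoot.run τ) (n := 2 ^ (n * n)) (σ := φ)
    (P := fun i τ => Layout n τ.reg ∧ τ.reg 2 = k ∧ τ.reg 7 = i ∧
      τ.reg 0 = (if Q i then 1 else 0) ∧ Tab n τ.mem 0 ℓ)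
    ⟨q1, q2, q3, by simp [hQ, q4], q6⟩ (by
      rintro i hi τ ⟨q1, q2, q3, q4, q5⟩
      obtain ⟨p1, p2, p3, p4, p5⟩ := run_tryRoot q1 q2 q3 (P := Q i)
        (by rw [q4, pos_indicator]) q5
      refine ⟨p1, p2, p3, ?_, p5⟩
      rw [p4]
      refine if_congr ?_ rfl rfl
      rw [hQ, hQ]
      constructor
      · rintro (⟨c, hc, h⟩ | h)
        · exact ⟨c, by omega, h⟩
        · exact ⟨i, by omega, h⟩
      · rintro ⟨c, hc, h⟩
        rcases Nat.lt_succ_iff_lt_or_eq.1 hc with h' | rfl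
        · exact Or.inl ⟨c, h', h⟩
        · exact Or.inr h)
  have hrep : (St.rep (.var 6) .tryRoot).run φ =
      applyUpTo (fun _ τ => St.tryRoot.run τ) (2 ^ (n * n)) φ := by
    rw [← q5]
    rfl
  rw [hrep]
  refine ⟨?_, key.2.1⟩
  rw [key.2.2.2.1]
  exact if_congr ((hQ _).trans solvable_iff_exists_digitGraph.symm) rfl rfl

/-- The cost of a statement that starts by loading the order into register `1`. -/
theorem St.cost_load_seq_le {p : St} (hp : p.Plain) {d q : ℕ} (hd : p.Wf d) (hq : p.depth ≤ q)
    (σ : State) :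
    (St.seq (.set 1 (.ld (.lit 0))) p).cost σ ≤ (p.size + 3) * (σ.mem 0 + 1) ^ q := by
  have h1 := hp.cost_le hd hq ((St.set 1 (.ld (.lit 0))).run σ)
  have h2 : ((St.set 1 (.ld (.lit 0))).run σ).reg 1 = σ.mem 0 := by
    simp [St.run, State.setReg, Ex.eval]
  rw [h2] at h1
  have h3 : 1 ≤ (σ.mem 0 + 1) ^ q := Nat.one_le_pow _ _ (by omega)
  simp only [St.cost, Ex.cost]
  nlinarith

/-- Because of `rep` the search is not `Plain`, so its cost is added up directly: one plain test of
cubic cost for each candidate. -/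
theorem cost_search_le (σ : State) : St.search.cost σ ≤
    (St.countRoots.size + St.tryRoot.size + 8) *
      (2 ^ (σ.mem 0 * σ.mem 0) * (σ.mem 0 + 1) ^ 3) := by
  set n := σ.mem 0 with hn
  set τ := (St.set 1 (.ld (.lit 0))).run σ with hτ
  have h1 : τ.reg 1 = n := by simp [hτ, hn, St.run, State.setReg, Ex.eval]
  obtain ⟨q1, -, -, -, q5, -⟩ := run_countRoots (σ := τ) (n := n) (k := σ.mem 1)
    (ℓ := fun i j => σ.mem (2 + i * n + j)) ⟨rfl, rfl, fun _ _ => rfl⟩ h1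
  have hP : St.countRoots.Plain ∧ St.countRoots.Wf 100 ∧ St.countRoots.depth ≤ 3 := by decide
  have hT : St.tryRoot.Plain ∧ St.tryRoot.Wf 100 ∧ St.tryRoot.depth ≤ 3 := by decide
  have c1 := hP.1.cost_le hP.2.1 hP.2.2 τ
  rw [h1] at c1
  have c2 : ∑ i ∈ Finset.range (2 ^ (n * n)), (St.tryRoot.cost
      (applyUpTo (fun _ τ => St.tryRoot.run τ) i (St.countRoots.run τ)) + 2) ≤
        2 ^ (n * n) * (St.tryRoot.size * (n + 1) ^ 3 + 2) := by
    refine (Finset.sum_le_card_nsmul _ _ (St.tryRoot.size * (n + 1) ^ 3 + 2) fun i _ => ?_).trans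
      (by simp)
    refine Nat.add_le_add_right ((hT.1.cost_le hT.2.1 hT.2.2 _).trans (Nat.mul_le_mul_left _
      (Nat.pow_le_pow_left (Nat.add_le_add_right ?_ 1) 3))) 2
    refine applyUpTo_induction (P := fun _ τ => τ.reg 1 ≤ n) q1.order.le fun i _ τ hτ => ?_
    exact ((hT.1.simple hT.2.1).reg_one _).trans hτ
  have hcost : St.search.cost σ = 3 + (St.countRoots.cost τ + (1 +
      (∑ i ∈ Finset.range ((St.countRoots.run τ).reg 6), (St.tryRoot.cost
        (applyUpTo (fun _ τ => St.tryRoot.run τ) i (St.countRoots.run τ)) + 2) + 2))) := rfl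
  rw [hcost, q5]
  have h2 : 1 ≤ 2 ^ (n * n) := Nat.one_le_two_pow
  have h3 : 1 ≤ (n + 1) ^ 3 := Nat.one_le_pow _ _ (by omega)
  generalize St.countRoots.size = A at *
  generalize St.tryRoot.size = B at *
  generalize 2 ^ (n * n) = X at *
  generalize (n + 1) ^ 3 = Y at *
  have h4 : Y ≤ X * Y := Nat.le_mul_of_pos_left _ h2
  have h5 : X ≤ X * Y := Nat.le_mul_of_pos_right _ h3
  nlinarith [Nat.mul_le_mul_left A h4]

end Programs

end TreePlusK

namespace TreePlusK
open scoped Classical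

/-! ### Kernelization and decision for connected graphs -/

section Algorithms

theorem matrix_inputState {n : ℕ} (G : SimpleGraph (Fin n)) (k : ℕ) :
    Matrix n k (plainLabel G) (inputState G k).mem := by
  refine ⟨rfl, rfl, fun i j => ?_⟩
  simp only [inputState]
  rw [if_neg (by omega), if_neg (by omega), plainLabel]
  refine if_congr ⟨?_, fun h => ⟨i, j, rfl, h⟩⟩ rfl rfl
  rintro ⟨i', j', h, hadj⟩
  obtain ⟨q1, q2⟩ := cell_inj (n := n) (i := i) (j := j) (i' := i') (j' := j') j.2 j'.2 (by omega)
  rwa [Fin.ext q1, Fin.ext q2]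

/-- Compute the kernel. -/
def St.kernelize : St := .seq .twinRule .kernelRule

/-- The first rule bounds the classes of twins by `6 * k + 3`, as the second one requires. -/
theorem run_kernelize {n k : ℕ} {G : SimpleGraph (Fin n)} {σ : State}
    (h : Matrix n k (plainLabel G) σ.mem) (hG : G.Connected) :
    ∃ (c : ℕ) (ℓ : Fin c → Fin c → ℕ), IsLabelling ℓ ∧ (c ≤ k ∨ c ≤ kernelBound k) ∧
      (Solvable ℓ k ↔ YesInstance G k) ∧ Matrix c k ℓ (St.kernelize.run σ).mem := by
  obtain ⟨c, e, h1⟩ := run_twinRule h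
  set G' : SimpleGraph {x // x ∈ kept G (6 * k + 3)} := G.comap Subtype.val with hG'
  have e1 : (G.comap fun i => (e i).1) = G'.comap e := rfl
  rw [e1] at h1
  have hc : (G'.comap e).Connected :=
    (SimpleGraph.Iso.comap e G').connected_iff.2 (connected_kept hG k)
  obtain ⟨c', ℓ, g1, g2, g3, g4⟩ := run_kernelRule h1 hc (by
    intro T hT
    rw [← Finset.card_map e.toEmbedding]
    refine card_le_of_twins_kept (by omega) fun x hx y hy => ?_
    obtain ⟨a, ha, rfl⟩ := Finset.mem_map.1 hx
    obtain ⟨b, hb, rfl⟩ := Finset.mem_map.1 hy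
    intro z
    obtain ⟨z, rfl⟩ := e.surjective z
    have := hT a ha b hb z
    simp only [SimpleGraph.comap_adj, ← e.injective.eq_iff] at this
    exact this)
  refine ⟨c', ℓ, g1, g2, g3.trans ?_, g4⟩
  rw [yesInstance_iff, ← solvable_kept hG k, ← solvable_comap_iff e]
  exact Iff.rfl

-- The second rule works on the order left by the first, which is at most `n`. The exponent is due
-- to the recognition of edges.
set_option maxRecDepth 10000 in
theorem exists_cost_kernelize_le : ∃ C, ∀ {n k : ℕ} {G : SimpleGraph (Fin n)} {σ : State},
    Matrix n k (plainLabel G) σ.mem → St.kernelize.cost σ ≤ C * (n + 1) ^ 5 := by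
  obtain ⟨p, hp, hp1, hp2, hp3⟩ : ∃ p, St.twinRule = .seq (.set 1 (.ld (.lit 0))) p ∧ p.Plain ∧
    p.Wf 100 ∧ p.depth ≤ 5 := ⟨_, rfl, by decide, by decide, by decide⟩
  obtain ⟨q, hq, hq1, hq2, hq3⟩ : ∃ q, St.kernelRule = .seq (.set 1 (.ld (.lit 0))) q ∧ q.Plain ∧
    q.Wf 100 ∧ q.depth ≤ 5 := ⟨_, rfl, by decide, by decide, by decide⟩
  refine ⟨p.size + 3 + (q.size + 3), fun {n k G σ} h => ?_⟩
  obtain ⟨c, e, h1⟩ := run_twinRule h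
  have hcn : c ≤ n := by
    have := Fintype.card_congr e
    rw [Fintype.card_fin, Fintype.card_coe] at this
    rw [this]
    exact (Finset.card_le_univ _).trans (by simp)
  have h2 := St.cost_load_seq_le hp1 hp2 hp3 σ
  have h3 := St.cost_load_seq_le hq1 hq2 hq3 (St.twinRule.run σ)
  rw [← hp, h.order] at h2
  rw [← hq, h1.order] at h3
  have h4 := Nat.mul_le_mul_left (q.size + 3)
    (Nat.pow_le_pow_left (Nat.add_le_add_right hcn 1) 5)
  rw [St.kernelize, St.cost, add_mul]
  omega

/-- Decide an instance with a connected graph. -/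
def St.decideConnected : St := .seq .kernelize .search

theorem run_decideConnected {n k : ℕ} {G : SimpleGraph (Fin n)} {σ : State}
    (h : Matrix n k (plainLabel G) σ.mem) (hG : G.Connected) :
    (St.decideConnected.run σ).reg 0 = if YesInstance G k then 1 else 0 := by
  obtain ⟨c, ℓ, -, -, h3, h4⟩ := run_kernelize h hG
  rw [St.decideConnected, St.run, (run_search h4).1]
  exact if_congr h3 rfl rfl

theorem exists_cost_decideConnected_le : ∃ C, ∀ {n k : ℕ} {G : SimpleGraph (Fin n)} {σ : State},
    Matrix n k (plainLabel G) σ.mem → G.Connected → ∃ c, (c ≤ k ∨ c ≤ kernelBound k) ∧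
      St.decideConnected.cost σ ≤ C * (n + 1) ^ 5 + C * (2 ^ (c * c) * (c + 1) ^ 3) := by
  obtain ⟨C, hC⟩ := exists_cost_kernelize_le
  refine ⟨C + (St.countRoots.size + St.tryRoot.size + 8), fun {n k G σ} h hG => ?_⟩
  obtain ⟨c, ℓ, -, h2, -, h4⟩ := run_kernelize h hG
  refine ⟨c, h2, ?_⟩
  have q1 := hC h
  have q2 := cost_search_le (St.kernelize.run σ)
  rw [h4.order] at q2
  rw [St.decideConnected, St.cost]
  generalize St.countRoots.size + St.tryRoot.size + 8 = D at *
  rw [add_mul, add_mul]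
  omega

/-- Replace the matrix in memory by the matrix of a graph with one vertex. -/
def St.accept : St :=
  .seq (.put (.lit 0) (.lit 1)) (.seq (.put (.lit 1) (.var 2)) (.put (.lit 2) (.lit 0)))

theorem run_accept {σ : State} :
    Matrix 1 (σ.reg 2) (plainLabel (⊤ : SimpleGraph (Fin 1))) (St.accept.run σ).mem := by
  refine ⟨?_, ?_, fun i j => ?_⟩
  · simp [St.accept, St.run, State.setMem, Ex.eval]
  · simp [St.accept, St.run, State.setMem, Ex.eval]
  · simp [St.accept, St.run, State.setMem, Ex.eval, plainLabel, Subsingleton.elim i 0,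
      Subsingleton.elim j 0]

theorem solvable_top_one (k : ℕ) : Solvable (plainLabel (⊤ : SimpleGraph (Fin 1))) k := by
  refine ⟨⊤, fun x y h => absurd (Subsingleton.elim x y) h, fun x y h => ?_, fun x y h => ?_, ?_⟩
  · simp [plainLabel, Subsingleton.elim x y] at h
  · simp [plainLabel, Subsingleton.elim x y] at h
  · simp [adjCount]

/-- Compute a generalized kernel with few vertices. -/
def St.smallKernel : St :=
  .seq .kernelize (.seq (.set 2 (.ld (.lit 1))) (.ite (.eq (.var 2) (.lit 1))
    (.seq .search (.ite (.var 0) .accept .refuse)) .skip))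

/-- The required bound exceeds `kernelBound k` except for `k = 1`, where it is `3`. In that case the
kernel is decided and replaced by a single vertex or by the path with three vertices. -/
theorem run_smallKernel {n k : ℕ} {G : SimpleGraph (Fin n)} {σ : State}
    (h : Matrix n k (plainLabel G) σ.mem) (hG : G.Connected) :
    ∃ (c : ℕ) (ℓ : Fin c → Fin c → ℕ), IsLabelling ℓ ∧
      (c : ℤ) ≤ (15 * (k : ℤ) - 14) * (15 * (k : ℤ) - 12) ∧
      (Solvable ℓ k ↔ YesInstance G k) ∧ Matrix c k ℓ (St.smallKernel.run σ).mem := by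
  obtain ⟨c, ℓ, g1, g2, g3, g4⟩ := run_kernelize h hG
  rw [St.smallKernel, St.run, St.run]
  set σ' := St.kernelize.run σ
  clear_value σ'
  set τ := (St.set 2 (.ld (.lit 1))).run σ' with hτ
  have hτm : Matrix c k ℓ τ.mem := g4
  have hτ2 : τ.reg 2 = k := by simp [hτ, St.run, State.setReg, Ex.eval, g4.parameter]
  clear_value τ
  have hT : 0 < (Ex.eq (.var 2) (.lit 1)).eval τ.reg τ.mem ↔ k = 1 :=
    Ex.T_eq.trans (by simp [Ex.eval, hτ2])
  by_cases hk : k = 1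
  · rw [St.run, if_pos (hT.2 hk)]
    obtain ⟨q1, q2⟩ := run_search hτm
    rw [St.run]
    set υ := St.search.run τ
    clear_value υ
    by_cases hs : Solvable ℓ k
    · rw [St.run, if_pos (by simp [Ex.eval, q1, hs])]
      refine ⟨1, _, isLabelling_plainLabel SimpleGraph.connected_top, by subst hk; norm_num,
        iff_of_true (solvable_top_one k) (g3.1 hs), ?_⟩
      rw [← q2]
      exact run_accept
    · rw [St.run, if_neg (by simp [Ex.eval, q1, hs])]
      refine ⟨3, _, isLabelling_plainLabel cherry_connected, by subst hk; norm_num,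
        iff_of_false (not_solvable_cherry k) fun h => hs (g3.2 h), ?_⟩
      rw [← q2]
      exact run_refuse
  · rw [St.run, if_neg (mt hT.1 hk)]
    refine ⟨c, ℓ, g1, ?_, g3, hτm⟩
    rcases Nat.lt_or_ge k 1 with h0 | h0
    · obtain rfl : k = 0 := by omega
      unfold kernelBound at g2
      norm_num
      omega
    · have h2 : 2 ≤ k := by omega
      obtain ⟨j, rfl⟩ := Nat.exists_eq_add_of_le h2
      have g2' : c ≤ 36 * ((2 + j) * (2 + j)) + 26 * (2 + j) + 8 := by
        rcases g2 with g | g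
        · nlinarith
        · exact g
      have : (c : ℤ) ≤ 36 * ((2 + j) * (2 + j)) + 26 * (2 + j) + 8 := by exact_mod_cast g2'
      push_cast
      nlinarith

theorem exists_cost_smallKernel_le : ∃ C, ∀ {n k : ℕ} {G : SimpleGraph (Fin n)} {σ : State},
    Matrix n k (plainLabel G) σ.mem → G.Connected → St.smallKernel.cost σ ≤ C * (n + 1) ^ 5 := by
  obtain ⟨C, hC⟩ := exists_cost_kernelize_le
  set D := St.countRoots.size + St.tryRoot.size + 8 with hD
  -- Since `kernelBound 1 = 70`, the search for `k = 1` takes constant time.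
  set E := D * (2 ^ (70 * 70) * (70 + 1) ^ 3) with hE
  have hA : St.accept.Plain ∧ St.accept.Wf 100 ∧ St.accept.depth ≤ 0 := by decide
  have hR : St.refuse.Plain ∧ St.refuse.Wf 100 ∧ St.refuse.depth ≤ 0 := by decide
  clear_value E
  have hs : ∀ {c k ℓ τ}, Matrix c k ℓ τ.mem → c ≤ 70 → St.search.cost τ ≤ E := by
    intro c k ℓ τ h hc
    refine (cost_search_le τ).trans ?_
    rw [h.order, hE, hD]
    gcongr
    norm_num
  refine ⟨C + (E + St.accept.size + St.refuse.size + 16), fun {n k G σ} h hG => ?_⟩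
  obtain ⟨c, ℓ, -, g2, -, g4⟩ := run_kernelize h hG
  have h1 := hC h
  rw [St.smallKernel, St.cost, St.cost, St.cost, St.cost]
  set σ' := St.kernelize.run σ
  clear_value σ'
  set τ := (St.set 2 (.ld (.lit 1))).run σ' with hτ
  have hτm : Matrix c k ℓ τ.mem := g4
  have hτ2 : τ.reg 2 = k := by simp [hτ, St.run, State.setReg, Ex.eval, g4.parameter]
  clear_value τ
  have hT : 0 < (Ex.eq (.var 2) (.lit 1)).eval τ.reg τ.mem ↔ k = 1 :=
    Ex.T_eq.trans (by simp [Ex.eval, hτ2])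
  have c1 : (Ex.ld (.lit 1)).cost σ'.reg σ'.mem = 2 := rfl
  have c2 : (Ex.eq (.var 2) (.lit 1)).cost τ.reg τ.mem = 9 := by
    simp [Ex.eq, Ex.not, Ex.cost]
  have h2 : (if 0 < (Ex.eq (.var 2) (.lit 1)).eval τ.reg τ.mem then
      (St.seq .search (.ite (.var 0) .accept .refuse)).cost τ else St.skip.cost τ) ≤
        E + St.accept.size + St.refuse.size + 2 := by
    split_ifs with hk
    · obtain rfl := hT.1 hk
      have h3 := hs hτm (by unfold kernelBound at g2; omega)
      rw [St.cost, St.cost]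
      have h4 := hA.1.cost_le hA.2.1 hA.2.2 (St.search.run τ)
      have h5 := hR.1.cost_le hR.2.1 hR.2.2 (St.search.run τ)
      rw [pow_zero, mul_one] at h4 h5
      have h6 : (Ex.var 0).cost (St.search.run τ).reg (St.search.run τ).mem = 1 := rfl
      rw [h6]
      split_ifs <;> omega
    · rw [St.cost]
      omega
  have h3 : 1 ≤ (n + 1) ^ 5 := Nat.one_le_pow _ _ (by omega)
  clear_value D
  clear hs hE hD
  rw [add_mul]
  have h4 := Nat.le_mul_of_pos_right (E + St.accept.size + St.refuse.size + 16) h3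
  omega

end Algorithms

end TreePlusK

namespace TreePlusK
open scoped Classical

/-! ### Arbitrary graphs -/

section Recognition

variable {n k : ℕ} {G : SimpleGraph (Fin n)} {σ : State}

/-- Table `1` becomes the reachability relation of the graph in memory, and its order and the
parameter are stored again. -/
def St.reachability : St :=
  .seq .setup (.seq (.closure 0 1) (.seq (.put (.lit 0) (.var 1)) (.put (.lit 1) (.var 2))))

/-- The conjunct `.var 1` excludes the empty graph. -/
def Ex.connected : Ex := .and (.var 1) (.all 30 (.all 32 (.tab 1 30 32)))

/-- `Stores` says nothing about the cells `0` and `1`, so the order and the parameter are written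
again for the next program. -/
theorem run_reachability (h : Matrix n k (plainLabel G) σ.mem) (hn : σ.reg 1 = n) :
    Matrix n k (plainLabel G) (St.reachability.run σ).mem ∧
      (Ex.connected.T (St.reachability.run σ).reg (St.reachability.run σ).mem ↔ G.Connected) := by
  obtain ⟨ρ, hk, h0⟩ := stores_setup h hn
  have h1 := h0.closure (a := 0) (t := 1) rfl (by omega) rfl
  rw [St.reachability, St.run, St.run]
  set τ := (St.closure 0 1).run (St.setup.run σ)
  clear_value τ
  set υ := (St.seq (.put (.lit 0) (.var 1)) (.put (.lit 1) (.var 2))).run τ with hυ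
  have hn' : ρ 1 = n := h1.layout.order
  have er : υ.reg = ρ := h1.reg
  have em : ∀ a, υ.mem a = if a = 1 then k else if a = 0 then n else τ.mem a := by
    intro a
    simp [hυ, St.run, State.setMem, Ex.eval, Function.update_apply, h1.reg, hk, hn']
  clear_value υ
  have e2 : ∀ a, 2 ≤ a → υ.mem a = τ.mem a := by
    intro a ha
    rw [em, if_neg (by omega), if_neg (by omega)]
  refine ⟨⟨by rw [em]; simp, by rw [em]; simp, fun i j => ?_⟩, ?_⟩
  · rw [e2 _ (by omega)]
    have := h1.tabs 0 _ rfl i j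
    rw [← this]
    congr 1
    omega
  · have a1 : ∀ x y : Fin n, υ.mem (ρ 11 + (x * n + y)) = relTable G.Reachable x y := by
      intro x y
      have := h1.layout.tab (t := 1) (by omega) (h1.tabs 1 _ rfl) x y
      rw [← this, e2]
      rw [h1.layout.base 1 (by omega)]
      omega
    have hall := fun (x : ℕ) (e : Ex) (ρ' m : ℕ → ℕ) (h : ρ' 1 = n) =>
      Ex.T_all (x := x) (e := e) (m := m) h
    have hpos : (Ex.var 1).T ρ υ.mem ↔ 0 < n := by
      rw [← hn']
      exact Iff.rfl
    rw [er, Ex.connected, Ex.T_and, hpos, hall _ _ _ _ hn']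
    have hrow : ∀ i : Fin n, (Ex.all 32 (.tab 1 30 32)).T (bindVar ρ 30 i n) υ.mem ↔
        ∀ j : Fin n, G.Reachable i j := by
      intro i
      rw [hall _ _ _ _ (by simp [bindVar_apply, hn'])]
      refine forall_congr' fun j => ?_
      simp [Ex.T_tab, bindVar_apply, a1, relTable, pos_indicator]
    simp only [hrow]
    constructor
    · rintro ⟨h1, h2⟩
      have : Nonempty (Fin n) := ⟨⟨0, h1⟩⟩
      exact SimpleGraph.Connected.mk h2
    · intro h
      exact ⟨h.nonempty.some.pos, h.preconnected⟩

/-- Decide an instance with an arbitrary graph, which has to be connected. -/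
def St.decideAny : St :=
  .seq (.set 1 (.ld (.lit 0))) (.seq .reachability
    (.ite .connected .decideConnected (.set 0 (.lit 0))))

theorem run_decideAny (h : Matrix n k (plainLabel G) σ.mem) :
    (St.decideAny.run σ).reg 0 = if IsSquareOfTreePlus k G then 1 else 0 := by
  set σ' := (St.set 1 (.ld (.lit 0))).run σ with hσ'
  have hrun : St.decideAny.run σ = (St.ite .connected .decideConnected (.set 0 (.lit 0))).run
    (St.reachability.run σ') := rfl
  rw [hrun]
  obtain ⟨h1, h2⟩ := run_reachability (σ := σ') (show Matrix n k (plainLabel G) σ'.mem from h)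
    (by simp [hσ', St.run, State.setReg, Ex.eval, h.order])
  set τ := St.reachability.run σ'
  clear_value τ
  rw [St.run, isSquareOfTreePlus_iff]
  by_cases hc : G.Connected
  · rw [if_pos (show 0 < Ex.connected.eval τ.reg τ.mem from h2.2 hc), run_decideConnected h1 hc]
    simp [hc]
  · rw [if_neg (show ¬ 0 < Ex.connected.eval τ.reg τ.mem from fun h => hc (h2.1 h))]
    simp [hc, St.run, State.setReg, Ex.eval]

/-- For fixed `k` the order of the kernel is bounded by a constant, and so is the cost of the
search. -/
theorem exists_cost_decideAny_le (k : ℕ) : ∃ C, ∀ {n : ℕ} {G : SimpleGraph (Fin n)} {σ : State},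
    Matrix n k (plainLabel G) σ.mem → St.decideAny.cost σ ≤ C * (n + 1) ^ 5 := by
  obtain ⟨C, hC⟩ := exists_cost_decideConnected_le
  have hR : St.reachability.Plain ∧ St.reachability.Wf 100 ∧ St.reachability.depth ≤ 5 := by decide
  set b := k + kernelBound k with hb
  refine ⟨St.reachability.size + 3 + Ex.connected.size + 1 +
    (C + C * (2 ^ (b * b) * (b + 1) ^ 3) + 2), fun {n G σ} h => ?_⟩
  have c1 := St.cost_load_seq_le hR.1 hR.2.1 hR.2.2 σ
  rw [h.order, St.cost] at c1
  have c0 : (St.set 1 (.ld (.lit 0))).cost σ = 3 := rfl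
  set σ' := (St.set 1 (.ld (.lit 0))).run σ with hσ'
  have hcost : St.decideAny.cost σ = 3 + (St.reachability.cost σ' +
    (St.ite .connected .decideConnected (.set 0 (.lit 0))).cost (St.reachability.run σ')) := rfl
  rw [hcost]
  have hn : σ'.reg 1 = n := by simp [hσ', St.run, State.setReg, Ex.eval, h.order]
  obtain ⟨h1, h2⟩ := run_reachability (σ := σ') (show Matrix n k (plainLabel G) σ'.mem from h) hn
  have h3 := (hR.1.simple hR.2.1).reg_one σ'
  rw [hn] at h3
  set τ := St.reachability.run σ'
  clear_value τ
  have c2 := (Ex.cost_le (show Ex.connected.Wf 100 by decide) τ.mem τ.reg 5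
    (by decide)).trans (Nat.mul_le_mul_left _
      (Nat.pow_le_pow_left (Nat.add_le_add_right h3 1) 5))
  have h5 : 1 ≤ (n + 1) ^ 5 := Nat.one_le_pow _ _ (by omega)
  have c3 : (if 0 < Ex.connected.eval τ.reg τ.mem then St.decideConnected.cost τ
      else (St.set 0 (.lit 0)).cost τ) ≤
        C * (n + 1) ^ 5 + C * (2 ^ (b * b) * (b + 1) ^ 3) + 2 := by
    split_ifs with hc
    · obtain ⟨c, hc1, hc2⟩ := hC h1 (h2.1 hc)
      have hcb : c ≤ b := by omega
      have := Nat.mul_le_mul_left C (Nat.mul_le_mul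
        (Nat.pow_le_pow_right (n := 2) (by omega) (Nat.mul_le_mul hcb hcb))
        (Nat.pow_le_pow_left (Nat.add_le_add_right hcb 1) 3))
      omega
    · have : (St.set 0 (.lit 0)).cost τ = 2 := rfl
      omega
  rw [St.cost]
  generalize C * (2 ^ (b * b) * (b + 1) ^ 3) = D at *
  generalize (n + 1) ^ 5 = N at *
  have h6 := Nat.le_mul_of_pos_right D h5
  simp only [add_mul] at c1 ⊢
  omega

end Recognition

/-! ### From cost bounds to the stated running times -/

section Transfer

variable {n k T : ℕ} {G : SimpleGraph (Fin n)}

theorem St.decidesWithin {p : St} (hp : p.Wf 100) {Q : Prop}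
    (hc : p.cost (inputState G k) ≤ T)
    (hr : (p.run (inputState G k)).reg 0 = if Q then 1 else 0) :
    DecidesWithin (p.compile 100) G k T Q := by
  obtain ⟨s, h1, h2⟩ := p.exec hp (inputState G k)
  refine ⟨_, s, h1, hc, fun hq => ?_, fun hq => ?_⟩
  · rw [h2.1 0 (by omega), hr, if_pos hq]
  · rw [h2.1 0 (by omega), hr, if_neg hq]

/-- A connected graph with at least two vertices satisfies `n ≤ 2 * m`; the summand `1` is for the
single vertex, where `m = 0`. -/
theorem succ_pow_five_le (hG : G.Connected) :
    (n + 1) ^ 5 ≤ 64 * (n ^ 4 * G.edgeSet.ncard + 1) := by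
  have h := two_mul_card_le_of_connected hG
  rw [adjCount_eq, Fintype.card_fin] at h
  have hn : 0 < n := hG.nonempty.some.pos
  rcases Nat.lt_or_ge n 2 with h2 | h2
  · obtain rfl : n = 1 := by omega
    omega
  · calc (n + 1) ^ 5 ≤ (2 * n) ^ 5 := Nat.pow_le_pow_left (by omega) 5
      _ = 32 * (n ^ 4 * n) := by ring
      _ ≤ 32 * (n ^ 4 * (2 * G.edgeSet.ncard)) := by gcongr; omega
      _ ≤ _ := by
        have : n ^ 4 * (2 * G.edgeSet.ncard) = 2 * (n ^ 4 * G.edgeSet.ncard) := by ring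
        omega

/-- The running time of the decision problem has no additive constant, so this one is absorbed into
the exponent. -/
theorem add_le_two_pow {a b x t : ℕ} (ht : 1 ≤ t) (ha : a ≤ 2 ^ (x * t)) (hx : 1 ≤ x) :
    a + b ≤ 2 ^ ((x + (b + 1)) * t) := by
  have h1 : b + 1 ≤ 2 ^ ((b + 1) * t) :=
    (Nat.lt_two_pow_self (n := b + 1)).le.trans
      (Nat.pow_le_pow_right (by omega) (Nat.le_mul_of_pos_right _ ht))
  have h2 : 2 ≤ 2 ^ (x * t) := by
    have := Nat.pow_le_pow_right (n := 2) (by omega) (Nat.mul_le_mul hx ht)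
    simpa using this
  rw [add_mul, pow_add]
  nlinarith

/-- From `c ≤ 70 * (k * k + 1)` the exponent `c * c + 3 * c` is `O(k ^ 4)`, with room to spare in
`20000`. -/
theorem search_bound {c k : ℕ} (C : ℕ) (hc : c ≤ k ∨ c ≤ kernelBound k) :
    C * (2 ^ (c * c) * (c + 1) ^ 3) ≤ 2 ^ ((C + 20000) * (k ^ 4 + 1)) := by
  have h1 : c ≤ 70 * (k * k + 1) := by
    unfold kernelBound at hc
    rcases hc with h | h <;> nlinarith
  have h2 : c * c + 3 * c ≤ 20000 * (k ^ 4 + 1) := by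
    have e : k ^ 4 = (k * k) * (k * k) := by ring
    rw [e]
    generalize k * k = x at *
    nlinarith [Nat.mul_le_mul h1 h1]
  calc C * (2 ^ (c * c) * (c + 1) ^ 3) ≤ 2 ^ C * (2 ^ (c * c) * (2 ^ c) ^ 3) := by
        gcongr
        · exact Nat.lt_two_pow_self.le
        · exact Nat.lt_two_pow_self
    _ = 2 ^ (C + (c * c + 3 * c)) := by
        rw [pow_add, pow_add, ← pow_mul, mul_comm c 3]
    _ ≤ _ := by
        refine Nat.pow_le_pow_right (by omega) ?_
        rw [add_mul]
        have := Nat.le_mul_of_pos_right C (show 0 < k ^ 4 + 1 by omega)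
        omega

end Transfer

end TreePlusK

theorem theorem1 :
    -- the decision problem is solved in time `2 ^ O(k ^ 4) + O(n ^ 4 * m)`
    (∃ (p : TreePlusK.Prog) (C : ℕ), ∀ (n : ℕ) (G : SimpleGraph (Fin n)) (k : ℕ), G.Connected →
      TreePlusK.DecidesWithin p G k
        (2 ^ (C * (k ^ 4 + 1)) + C * (n ^ 4 * G.edgeSet.ncard)) (TreePlusK.YesInstance G k)) ∧
    -- there is a generalized kernel of quadratic size, computed in time `O(n ^ 4 * m)`
    (∃ (p : TreePlusK.Prog) (C : ℕ), ∀ (n : ℕ) (G : SimpleGraph (Fin n)) (k : ℕ), G.Connected →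
      ∃ (n' : ℕ) (L : TreePlusK.LabelledGraph n'),
        (n' : ℤ) ≤ (15 * (k : ℤ) - 14) * (15 * (k : ℤ) - 12) ∧
        (TreePlusK.YesInstance G k ↔ TreePlusK.LabelledYesInstance L k) ∧
        TreePlusK.OutputsWithin p G k (C * (n ^ 4 * G.edgeSet.ncard + 1)) L) ∧
    -- for fixed `k`, squares of trees plus at most `k` edges are recognized in polynomial time
    (∀ k : ℕ, ∃ (p : TreePlusK.Prog) (C d : ℕ), ∀ (n : ℕ) (G : SimpleGraph (Fin n)),
      TreePlusK.DecidesWithin p G k (C * (n + 1) ^ d) (TreePlusK.IsSquareOfTreePlus k G)) := by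
  refine ⟨?_, ?_, fun k => ?_⟩
  · obtain ⟨C, hC⟩ := TreePlusK.exists_cost_decideConnected_le
    -- `C + 20000` comes from `search_bound`, and `64 * C + 1` from absorbing the additive constant
    -- of `succ_pow_five_le`.
    refine ⟨TreePlusK.St.decideConnected.compile 100, C + 20000 + (64 * C + 1),
      fun n G k hG => ?_⟩
    have hm := TreePlusK.matrix_inputState G k
    refine TreePlusK.St.decidesWithin (by decide) ?_ (TreePlusK.run_decideConnected hm hG)
    obtain ⟨c, hc, h1⟩ := hC hm hG
    have h2 := TreePlusK.search_bound C hc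
    have h3 := TreePlusK.add_le_two_pow (b := 64 * C) (show 1 ≤ k ^ 4 + 1 by omega) h2 (by omega)
    have h4 := Nat.mul_le_mul_left C (TreePlusK.succ_pow_five_le hG)
    generalize n ^ 4 * G.edgeSet.ncard = M at *
    have h5 : C * (64 * (M + 1)) = 64 * C * M + 64 * C := by ring
    have h6 := Nat.mul_le_mul_right M (show 64 * C ≤ C + 20000 + (64 * C + 1) by omega)
    omega
  · obtain ⟨C, hC⟩ := TreePlusK.exists_cost_smallKernel_le
    refine ⟨TreePlusK.St.smallKernel.compile 100, C * 64, fun n G k hG => ?_⟩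
    have hm := TreePlusK.matrix_inputState G k
    obtain ⟨c, ℓ, h1, h2, h3, h4⟩ := TreePlusK.run_smallKernel hm hG
    refine ⟨c, .ofLabel ℓ h1.symm h1.self h1.connected, h2,
      h3.symm.trans TreePlusK.labelledYesInstance_ofLabel.symm, ?_⟩
    obtain ⟨s, q1, q2⟩ := TreePlusK.St.exec TreePlusK.St.smallKernel (d := 100) (by decide)
      (TreePlusK.inputState G k)
    refine ⟨_, s, q1, (hC hm hG).trans ?_, ?_⟩
    · rw [mul_assoc]
      exact Nat.mul_le_mul_left C (TreePlusK.succ_pow_five_le hG)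
    · rw [← q2.2] at h4
      exact TreePlusK.holds_ofLabel h1.le h4.order h4.parameter h4.entry
  · obtain ⟨C, hC⟩ := TreePlusK.exists_cost_decideAny_le k
    refine ⟨TreePlusK.St.decideAny.compile 100, C, 5, fun n G => ?_⟩
    have hm := TreePlusK.matrix_inputState G k
    exact TreePlusK.St.decidesWithin (by decide) (hC hm) (TreePlusK.run_decideAny hm)
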